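/- Let $P_{XY_1Y_2Z_1}$ be a pmf on a finite product alphabet $\mathcal X\times\mathcal Y_1\times\mathcal Y_2\times\mathcal Z_1$ and let $R\ge 0$. Under the hypothesis $\mathcal H=0$ the tuples $(X_t,Y_{1,t},Y_{2,t},Z_{1,t})$, $t=1,\dots,n$, are i.i.d. with pmf $P_{XY_1Y_2Z_1}$; under $\mathcal H=1$ they are i.i.d. with pmf $P_{XZ_1}P_{Y_1|Z_1}P_{Y_2}$. A code of blocklength $n$ consists of a (possibly stochastic) encoder, which maps $X^n$ to a message $M\in\{0,1,\dots,\lfloor 2^{nR}\rfloor\}$, and of two decision functions $\hat{\mathcal H}_1=g_1(Y_1^n,Z_1^n,M)\in\{0,1\}$ and $\hat{\mathcal H}_2=g_2(Y_2^n,M)\in\{0,1\}$. Put $\alpha_{i,n}=\Pr[\hat{\mathcal H}_i=1\mid\mathcal H=0]$ and $\beta_{i,n}=\Pr[\hat{\mathcal H}_i=0\mid\mathcal H=1]$ for $i\in\{1,2\}$. For $\epsilon\in(0,1)$, the tuple $(\theta_1,\theta_2,R)$ is called $\epsilon$-achievable if there is a sequence of codes such that $\alpha_{i,n}\le\epsilon$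 for all sufficiently large $n$ and $-\limsup_{n\to\infty}\frac1n\log_2\beta_{i,n}\ge\theta_i$ for $i\in\{1,2\}$ (with $\log_2 0=-\infty$). Let $\mathcal E_{\mathrm{HB}}(R)$ be the closure of the set of all pairs $(\theta_1,\theta_2)$ with $\theta_1,\theta_2\ge0$ such that $(\theta_1,\theta_2,R)$ is $\epsilon$-achievable for every $\epsilon\in(0,1)$. Let $\mathcal E^{\mathrm{in}}_{\mathrm{HB}}(R)$ be the set of all pairs $(\theta_1,\theta_2)$ with $\theta_1,\theta_2\ge0$ for which there exist finite-valued auxiliary random variables $U_0,U_1$ forming a Markov chain $(U_0,U_1)\to X\to(Y_1,Y_2,Z_1)$ with $$\theta_1\le I(U_0,U_1;Y_1|Z_1),\qquad \theta_2\le I(U_0;Y_2),\qquad R\ge I(U_0;X)+I(U_1;X|U_0,Z_1),$$ where $(X,Y_1,Y_2,Z_1)\sim P_{XY_1Y_2Z_1}$ and all information quantities are in bits. Suppose that $Z_1$ is less noisy than $Y_2$, that is, $I(U;Z_1)\ge I(U;Y_2)$ for every finite-valued random variable $U$ forming a Markov chain $U\to X\to(Y_1,Y_2,Z_1)$ with $(X,Y_1,Y_2,Z_1)\sim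 P_{XY_1Y_2Z_1}$. Then $$\mathcal E^{\mathrm{in}}_{\mathrm{HB}}(R)=\mathcal E_{\mathrm{HB}}(R).$$ -/

import Mathlib

noncomputable section

namespace HeegardBerger

/-! A pmf on a finite set `Ω` is a point of `stdSimplex ℝ Ω`; a random variable on the finite
probability space `(Ω, p)` is a function on `Ω`. All logarithms are to base 2. -/

open Classical in
/-- The pmf of the random variable `A`: `law p A a = Pr[A = a]`. -/
def law {Ω α : Type*} [Fintype Ω] (p : Ω → ℝ) (A : Ω → α) (a : α) : ℝ :=
  ∑ ω with A ω = a, p ω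

/-- Entropy `H(A)`. -/
def entropy {Ω α : Type*} [Fintype Ω] [Fintype α] (p : Ω → ℝ) (A : Ω → α) : ℝ :=
  -∑ a, law p A a * Real.logb 2 (law p A a)

/-- Conditional entropy `H(A | B)`. -/
def condEntropy {Ω α β : Type*} [Fintype Ω] [Fintype α] [Fintype β]
    (p : Ω → ℝ) (A : Ω → α) (B : Ω → β) : ℝ :=
  -∑ a, ∑ b, law p (fun ω => (A ω, B ω)) (a, b) *
    Real.logb 2 (law p (fun ω => (A ω, B ω)) (a, b) / law p B b)

/-- Mutual information `I(A; B)`. -/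
def mutualInfo {Ω α β : Type*} [Fintype Ω] [Fintype α] [Fintype β]
    (p : Ω → ℝ) (A : Ω → α) (B : Ω → β) : ℝ :=
  entropy p A - condEntropy p A B

/-- Conditional mutual information `I(A; B | C)`. -/
def condMutualInfo {Ω α β γ : Type*} [Fintype Ω] [Fintype α] [Fintype β] [Fintype γ]
    (p : Ω → ℝ) (A : Ω → α) (B : Ω → β) (C : Ω → γ) : ℝ :=
  condEntropy p A C - condEntropy p A (fun ω => (B ω, C ω))

/-- The Markov chain `A → B → C`: given `B`, the variables `A` and `C` are independent. -/
def IsMarkovChain {Ω α β γ : Type*} [Fintype Ω]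
    (p : Ω → ℝ) (A : Ω → α) (B : Ω → β) (C : Ω → γ) : Prop :=
  ∀ a b c, law p (fun ω => (A ω, B ω, C ω)) (a, b, c) * law p B b =
    law p (fun ω => (A ω, B ω)) (a, b) * law p (fun ω => (B ω, C ω)) (b, c)

/-- The alphabet of one source letter `(X, Y₁, Y₂, Z₁)`. -/
abbrev Src (𝒳 𝒴₁ 𝒴₂ 𝒵₁ : Type*) := 𝒳 × 𝒴₁ × 𝒴₂ × 𝒵₁

section Source

variable {𝒳 𝒴₁ 𝒴₂ 𝒵₁ : Type*}

/-- The component `X`. -/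
def Xc (w : Src 𝒳 𝒴₁ 𝒴₂ 𝒵₁) : 𝒳 := w.1

/-- The component `Y₁`. -/
def Y1c (w : Src 𝒳 𝒴₁ 𝒴₂ 𝒵₁) : 𝒴₁ := w.2.1

/-- The component `Y₂`. -/
def Y2c (w : Src 𝒳 𝒴₁ 𝒴₂ 𝒵₁) : 𝒴₂ := w.2.2.1

/-- The component `Z₁`. -/
def Z1c (w : Src 𝒳 𝒴₁ 𝒴₂ 𝒵₁) : 𝒵₁ := w.2.2.2

variable [Fintype 𝒳] [Fintype 𝒴₁] [Fintype 𝒴₂] [Fintype 𝒵₁]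

/-- The law `P_{X Z₁} P_{Y₁ | Z₁} P_{Y₂}` of one source letter under the alternative hypothesis
(where `P_{Z₁}(z) = 0` the first factor vanishes, so the value of the quotient is immaterial). -/
def altLaw (P : Src 𝒳 𝒴₁ 𝒴₂ 𝒵₁ → ℝ) (w : Src 𝒳 𝒴₁ 𝒴₂ 𝒵₁) : ℝ :=
  law P (fun v => (Xc v, Z1c v)) (Xc w, Z1c w) *
    (law P (fun v => (Y1c v, Z1c v)) (Y1c w, Z1c w) / law P Z1c (Z1c w)) *
    law P Y2c (Y2c w)

end Source

/-- The message set `{0, …, 2^{nR}}`. -/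
abbrev Message (n : ℕ) (R : ℝ) := Fin (⌊(2 : ℝ) ^ ((n : ℝ) * R)⌋₊ + 1)

/-- A code of blocklength `n` and rate `R`: a stochastic encoder, given by the conditional pmf
`enc x` of the message for the source sequence `x`, and two decision rules. -/
structure Code (𝒳 𝒴₁ 𝒴₂ 𝒵₁ : Type*) (n : ℕ) (R : ℝ) where
  enc : (Fin n → 𝒳) → Message n R → ℝ
  enc_mem : ∀ x, enc x ∈ stdSimplex ℝ (Message n R)
  dec₁ : (Fin n → 𝒴₁) → (Fin n → 𝒵₁) → Message n R → Fin 2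
  dec₂ : (Fin n → 𝒴₂) → Message n R → Fin 2

namespace Code

variable {𝒳 𝒴₁ 𝒴₂ 𝒵₁ : Type*} {n : ℕ} {R : ℝ} (c : Code 𝒳 𝒴₁ 𝒴₂ 𝒵₁ n R)

/-- The joint pmf of the `n` source letters and the message, when the letters are i.i.d. with
pmf `Q`. -/
def jointLaw (Q : Src 𝒳 𝒴₁ 𝒴₂ 𝒵₁ → ℝ) (ω : (Fin n → Src 𝒳 𝒴₁ 𝒴₂ 𝒵₁) × Message n R) : ℝ :=
  (∏ t, Q (ω.1 t)) * c.enc (fun t => Xc (ω.1 t)) ω.2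

/-- The decision of receiver 1. -/
def decision₁ (ω : (Fin n → Src 𝒳 𝒴₁ 𝒴₂ 𝒵₁) × Message n R) : Fin 2 :=
  c.dec₁ (fun t => Y1c (ω.1 t)) (fun t => Z1c (ω.1 t)) ω.2

/-- The decision of receiver 2. -/
def decision₂ (ω : (Fin n → Src 𝒳 𝒴₁ 𝒴₂ 𝒵₁) × Message n R) : Fin 2 :=
  c.dec₂ (fun t => Y2c (ω.1 t)) ω.2

variable [Fintype 𝒳] [Fintype 𝒴₁] [Fintype 𝒴₂] [Fintype 𝒵₁]

/-- Type-I error probability at receiver 1. -/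
def typeI₁ (P : Src 𝒳 𝒴₁ 𝒴₂ 𝒵₁ → ℝ) : ℝ := law (c.jointLaw P) c.decision₁ 1

/-- Type-I error probability at receiver 2. -/
def typeI₂ (P : Src 𝒳 𝒴₁ 𝒴₂ 𝒵₁ → ℝ) : ℝ := law (c.jointLaw P) c.decision₂ 1

/-- Type-II error probability at receiver 1. -/
def typeII₁ (P : Src 𝒳 𝒴₁ 𝒴₂ 𝒵₁ → ℝ) : ℝ := law (c.jointLaw (altLaw P)) c.decision₁ 0

/-- Type-II error probability at receiver 2. -/
def typeII₂ (P : Src 𝒳 𝒴₁ 𝒴₂ 𝒵₁ → ℝ) : ℝ := law (c.jointLaw (altLaw P)) c.decision₂ 0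

end Code

open Classical in
/-- The base-2 logarithm of a nonnegative real, with `log 0 = -∞`. -/
def elog2 (b : ℝ) : EReal := if b = 0 then ⊥ else (Real.logb 2 b : EReal)

/-- The exponent `-limsup_n (1/n) log β_n` of a sequence of probabilities. -/
def errorExponent (β : ℕ → ℝ) : EReal :=
  -Filter.limsup (fun n : ℕ => ((1 / (n : ℝ) : ℝ) : EReal) * elog2 (β n)) Filter.atTop

section Regions

variable {𝒳 𝒴₁ 𝒴₂ 𝒵₁ : Type*} [Fintype 𝒳] [Fintype 𝒴₁] [Fintype 𝒴₂] [Fintype 𝒵₁]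

/-- `(θ₁, θ₂, R)` is `ε`-achievable over the Heegard-Berger network. -/
def EpsAchievable (P : Src 𝒳 𝒴₁ 𝒴₂ 𝒵₁ → ℝ) (ε θ₁ θ₂ R : ℝ) : Prop :=
  ∃ c : (n : ℕ) → Code 𝒳 𝒴₁ 𝒴₂ 𝒵₁ n R,
    (∀ᶠ n in Filter.atTop, (c n).typeI₁ P ≤ ε ∧ (c n).typeI₂ P ≤ ε) ∧
    (θ₁ : EReal) ≤ errorExponent (fun n => (c n).typeII₁ P) ∧
    (θ₂ : EReal) ≤ errorExponent (fun n => (c n).typeII₂ P)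

/-- The exponents region `E_HB(R)`. -/
def region (P : Src 𝒳 𝒴₁ 𝒴₂ 𝒵₁ → ℝ) (R : ℝ) : Set (ℝ × ℝ) :=
  closure {θ | 0 ≤ θ.1 ∧ 0 ≤ θ.2 ∧ ∀ ε ∈ Set.Ioo (0 : ℝ) 1, EpsAchievable P ε θ.1 θ.2 R}

/-- `Q` is the joint pmf of an auxiliary random variable `U` and `(X, Y₁, Y₂, Z₁)`, where the
latter has pmf `P` and `U → X → (Y₁, Y₂, Z₁)` is a Markov chain. -/
def IsAuxiliary {𝒰 : Type*} [Fintype 𝒰] (P : Src 𝒳 𝒴₁ 𝒴₂ 𝒵₁ → ℝ)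
    (Q : 𝒰 × Src 𝒳 𝒴₁ 𝒴₂ 𝒵₁ → ℝ) : Prop :=
  Q ∈ stdSimplex ℝ (𝒰 × Src 𝒳 𝒴₁ 𝒴₂ 𝒵₁) ∧
  (∀ w, law Q Prod.snd w = P w) ∧
  IsMarkovChain Q Prod.fst (fun ω => Xc ω.2) (fun ω => (Y1c ω.2, Y2c ω.2, Z1c ω.2))

/-- The inner bound `E_HB^in(R)`. The auxiliary variables `U₀`, `U₁` range over all finite
alphabets, which are labelled `Fin k₀`, `Fin k₁`. -/
def innerRegion (P : Src 𝒳 𝒴₁ 𝒴₂ 𝒵₁ → ℝ) (R : ℝ) : Set (ℝ × ℝ) :=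
  {θ | 0 ≤ θ.1 ∧ 0 ≤ θ.2 ∧
    ∃ (k₀ k₁ : ℕ) (Q : (Fin k₀ × Fin k₁) × Src 𝒳 𝒴₁ 𝒴₂ 𝒵₁ → ℝ), IsAuxiliary P Q ∧
      θ.1 ≤ condMutualInfo Q (fun ω => (ω.1.1, ω.1.2)) (fun ω => Y1c ω.2) (fun ω => Z1c ω.2) ∧
      θ.2 ≤ mutualInfo Q (fun ω => ω.1.1) (fun ω => Y2c ω.2) ∧
      mutualInfo Q (fun ω => ω.1.1) (fun ω => Xc ω.2) +
        condMutualInfo Q (fun ω => ω.1.2) (fun ω => Xc ω.2) (fun ω => (ω.1.1, Z1c ω.2)) ≤ R}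

/-- `Z₁` is less noisy than `Y₂`: `I(U; Z₁) ≥ I(U; Y₂)` for every finite-valued `U` such that
`U → X → (Y₁, Y₂, Z₁)`. -/
def LessNoisy (P : Src 𝒳 𝒴₁ 𝒴₂ 𝒵₁ → ℝ) : Prop :=
  ∀ (k : ℕ) (Q : Fin k × Src 𝒳 𝒴₁ 𝒴₂ 𝒵₁ → ℝ), IsAuxiliary P Q →
    mutualInfo Q Prod.fst (fun ω => Y2c ω.2) ≤ mutualInfo Q Prod.fst (fun ω => Z1c ω.2)

end Regions

end HeegardBerger

end

/-! By the chain `U₀ → X → Z₁`, the rate in the inner bound equals I(U₀;Z₁) + I(U₀,U₁;X|Z₁)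
(`rate_eq`). The region therefore depends only on H(Y₂|U₀), H(Z₁|U₀), H(X|Z₁,U₀,U₁) and
H(Y₁|Z₁,U₀,U₁). Conditioning on an auxiliary variable writes `P` as a mixture of laws with the same
conditional law given X, and conditional entropies are averages over the mixture. The attainable
tuples thus form a convex hull, taken once for U₁ and once for U₀ (`hull₀`). By Carathéodory's
theorem it is compact and finite alphabets exhaust it, so the inner region is closed; its convexity
does the work of time sharing.

Converse. Comparing divergences bounds the exponents by I(M;Y₁ⁿ|Z₁ⁿ)/n and I(M;Y₂ⁿ)/n, up to a
factor 1-ε and terms of order 1/n. Take U₀ = (M, past of Y₂, future of Z₁) and let U₁ hold the past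
of (Y₁,Y₂) and the other letters of Z₁. By Csiszár's sum identity, I(M;Y₂ⁿ)/n and I(M;Z₁ⁿ)/n are the
averages of I(U₀;Y₂) and I(U₀;Z₁) diminished by the same τ ≥ 0. So τ is lost in θ₂ but also saved in
the rate. To match this, U₀ is erased with probability l = τ/I(U₀;Y₂), while U₁ receives the
unerased pair. Then I(U₀;Y₂) drops by exactly τ, and I(U₀;Z₁) drops by l I(U₀;Z₁) ≥ τ because Z₁ is
less noisy than Y₂. The terms in (U₀,U₁) do not change. This is `mem_triples_of_code`, resting on
`sum_cEnt_auxV`, `erase_mem_hull₀` and `LessNoisy.sub_le_sub`.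

Achievability. A random superposition codebook has cloud centres U₀ and satellites U₁ collected in
bins; a message names a centre and a bin. A likelihood encoder is analysed by soft covering: the
true source law is close to the law obtained by sending a uniformly chosen codeword through the
reverse channel. Receiver 1 finds the satellite in its bin with the help of Z₁. Both receivers apply
likelihood-ratio tests, whose type-II error is at most the threshold whatever the message
(`exists_oneShot_code`, `exists_code_of_isAuxiliary`, `eventually_exists_code`). For R > 0, slack in
the rate comes from shrinking (θ₁,θ₂,R) towards 0. For R = 0 the exponents must vanish, again by
less noisiness. -/

noncomputable section

namespace HeegardBerger

open Finset

/-! ### Entropy inequalities on a finite probability space. -/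

section Entropy

variable {Ω α β γ δ : Type*} [Fintype Ω]

theorem law_eq_sum_ite (p : Ω → ℝ) (A : Ω → α) (a : α) [∀ ω, Decidable (A ω = a)] :
    law p A a = ∑ ω, if A ω = a then p ω else 0 := by
  rw [law, sum_filter]
  exact sum_congr rfl fun ω _ => by congr

theorem law_nonneg {p : Ω → ℝ} (hp : ∀ ω, 0 ≤ p ω) (A : Ω → α) (a : α) : 0 ≤ law p A a :=
  sum_nonneg fun ω _ => hp ω

theorem le_law {p : Ω → ℝ} (hp : ∀ ω, 0 ≤ p ω) (A : Ω → α) (ω : Ω) : p ω ≤ law p A (A ω) := by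
  classical
  exact single_le_sum (f := p) (fun ω _ => hp ω) (by simp)

theorem law_pos {p : Ω → ℝ} (hp : ∀ ω, 0 ≤ p ω) (A : Ω → α) {ω : Ω} (h : 0 < p ω) :
    0 < law p A (A ω) := h.trans_le (le_law hp A ω)

theorem sum_law_mul [Fintype α] (p : Ω → ℝ) (A : Ω → α) (g : α → ℝ) :
    ∑ a, law p A a * g a = ∑ ω, p ω * g (A ω) := by
  classical
  simp only [law_eq_sum_ite, sum_mul]
  rw [sum_comm]
  refine sum_congr rfl fun ω _ => ?_
  simp [ite_mul]

theorem sum_law [Fintype α] (p : Ω → ℝ) (A : Ω → α) : ∑ a, law p A a = ∑ ω, p ω := by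
  simpa using sum_law_mul p A fun _ => 1

theorem law_mem_stdSimplex [Fintype α] {p : Ω → ℝ} (hp : p ∈ stdSimplex ℝ Ω) (A : Ω → α) :
    law p A ∈ stdSimplex ℝ α :=
  ⟨law_nonneg hp.1 A, by rw [sum_law, hp.2]⟩

theorem law_law [Fintype α] (p : Ω → ℝ) (A : Ω → α) (f : α → β) (b : β) :
    law (law p A) f b = law p (fun ω => f (A ω)) b := by
  classical
  rw [law_eq_sum_ite, law_eq_sum_ite]
  simpa using sum_law_mul p A fun a => if f a = b then 1 else 0

theorem law_congr (p : Ω → ℝ) (A : Ω → α) (B : Ω → β) (a : α) (b : β)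
    (h : ∀ ω, A ω = a ↔ B ω = b) : law p A a = law p B b := by
  classical
  simp only [law_eq_sum_ite, h]

theorem sum_law_pair [Fintype β] (p : Ω → ℝ) (A : Ω → α) (B : Ω → β) (a : α) :
    ∑ b, law p (fun ω => (A ω, B ω)) (a, b) = law p A a := by
  classical
  simp only [law_eq_sum_ite]
  rw [sum_comm]
  refine sum_congr rfl fun ω _ => ?_
  by_cases h : A ω = a <;> simp [h, Prod.ext_iff]

theorem sum_law_pair' [Fintype β] (p : Ω → ℝ) (A : Ω → α) (B : Ω → β) (a : α) :
    ∑ b, law p (fun ω => (B ω, A ω)) (b, a) = law p A a := by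
  rw [← sum_law_pair p A B a]
  exact sum_congr rfl fun b _ => law_congr _ _ _ _ _ fun ω => by simp [and_comm]

theorem entropy_eq_sum [Fintype α] (p : Ω → ℝ) (A : Ω → α) :
    entropy p A = -∑ ω, p ω * Real.logb 2 (law p A (A ω)) := by
  rw [entropy, sum_law_mul p A fun a => Real.logb 2 (law p A a)]

theorem entropy_law [Fintype α] [Fintype β] (p : Ω → ℝ) (A : Ω → α) (f : α → β) :
    entropy (law p A) f = entropy p (fun ω => f (A ω)) := by
  simp only [entropy, law_law]

/-- Random variables that determine each other have the same entropy. -/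
theorem entropy_congr [Fintype α] [Fintype β] (p : Ω → ℝ) (A : Ω → α) (B : Ω → β)
    (h : ∀ ω ω', A ω = A ω' ↔ B ω = B ω') : entropy p A = entropy p B := by
  rw [entropy_eq_sum, entropy_eq_sum]
  congr 1
  refine sum_congr rfl fun ω _ => ?_
  rw [law_congr p A B (A ω) (B ω) fun ω' => h ω' ω]

theorem condEntropy_eq [Fintype α] [Fintype β] {p : Ω → ℝ} (hp : ∀ ω, 0 ≤ p ω)
    (A : Ω → α) (B : Ω → β) :
    condEntropy p A B = entropy p (fun ω => (A ω, B ω)) - entropy p B := by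
  have h : condEntropy p A B = -∑ ω, p ω * Real.logb 2
      (law p (fun ω => (A ω, B ω)) (A ω, B ω) / law p B (B ω)) := by
    rw [condEntropy, ← sum_law_mul p (fun ω => (A ω, B ω)) fun c => Real.logb 2
      (law p (fun ω => (A ω, B ω)) c / law p B c.2), Fintype.sum_prod_type]
  rw [h, entropy_eq_sum, entropy_eq_sum, ← neg_sub', ← sum_sub_distrib]
  congr 1
  refine sum_congr rfl fun ω _ => ?_
  rcases (hp ω).eq_or_lt with h0 | h0
  · simp [← h0]
  · rw [Real.logb_div (law_pos hp (fun ω => (A ω, B ω)) h0).ne' (law_pos hp B h0).ne']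
    ring

theorem mutualInfo_eq [Fintype α] [Fintype β] {p : Ω → ℝ} (hp : ∀ ω, 0 ≤ p ω)
    (A : Ω → α) (B : Ω → β) :
    mutualInfo p A B = entropy p A + entropy p B - entropy p (fun ω => (A ω, B ω)) := by
  rw [mutualInfo, condEntropy_eq hp]; ring

theorem condMutualInfo_eq [Fintype α] [Fintype β] [Fintype γ] {p : Ω → ℝ} (hp : ∀ ω, 0 ≤ p ω)
    (A : Ω → α) (B : Ω → β) (C : Ω → γ) :
    condMutualInfo p A B C = entropy p (fun ω => (A ω, C ω)) + entropy p (fun ω => (B ω, C ω))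
      - entropy p (fun ω => (A ω, B ω, C ω)) - entropy p C := by
  rw [condMutualInfo, condEntropy_eq hp, condEntropy_eq hp]; ring

/-- Gibbs' inequality. -/
theorem sum_mul_logb_div_nonpos {p q : Ω → ℝ} (hp : ∀ ω, 0 ≤ p ω) (hq : ∀ ω, 0 ≤ q ω)
    (h : ∀ ω, 0 < p ω → 0 < q ω) (hpq : ∑ ω, q ω ≤ ∑ ω, p ω) :
    ∑ ω, p ω * Real.logb 2 (q ω / p ω) ≤ 0 := by
  have hl : 0 < Real.log 2 := Real.log_pos (by norm_num)
  have key : ∀ ω, p ω * Real.logb 2 (q ω / p ω) ≤ (q ω - p ω) / Real.log 2 := by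
    intro ω
    rcases (hp ω).eq_or_lt with h0 | h0
    · simp only [← h0, zero_mul, sub_zero]
      exact div_nonneg (hq ω) hl.le
    · rw [Real.logb, ← mul_div_assoc]
      gcongr
      calc p ω * Real.log (q ω / p ω) ≤ p ω * (q ω / p ω - 1) :=
            mul_le_mul_of_nonneg_left (Real.log_le_sub_one_of_pos (div_pos (h ω h0) h0)) h0.le
        _ = q ω - p ω := by field_simp
  calc _ ≤ ∑ ω, (q ω - p ω) / Real.log 2 := sum_le_sum fun ω _ => key ω
    _ = (∑ ω, q ω - ∑ ω, p ω) / Real.log 2 := by rw [← sum_div, sum_sub_distrib]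
    _ ≤ 0 := div_nonpos_of_nonpos_of_nonneg (by linarith) hl.le

/-- Strong subadditivity of entropy. -/
theorem entropy_submodular [Fintype α] [Fintype β] [Fintype γ] {p : Ω → ℝ} (hp : ∀ ω, 0 ≤ p ω)
    (A : Ω → α) (B : Ω → β) (C : Ω → γ) :
    entropy p (fun ω => (A ω, B ω, C ω)) + entropy p C ≤
      entropy p (fun ω => (A ω, C ω)) + entropy p (fun ω => (B ω, C ω)) := by
  set T : Ω → α × β × γ := fun ω => (A ω, B ω, C ω)
  -- `q` makes `A` and `B` independent given `C` with unchanged pair marginals; the claim is Gibbs'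
  -- inequality for the law of `T` against `q`.
  set q : α × β × γ → ℝ := fun c => law p (fun ω => (A ω, C ω)) (c.1, c.2.2) *
    law p (fun ω => (B ω, C ω)) c.2 / law p C c.2.2
  have hT : ∀ ω, 0 ≤ law p T ω := law_nonneg hp T
  have hq : ∀ c, 0 ≤ q c := fun c =>
    div_nonneg (mul_nonneg (law_nonneg hp _ _) (law_nonneg hp _ _)) (law_nonneg hp _ _)
  have hqs : ∑ c, q c ≤ ∑ c, law p T c := by
    have hs : ∑ c, q c = ∑ c, (∑ a, law p (fun ω => (A ω, C ω)) (a, c)) *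
        (∑ b, law p (fun ω => (B ω, C ω)) (b, c)) / law p C c := by
      simp only [q, Fintype.sum_prod_type, sum_mul_sum, sum_div]
      rw [sum_comm (s := (univ : Finset γ))]
      exact sum_congr rfl fun a _ => sum_comm
    rw [hs, sum_law, ← sum_law p C]
    refine sum_le_sum fun c _ => ?_
    rw [sum_law_pair' p C A c, sum_law_pair' p C B c]
    by_cases h : law p C c = 0
    · simp [h]
    · rw [mul_div_assoc, div_self h, mul_one]
  have hpos : ∀ ω, 0 < p ω → 0 < q (T ω) := fun ω h0 =>
    div_pos (mul_pos (law_pos hp (fun ω => (A ω, C ω)) h0) (law_pos hp (fun ω => (B ω, C ω)) h0))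
      (law_pos hp C h0)
  have hpq : ∀ c, 0 < law p T c → 0 < q c := by
    intro c hc
    by_contra hn
    refine hc.ne' ?_
    rw [law]
    refine sum_eq_zero fun ω hω => ?_
    simp only [mem_filter, mem_univ, true_and] at hω
    subst hω
    by_contra h0
    exact hn (hpos ω ((hp ω).lt_of_ne' h0))
  have key := sum_mul_logb_div_nonpos hT hq hpq hqs
  rw [sum_law_mul p T fun c => Real.logb 2 (q c / law p T c)] at key
  have e : ∑ ω, p ω * Real.logb 2 (q (T ω) / law p T (T ω)) =
      entropy p T + entropy p C - entropy p (fun ω => (A ω, C ω)) -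
        entropy p (fun ω => (B ω, C ω)) := by
    simp only [entropy_eq_sum]
    rw [← sub_eq_zero]
    simp only [sub_eq_add_neg, neg_neg, neg_add, ← sum_neg_distrib, ← sum_add_distrib]
    refine sum_eq_zero fun ω _ => ?_
    rcases (hp ω).eq_or_lt with h0 | h0
    · simp [← h0]
    · have h1 := (law_pos hp (fun ω => (A ω, C ω)) h0).ne'
      have h2 := (law_pos hp (fun ω => (B ω, C ω)) h0).ne'
      have h3 := (law_pos hp C h0).ne'
      rw [Real.logb_div (hpos ω h0).ne' (law_pos hp T h0).ne', Real.logb_div (mul_ne_zero h1 h2) h3,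
        Real.logb_mul h1 h2]
      ring
  linarith

/-- Entropies of random variables whose laws satisfy a product identity. -/
theorem entropy_add_eq [Fintype α] [Fintype β] [Fintype γ] [Fintype δ] {p : Ω → ℝ}
    (hp : ∀ ω, 0 ≤ p ω) (A : Ω → α) (B : Ω → β) (C : Ω → γ) (D : Ω → δ)
    (h : ∀ ω, law p A (A ω) * law p B (B ω) = law p C (C ω) * law p D (D ω)) :
    entropy p A + entropy p B = entropy p C + entropy p D := by
  simp only [entropy_eq_sum, ← neg_add, ← sum_add_distrib, ← mul_add]
  congr 1
  refine sum_congr rfl fun ω _ => ?_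
  rcases (hp ω).eq_or_lt with h0 | h0
  · simp [← h0]
  · rw [← Real.logb_mul (law_pos hp A h0).ne' (law_pos hp B h0).ne',
      ← Real.logb_mul (law_pos hp C h0).ne' (law_pos hp D h0).ne', h]

theorem IsMarkovChain.entropy_eq [Fintype α] [Fintype β] [Fintype γ] {p : Ω → ℝ}
    (hp : ∀ ω, 0 ≤ p ω) {A : Ω → α} {B : Ω → β} {C : Ω → γ} (h : IsMarkovChain p A B C) :
    entropy p (fun ω => (A ω, B ω, C ω)) + entropy p B =
      entropy p (fun ω => (A ω, B ω)) + entropy p (fun ω => (B ω, C ω)) :=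
  entropy_add_eq hp _ _ _ _ fun _ => h _ _ _

/-- Conditioning on more reduces entropy. -/
theorem entropy_sub_anti [Fintype α] [Fintype β] [Fintype γ] {p : Ω → ℝ} (hp : ∀ ω, 0 ≤ p ω)
    (A : Ω → α) (B : Ω → β) (C : Ω → γ) (h : ∀ ω ω', B ω = B ω' → C ω = C ω') :
    entropy p (fun ω => (A ω, B ω)) - entropy p B ≤
      entropy p (fun ω => (A ω, C ω)) - entropy p C := by
  have := entropy_submodular hp A B C
  rw [entropy_congr p (fun ω => (A ω, B ω, C ω)) (fun ω => (A ω, B ω)) fun ω ω' => by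
      simpa using fun _ => h ω ω',
    entropy_congr p (fun ω => (B ω, C ω)) B fun ω ω' => by simpa using h ω ω'] at this
  linarith

theorem law_le_of_imp {p : Ω → ℝ} (hp : ∀ ω, 0 ≤ p ω) (A : Ω → α) (B : Ω → β) (a : α) (b : β)
    (h : ∀ ω, A ω = a → B ω = b) : law p A a ≤ law p B b := by
  classical
  exact sum_le_sum_of_subset_of_nonneg (fun ω => by simpa using h ω) fun ω _ _ => hp ω

theorem entropy_le_of_determines [Fintype α] [Fintype β] {p : Ω → ℝ} (hp : ∀ ω, 0 ≤ p ω)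
    (A : Ω → α) (B : Ω → β) (h : ∀ ω ω', A ω = A ω' → B ω = B ω') :
    entropy p B ≤ entropy p A := by
  rw [entropy_eq_sum, entropy_eq_sum, neg_le_neg_iff]
  refine sum_le_sum fun ω _ => ?_
  rcases (hp ω).eq_or_lt with h0 | h0
  · simp [← h0]
  · refine mul_le_mul_of_nonneg_left ?_ h0.le
    exact Real.logb_le_logb_of_le (by norm_num) (law_pos hp A h0)
      (law_le_of_imp hp A B _ _ fun ω' h' => h ω' ω h')

theorem entropy_const [Fintype α] {p : Ω → ℝ} (hp : ∑ ω, p ω = 1) (A : Ω → α)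
    (h : ∀ ω ω', A ω = A ω') : entropy p A = 0 := by
  classical
  rw [entropy_eq_sum]
  have : ∀ ω, law p A (A ω) = 1 := fun ω => by
    rw [law_eq_sum_ite, ← hp]
    exact sum_congr rfl fun ω' _ => by simp [h ω' ω]
  simp [this]

theorem entropy_pair_le [Fintype α] [Fintype β] {p : Ω → ℝ} (hp : p ∈ stdSimplex ℝ Ω)
    (A : Ω → α) (B : Ω → β) :
    entropy p (fun ω => (A ω, B ω)) ≤ entropy p A + entropy p B := by
  have h1 := entropy_sub_anti hp.1 A B (fun _ => ()) fun _ _ _ => rfl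
  rw [entropy_const hp.2 (fun _ => ()) fun _ _ => rfl,
    entropy_congr p (fun ω => (A ω, ())) A fun ω ω' => by simp] at h1
  linarith

theorem entropy_le_logb_card [Fintype α] {p : Ω → ℝ} (hp : p ∈ stdSimplex ℝ Ω)
    (A : Ω → α) : entropy p A ≤ Real.logb 2 (Fintype.card α) := by
  have hl := law_mem_stdSimplex hp A
  have hne : Nonempty α := by
    by_contra hne
    rw [not_nonempty_iff] at hne
    simpa using hl.2
  have hc : (0 : ℝ) < Fintype.card α := by exact_mod_cast Fintype.card_pos
  have key := sum_mul_logb_div_nonpos (q := fun _ : α => (Fintype.card α : ℝ)⁻¹) hl.1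
    (fun _ => by positivity) (fun _ _ => by positivity) (by simp [hl.2, hc.ne'])
  have e : ∀ a, law p A a * Real.logb 2 ((Fintype.card α : ℝ)⁻¹ / law p A a) =
      -(law p A a * Real.logb 2 (law p A a)) - law p A a * Real.logb 2 (Fintype.card α) := by
    intro a
    by_cases h0 : law p A a = 0
    · simp [h0]
    · rw [Real.logb_div (inv_ne_zero hc.ne') h0, Real.logb_inv]; ring
  rw [sum_congr rfl fun a _ => e a, sum_sub_distrib, ← sum_mul, hl.2, one_mul,
    sum_neg_distrib] at key
  rw [entropy]; linarith

end Entropy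

/-! ### Carathéodory's theorem and compactness of convex hulls. -/

section ConvexHull

variable {E : Type*} [NormedAddCommGroup E] [NormedSpace ℝ E] [FiniteDimensional ℝ E]

/-- Carathéodory's theorem with a fixed number of points. -/
theorem mem_convexHull_iff_exists_fin {s : Set E} {x : E} : x ∈ convexHull ℝ s ↔
    ∃ w ∈ stdSimplex ℝ (Fin (Module.finrank ℝ E + 1)), ∃ z : Fin (Module.finrank ℝ E + 1) → E,
      (∀ i, z i ∈ s) ∧ ∑ i, w i • z i = x := by
  constructor
  · intro hx
    obtain ⟨ι, _, z, w, hz, hai, hw, hw1, hwz⟩ := eq_pos_convex_span_of_mem_convexHull hx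
    obtain ⟨x0, hx0⟩ : s.Nonempty := convexHull_nonempty_iff.1 ⟨x, hx⟩
    have hcard : Fintype.card ι ≤ Module.finrank ℝ E + 1 :=
      hai.card_le_finrank_succ.trans (Nat.add_le_add_right (Submodule.finrank_le _) 1)
    obtain ⟨e⟩ : Nonempty (ι ↪ Fin (Module.finrank ℝ E + 1)) :=
      Function.Embedding.nonempty_of_card_le (by simpa using hcard)
    -- Indices outside the range of `e` get weight 0 and the arbitrary point `x0`.
    refine ⟨Function.extend e w 0, ⟨fun i => ?_, ?_⟩, Function.extend e z fun _ => x0,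
      fun i => ?_, ?_⟩
    · by_cases h : ∃ j, e j = i
      · obtain ⟨j, rfl⟩ := h
        rw [e.injective.extend_apply]; exact (hw j).le
      · rw [Function.extend_apply' _ _ _ h]; rfl
    · rw [← hw1]
      refine (Finset.sum_of_injOn e e.injective.injOn (by simp) (fun i _ h => ?_)
        fun i _ => ?_).symm
      · rw [Function.extend_apply' _ _ _ (by simpa using h)]; rfl
      · rw [e.injective.extend_apply]
    · by_cases h : ∃ j, e j = i
      · obtain ⟨j, rfl⟩ := h
        rw [e.injective.extend_apply]; exact hz ⟨j, rfl⟩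
      · rw [Function.extend_apply' _ _ _ h]; exact hx0
    · rw [← hwz]
      refine (Finset.sum_of_injOn e e.injective.injOn (by simp) (fun i _ h => ?_)
        fun i _ => ?_).symm
      · rw [Function.extend_apply' _ _ _ (by simpa using h)]; simp
      · rw [e.injective.extend_apply, e.injective.extend_apply]
  · rintro ⟨w, hw, z, hz, rfl⟩
    exact mem_convexHull_of_exists_fintype w z hw.1 hw.2 hz rfl

/-- Since the number of points in Carathéodory's theorem is fixed, the hull is a continuous image of
a compact product: a simplex times finitely many copies of `s`. -/
theorem isCompact_convexHull {s : Set E} (hs : IsCompact s) : IsCompact (convexHull ℝ s) := by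
  have : convexHull ℝ s = (fun y : (Fin (Module.finrank ℝ E + 1) → ℝ) ×
      (Fin (Module.finrank ℝ E + 1) → E) => ∑ i, y.1 i • y.2 i) ''
        (stdSimplex ℝ (Fin (Module.finrank ℝ E + 1)) ×ˢ Set.univ.pi fun _ => s) := by
    ext x
    rw [mem_convexHull_iff_exists_fin]
    constructor
    · rintro ⟨w, hw, z, hz, h⟩
      exact ⟨(w, z), ⟨hw, fun i _ => hz i⟩, h⟩
    · rintro ⟨⟨w, z⟩, ⟨hw, hz⟩, h⟩
      exact ⟨w, hw, z, fun i => hz i trivial, h⟩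
  rw [this]
  exact ((isCompact_stdSimplex _ _).prod (isCompact_univ_pi fun _ => hs)).image (by fun_prop)

end ConvexHull

/-! ### Conditional entropies of mixtures, and their continuity. -/

section Mixture

variable {Ω α β γ δ σ τ : Type*} [Fintype Ω]

theorem law_mul_left (c : ℝ) (p : Ω → ℝ) (A : Ω → α) (a : α) :
    law (fun ω => c * p ω) A a = c * law p A a := by
  simp [law, mul_sum]

theorem law_add (p q : Ω → ℝ) (A : Ω → α) (a : α) :
    law (fun ω => p ω + q ω) A a = law p A a + law q A a := by
  simp [law, sum_add_distrib]

theorem law_section [Fintype σ] (p : Ω → ℝ) (U : Ω → α) (S : Ω → σ) (f : σ → τ) (u : α) (b : τ) :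
    law (fun s => law p (fun ω => (U ω, S ω)) (u, s)) f b =
      law p (fun ω => (U ω, f (S ω))) (u, b) := by
  classical
  simp only [law_eq_sum_ite]
  refine Eq.trans (sum_congr rfl fun s _ =>
    (?_ : _ = ∑ ω, if f s = b ∧ U ω = u ∧ S ω = s then p ω else 0)) ?_
  · by_cases h : f s = b <;> simp [h]
  rw [sum_comm]
  refine sum_congr rfl fun ω _ => ?_
  rw [Fintype.sum_eq_single (S ω) fun s hs => by simp [hs.symm]]
  simp [and_comm]

/-- Conditional entropy as a difference of entropies. -/
def cEnt [Fintype α] [Fintype β] (p : Ω → ℝ) (A : Ω → α) (B : Ω → β) : ℝ :=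
  entropy p (fun ω => (A ω, B ω)) - entropy p B

/-- The conditional entropy of a mixture. -/
theorem cEnt_mixture [Fintype α] [Fintype σ] [Fintype τ] {p : Ω → ℝ} (U : Ω → α) (S : Ω → σ)
    (w : α → ℝ) (q : α → σ → ℝ) (hq : ∀ u, q u ∈ stdSimplex ℝ σ)
    (h : ∀ u s, law p (fun ω => (U ω, S ω)) (u, s) = w u * q u s) (A : σ → τ) :
    cEnt p (fun ω => A (S ω)) U = ∑ u, w u * entropy (q u) A := by
  have hU : ∀ u, law p U u = w u := fun u => by
    rw [← sum_law_pair p U S u]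
    simp only [h, ← mul_sum, (hq u).2, mul_one]
  have hA : ∀ a u, law p (fun ω => (A (S ω), U ω)) (a, u) = w u * law (q u) A a := fun a u => by
    rw [law_congr p (fun ω => (A (S ω), U ω)) (fun ω => (U ω, A (S ω))) (a, u) (u, a)
      (fun ω => by simp [and_comm]), ← law_section, ← law_mul_left]
    simp only [h]
  rw [cEnt, entropy, entropy, Fintype.sum_prod_type, sum_comm, ← neg_sub', ← sum_sub_distrib,
    ← sum_neg_distrib]
  refine sum_congr rfl fun u _ => ?_
  simp only [hU, hA]
  have hs := sum_law (q u) A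
  rw [(hq u).2] at hs
  by_cases h0 : w u = 0
  · simp [h0]
  · have e : ∀ a, w u * law (q u) A a * Real.logb 2 (w u * law (q u) A a) =
        law (q u) A a * (w u * Real.logb 2 (w u)) +
          w u * (law (q u) A a * Real.logb 2 (law (q u) A a)) := by
      intro a
      by_cases h1 : law (q u) A a = 0
      · simp [h1]
      · rw [Real.logb_mul h0 h1]; ring
    rw [sum_congr rfl fun a _ => e a, sum_add_distrib, ← sum_mul, hs, ← mul_sum, entropy]
    ring

theorem cEnt_mixture₂ [Fintype α] [Fintype σ] [Fintype τ] [Fintype δ] {p : Ω → ℝ} (U : Ω → α)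
    (S : Ω → σ) (w : α → ℝ) (q : α → σ → ℝ) (hq : ∀ u, q u ∈ stdSimplex ℝ σ)
    (h : ∀ u s, law p (fun ω => (U ω, S ω)) (u, s) = w u * q u s) (A : σ → τ) (B : σ → δ) :
    cEnt p (fun ω => A (S ω)) (fun ω => (B (S ω), U ω)) = ∑ u, w u * cEnt (q u) A B := by
  have h1 := cEnt_mixture U S w q hq h fun s => (A s, B s)
  have h2 := cEnt_mixture U S w q hq h B
  have e := entropy_congr p (fun ω => (A (S ω), B (S ω), U ω))
    (fun ω => ((A (S ω), B (S ω)), U ω)) (by simp [and_assoc])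
  simp only [cEnt, mul_sub, sum_sub_distrib] at h1 h2 ⊢
  linarith

/-- Each `law p A a` is linear in `p`, and x log x is continuous at 0 as well. -/
theorem continuous_entropy [Fintype α] (A : Ω → α) : Continuous fun p : Ω → ℝ => entropy p A := by
  have h : ∀ p : Ω → ℝ, entropy p A = -∑ a, (law p A a * Real.log (law p A a)) / Real.log 2 := by
    intro p; simp [entropy, Real.logb, mul_div_assoc]
  simp only [h]
  have hl : ∀ a, Continuous fun p : Ω → ℝ => law p A a := fun a => by
    unfold law; fun_prop
  exact (continuous_finsetSum _ fun a _ =>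
    ((Real.continuous_mul_log.comp (hl a)).div_const _)).neg

theorem continuous_cEnt [Fintype α] [Fintype β] (A : Ω → α) (B : Ω → β) :
    Continuous fun p : Ω → ℝ => cEnt p A B :=
  (continuous_entropy _).sub (continuous_entropy _)

end Mixture

/-! ### Auxiliary variables as points of an iterated convex hull. -/

section Characterization

variable {𝒳 𝒴₁ 𝒴₂ 𝒵₁ : Type*} [Fintype 𝒳] [Fintype 𝒴₁] [Fintype 𝒴₂] [Fintype 𝒵₁]

/-- The pmfs of a source letter with the same conditional law given `X` as under `P`. -/
def condLaws (P : Src 𝒳 𝒴₁ 𝒴₂ 𝒵₁ → ℝ) : Set (Src 𝒳 𝒴₁ 𝒴₂ 𝒵₁ → ℝ) :=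
  {q | q ∈ stdSimplex ℝ (Src 𝒳 𝒴₁ 𝒴₂ 𝒵₁) ∧
    ∀ s, q s * law P Xc (Xc s) = P s * law q Xc (Xc s)}

/-- Values of `(P_S, H(X | Z₁, U), H(Y₁ | Z₁, U))`. -/
def hull₁ (P : Src 𝒳 𝒴₁ 𝒴₂ 𝒵₁ → ℝ) : Set ((Src 𝒳 𝒴₁ 𝒴₂ 𝒵₁ → ℝ) × ℝ × ℝ) :=
  convexHull ℝ ((fun q => (q, cEnt q Xc Z1c, cEnt q Y1c Z1c)) '' condLaws P)

/-- Values of `(P_S, H(Y₂ | U₀), H(Z₁ | U₀), H(X | Z₁, U₀, U₁), H(Y₁ | Z₁, U₀, U₁))`. -/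
def hull₀ (P : Src 𝒳 𝒴₁ 𝒴₂ 𝒵₁ → ℝ) : Set ((Src 𝒳 𝒴₁ 𝒴₂ 𝒵₁ → ℝ) × ℝ × ℝ × ℝ × ℝ) :=
  convexHull ℝ ((fun κ : (Src 𝒳 𝒴₁ 𝒴₂ 𝒵₁ → ℝ) × ℝ × ℝ =>
    (κ.1, entropy κ.1 Y2c, entropy κ.1 Z1c, κ.2.1, κ.2.2)) '' hull₁ P)

variable {P : Src 𝒳 𝒴₁ 𝒴₂ 𝒵₁ → ℝ}

theorem continuous_law {Ω α : Type*} [Fintype Ω] (A : Ω → α) (a : α) :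
    Continuous fun p : Ω → ℝ => law p A a := by
  unfold law; fun_prop

theorem isCompact_condLaws (P : Src 𝒳 𝒴₁ 𝒴₂ 𝒵₁ → ℝ) : IsCompact (condLaws P) := by
  refine (isCompact_stdSimplex ℝ _).inter_right (t := {q | ∀ s, q s * law P Xc (Xc s) =
    P s * law q Xc (Xc s)}) ?_
  simp only [Set.ofPred_forall]
  exact isClosed_iInter fun s => isClosed_eq (by fun_prop)
    (continuous_const.mul (continuous_law _ _))

theorem isCompact_hull₁ (P : Src 𝒳 𝒴₁ 𝒴₂ 𝒵₁ → ℝ) : IsCompact (hull₁ P) :=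
  isCompact_convexHull ((isCompact_condLaws P).image
    (continuous_id.prodMk ((continuous_cEnt _ _).prodMk (continuous_cEnt _ _))))

theorem isCompact_hull₀ (P : Src 𝒳 𝒴₁ 𝒴₂ 𝒵₁ → ℝ) : IsCompact (hull₀ P) :=
  isCompact_convexHull ((isCompact_hull₁ P).image
    (continuous_fst.prodMk (((continuous_entropy _).comp continuous_fst).prodMk
      (((continuous_entropy _).comp continuous_fst).prodMk continuous_snd))))

theorem self_mem_condLaws (hP : P ∈ stdSimplex ℝ (Src 𝒳 𝒴₁ 𝒴₂ 𝒵₁)) : P ∈ condLaws P :=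
  ⟨hP, fun _ => rfl⟩

theorem mem_stdSimplex_of_law_eq {Ω α : Type*} [Fintype Ω] [Fintype α] {p : Ω → ℝ}
    (hp : p ∈ stdSimplex ℝ Ω) {S : Ω → α} {P : α → ℝ} (hS : ∀ s, law p S s = P s) :
    P ∈ stdSimplex ℝ α := by
  rw [← funext hS]; exact law_mem_stdSimplex hp S

theorem convex_condLaws (P : Src 𝒳 𝒴₁ 𝒴₂ 𝒵₁ → ℝ) : Convex ℝ (condLaws P) := by
  intro q hq r hr a b ha hb hab
  refine ⟨convex_stdSimplex ℝ _ hq.1 hr.1 ha hb hab, fun s => ?_⟩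
  have e : law (a • q + b • r) Xc (Xc s) = a * law q Xc (Xc s) + b * law r Xc (Xc s) := by
    rw [← law_mul_left, ← law_mul_left, ← law_add]; rfl
  rw [e]
  simp only [Pi.add_apply, Pi.smul_apply, smul_eq_mul]
  linear_combination a * hq.2 s + b * hr.2 s

variable {Ω α β : Type*} [Fintype Ω]

/-- The conditional law of `S` given `U = u` belongs to `condLaws P`. -/
theorem exists_condLaws {p : Ω → ℝ} (hp : p ∈ stdSimplex ℝ Ω) (U : Ω → α)
    (S : Ω → Src 𝒳 𝒴₁ 𝒴₂ 𝒵₁) (hS : ∀ s, law p S s = P s)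
    (hM : IsMarkovChain p U (fun ω => Xc (S ω)) (fun ω => (Y1c (S ω), Y2c (S ω), Z1c (S ω))))
    (u : α) : ∃ q ∈ condLaws P, ∀ s, law p (fun ω => (U ω, S ω)) (u, s) = law p U u * q s := by
  by_cases h0 : law p U u = 0
  -- On a null value of `U` any member of `condLaws P` serves; `P` is one.
  · refine ⟨P, self_mem_condLaws (mem_stdSimplex_of_law_eq hp hS), fun s => ?_⟩
    rw [h0, zero_mul]
    refine le_antisymm ?_ (law_nonneg hp.1 _ _)
    rw [← h0]
    exact law_le_of_imp hp.1 _ _ _ _ fun ω h => by simpa using congrArg Prod.fst h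
  · have hpos : 0 < law p U u := (law_nonneg hp.1 U u).lt_of_ne' h0
    set r : Src 𝒳 𝒴₁ 𝒴₂ 𝒵₁ → ℝ := fun s => law p (fun ω => (U ω, S ω)) (u, s) with hr
    refine ⟨fun s => (law p U u)⁻¹ * r s, ⟨⟨fun s => mul_nonneg (inv_nonneg.2 hpos.le)
      (law_nonneg hp.1 _ _), ?_⟩, fun s => ?_⟩, fun s => ?_⟩
    · rw [← mul_sum, hr, sum_law_pair, inv_mul_cancel₀ h0]
    · have h1 := hM u (Xc s) (Y1c s, Y2c s, Z1c s)
      have e1 : law p (fun ω => (U ω, Xc (S ω), Y1c (S ω), Y2c (S ω), Z1c (S ω)))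
          (u, Xc s, Y1c s, Y2c s, Z1c s) = r s :=
        law_congr _ _ _ _ _ fun ω => by
          simp [Xc, Y1c, Y2c, Z1c, Prod.ext_iff]
      have e2 : law p (fun ω => (Xc (S ω), Y1c (S ω), Y2c (S ω), Z1c (S ω)))
          (Xc s, Y1c s, Y2c s, Z1c s) = P s := by
        rw [← hS]
        exact law_congr _ _ _ _ _ fun ω => by
          simp [Xc, Y1c, Y2c, Z1c, Prod.ext_iff]
      have e3 : law p (fun ω => Xc (S ω)) (Xc s) = law P Xc (Xc s) := by
        rw [← funext hS, law_law]
      rw [e1, e2, e3] at h1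
      rw [law_mul_left, hr, law_section]
      linear_combination (law p U u)⁻¹ * h1
    · rw [mul_inv_cancel_left₀ h0]

/-- Auxiliary random variables define a point of `hull₀ P`. -/
theorem mem_hull₀_of_isMarkovChain [Fintype α] [Fintype β] {p : Ω → ℝ} (hp : p ∈ stdSimplex ℝ Ω)
    (U₀ : Ω → α) (U₁ : Ω → β)
    (S : Ω → Src 𝒳 𝒴₁ 𝒴₂ 𝒵₁) (hS : ∀ s, law p S s = P s)
    (hM : IsMarkovChain p (fun ω => (U₀ ω, U₁ ω)) (fun ω => Xc (S ω))
      (fun ω => (Y1c (S ω), Y2c (S ω), Z1c (S ω)))) :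
    (P, cEnt p (fun ω => Y2c (S ω)) U₀, cEnt p (fun ω => Z1c (S ω)) U₀,
      cEnt p (fun ω => Xc (S ω)) (fun ω => (Z1c (S ω), U₀ ω, U₁ ω)),
      cEnt p (fun ω => Y1c (S ω)) (fun ω => (Z1c (S ω), U₀ ω, U₁ ω))) ∈ hull₀ P := by
  have hPs := mem_stdSimplex_of_law_eq hp hS
  choose q hq hqe using exists_condLaws hp (fun ω => (U₀ ω, U₁ ω)) S hS hM
  set w : α × β → ℝ := law p fun ω => (U₀ ω, U₁ ω) with hw
  set w₀ : α → ℝ := law p U₀ with hw₀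
  have hwn : ∀ u, 0 ≤ w u := law_nonneg hp.1 _
  have hw₀n : ∀ u, 0 ≤ w₀ u := law_nonneg hp.1 _
  have hws : ∀ u₀, ∑ u₁, w (u₀, u₁) = w₀ u₀ := sum_law_pair p U₀ U₁
  have hw0 : ∀ u₀ u₁, w₀ u₀ = 0 → w (u₀, u₁) = 0 := fun u₀ u₁ h =>
    (sum_eq_zero_iff_of_nonneg fun u _ => hwn (u₀, u)).1 ((hws u₀).trans h) u₁ (mem_univ _)
  have hK : ∀ u₀, ∃ κ ∈ hull₁ P, κ.1 ∈ stdSimplex ℝ (Src 𝒳 𝒴₁ 𝒴₂ 𝒵₁) ∧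
      (∀ s, law p (fun ω => (U₀ ω, S ω)) (u₀, s) = w₀ u₀ * κ.1 s) ∧
      w₀ u₀ * κ.2.1 = ∑ u₁, w (u₀, u₁) * cEnt (q (u₀, u₁)) Xc Z1c ∧
      w₀ u₀ * κ.2.2 = ∑ u₁, w (u₀, u₁) * cEnt (q (u₀, u₁)) Y1c Z1c := by
    intro u₀
    have hsum : ∀ s, law p (fun ω => (U₀ ω, S ω)) (u₀, s) =
        ∑ u₁, w (u₀, u₁) * q (u₀, u₁) s := fun s => by
      rw [← sum_law_pair p (fun ω => (U₀ ω, S ω)) U₁]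
      refine sum_congr rfl fun u₁ _ => ?_
      rw [← hqe]
      exact law_congr _ _ _ _ _ fun ω => by simp; tauto
    by_cases h0 : w₀ u₀ = 0
    · refine ⟨(P, cEnt P Xc Z1c, cEnt P Y1c Z1c), subset_convexHull ℝ _
        ⟨P, self_mem_condLaws hPs, rfl⟩, hPs, fun s => ?_, ?_, ?_⟩
      · rw [hsum]; simp [h0, hw0 u₀ _ h0]
      · simp [h0, hw0 u₀ _ h0]
      · simp [h0, hw0 u₀ _ h0]
    · have hpos : 0 < w₀ u₀ := (hw₀n u₀).lt_of_ne' h0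
      -- The inner mixture: `U₁` is averaged with its conditional law given `U₀ = u₀`.
      refine ⟨∑ u₁, ((w₀ u₀)⁻¹ * w (u₀, u₁)) • (q (u₀, u₁), cEnt (q (u₀, u₁)) Xc Z1c,
        cEnt (q (u₀, u₁)) Y1c Z1c), ?_, ?_, fun s => ?_, ?_, ?_⟩
      · exact mem_convexHull_of_exists_fintype _ _
          (fun u₁ => mul_nonneg (inv_nonneg.2 hpos.le) (hwn _))
          (by rw [← mul_sum, hws, inv_mul_cancel₀ h0]) (fun u₁ => ⟨_, hq _, rfl⟩) rfl
      · rw [Prod.fst_sum]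
        exact (convex_stdSimplex ℝ _).sum_mem
          (fun u₁ _ => mul_nonneg (inv_nonneg.2 hpos.le) (hwn _))
          (by rw [← mul_sum, hws, inv_mul_cancel₀ h0]) (fun u₁ _ => (hq _).1)
      · rw [hsum, Prod.fst_sum, Finset.sum_apply, mul_sum]
        refine sum_congr rfl fun u₁ _ => ?_
        simp only [Prod.smul_fst, Pi.smul_apply, smul_eq_mul]
        field_simp
      · rw [Prod.snd_sum, Prod.fst_sum, mul_sum]
        refine sum_congr rfl fun u₁ _ => ?_
        simp only [Prod.smul_fst, Prod.smul_snd, smul_eq_mul]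
        field_simp
      · rw [Prod.snd_sum, Prod.snd_sum, mul_sum]
        refine sum_congr rfl fun u₁ _ => ?_
        simp only [Prod.smul_snd, smul_eq_mul]
        field_simp
  choose κ hκ hκs hκe hκa hκb using hK
  refine mem_convexHull_of_exists_fintype w₀ (fun u₀ => ((κ u₀).1, entropy (κ u₀).1 Y2c,
    entropy (κ u₀).1 Z1c, (κ u₀).2.1, (κ u₀).2.2)) hw₀n (by rw [hw₀, sum_law, hp.2])
    (fun u₀ => ⟨κ u₀, hκ u₀, rfl⟩) ?_
  have hqs : ∀ u, q u ∈ stdSimplex ℝ (Src 𝒳 𝒴₁ 𝒴₂ 𝒵₁) := fun u => (hq u).1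
  refine Prod.ext ?_ (Prod.ext ?_ (Prod.ext ?_ (Prod.ext ?_ ?_)))
  · rw [Prod.fst_sum]
    funext s
    rw [Finset.sum_apply]
    change _ = P s
    rw [← hS, ← sum_law_pair' p S U₀]
    exact sum_congr rfl fun u₀ _ => (hκe u₀ s).symm
  · rw [Prod.snd_sum, Prod.fst_sum]
    exact (cEnt_mixture U₀ S w₀ (fun u₀ => (κ u₀).1) hκs hκe Y2c).symm
  · rw [Prod.snd_sum, Prod.snd_sum, Prod.fst_sum]
    exact (cEnt_mixture U₀ S w₀ (fun u₀ => (κ u₀).1) hκs hκe Z1c).symm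
  · rw [Prod.snd_sum, Prod.snd_sum, Prod.snd_sum, Prod.fst_sum]
    refine (sum_congr rfl fun u₀ _ => hκa u₀).trans ?_
    rw [← Fintype.sum_prod_type']
    exact (cEnt_mixture₂ (fun ω => (U₀ ω, U₁ ω)) S w q hqs hqe Xc Z1c).symm
  · rw [Prod.snd_sum, Prod.snd_sum, Prod.snd_sum, Prod.snd_sum]
    refine (sum_congr rfl fun u₀ _ => hκb u₀).trans ?_
    rw [← Fintype.sum_prod_type']
    exact (cEnt_mixture₂ (fun ω => (U₀ ω, U₁ ω)) S w q hqs hqe Y1c Z1c).symm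

end Characterization

/-! ### From hull points back to auxiliary variables; the inner region is closed; erasure. -/

section

theorem law_eq_of_iff {Ω α : Type*} [Fintype Ω] (p : Ω → ℝ) (A : Ω → α) (a : α) (ω₀ : Ω)
    (h : ∀ ω, A ω = a ↔ ω = ω₀) : law p A a = p ω₀ := by
  classical
  simp [law_eq_sum_ite, h]

/-- Conditional independence is inherited by functions of the outer variables. -/
theorem entropy_markov_map {Ω α β γ α' γ' : Type*} [Fintype Ω] [Fintype α] [Fintype β] [Fintype γ]
    [Fintype α'] [Fintype γ'] {p : Ω → ℝ} (hp : ∀ ω, 0 ≤ p ω) {A : Ω → α} {B : Ω → β} {C : Ω → γ}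
    (h : IsMarkovChain p A B C) (f : α → α') (g : γ → γ') :
    entropy p (fun ω => (f (A ω), B ω, g (C ω))) + entropy p B =
      entropy p (fun ω => (f (A ω), B ω)) + entropy p (fun ω => (B ω, g (C ω))) := by
  have h0 := h.entropy_eq hp
  -- `h1` says I(f(A);g(C)|B) ≥ 0. By `h2` and `h3` this quantity is at most I(A;C|B), which `h0`
  -- makes zero.
  have h1 := entropy_submodular hp (fun ω => f (A ω)) (fun ω => g (C ω)) B
  have h2 := entropy_sub_anti hp (fun ω => g (C ω)) (fun ω => (A ω, B ω))
    (fun ω => (f (A ω), B ω)) fun ω ω' => by simp +contextual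
  have h3 := entropy_sub_anti hp A (fun ω => (C ω, B ω))
    (fun ω => (g (C ω), B ω)) fun ω ω' => by simp +contextual
  have e1 := entropy_congr p (fun ω => (f (A ω), B ω, g (C ω)))
    (fun ω => (f (A ω), g (C ω), B ω)) fun ω ω' => by simp; tauto
  have e1' := entropy_congr p (fun ω => (f (A ω), B ω, g (C ω)))
    (fun ω => (g (C ω), f (A ω), B ω)) fun ω ω' => by simp; tauto
  have e2 := entropy_congr p (fun ω => (B ω, g (C ω))) (fun ω => (g (C ω), B ω))
    fun ω ω' => by simp; tauto
  have e3 := entropy_congr p (fun ω => (A ω, B ω, C ω)) (fun ω => (A ω, C ω, B ω))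
    fun ω ω' => by simp; tauto
  have e4 := entropy_congr p (fun ω => (g (C ω), A ω, B ω)) (fun ω => (A ω, g (C ω), B ω))
    fun ω ω' => by simp; tauto
  have e5 := entropy_congr p (fun ω => (B ω, C ω)) (fun ω => (C ω, B ω))
    fun ω ω' => by simp; tauto
  linarith

variable {𝒳 𝒴₁ 𝒴₂ 𝒵₁ : Type*} [Fintype 𝒳] [Fintype 𝒴₁] [Fintype 𝒴₂] [Fintype 𝒵₁]
  {P : Src 𝒳 𝒴₁ 𝒴₂ 𝒵₁ → ℝ}

theorem law_prod_fst {α σ : Type*} [Fintype α] [Fintype σ] (Q : α × σ → ℝ) (u : α) (s : σ) :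
    law Q (fun ω => (ω.1, ω.2)) (u, s) = Q (u, s) :=
  law_eq_of_iff _ _ _ _ fun ω => by simp

/-- Converse of `exists_condLaws`: the defining equation of `condLaws`, scaled by the weight of `u`,
is the Markov condition for the glued law. -/
theorem isAuxiliary_of_condLaws {𝒰 : Type*} [Fintype 𝒰] {w : 𝒰 → ℝ}
    {q : 𝒰 → Src 𝒳 𝒴₁ 𝒴₂ 𝒵₁ → ℝ} (hw : ∀ u, 0 ≤ w u) (hw1 : ∑ u, w u = 1)
    (hq : ∀ u, q u ∈ condLaws P) (hP : ∀ s, ∑ u, w u * q u s = P s) :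
    IsAuxiliary P fun ω : 𝒰 × Src 𝒳 𝒴₁ 𝒴₂ 𝒵₁ => w ω.1 * q ω.1 ω.2 := by
  set Q : 𝒰 × Src 𝒳 𝒴₁ 𝒴₂ 𝒵₁ → ℝ := fun ω => w ω.1 * q ω.1 ω.2
  have hS : ∀ s, law Q Prod.snd s = P s := fun s => by
    rw [← hP, ← sum_law_pair' Q Prod.snd Prod.fst]
    exact sum_congr rfl fun u _ => law_prod_fst Q u s
  refine ⟨⟨fun ω => mul_nonneg (hw _) ((hq _).1.1 _), ?_⟩, hS, fun u x y => ?_⟩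
  · simp only [Q, Fintype.sum_prod_type, ← mul_sum, (hq _).1.2, mul_one, hw1]
  · obtain ⟨y₁, y₂, z⟩ := y
    have e1 : law Q (fun ω => (ω.1, Xc ω.2, Y1c ω.2, Y2c ω.2, Z1c ω.2)) (u, x, y₁, y₂, z) =
        w u * q u (x, y₁, y₂, z) :=
      law_eq_of_iff _ _ _ (u, x, y₁, y₂, z) fun ω => by simp [Xc, Y1c, Y2c, Z1c, Prod.ext_iff]
    have e2 : law Q (fun ω => (Xc ω.2, Y1c ω.2, Y2c ω.2, Z1c ω.2)) (x, y₁, y₂, z) =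
        P (x, y₁, y₂, z) := by
      rw [← hS]
      exact law_congr _ _ _ _ _ fun ω => by simp [Xc, Y1c, Y2c, Z1c, Prod.ext_iff]
    have e3 : law Q (fun ω => Xc ω.2) x = law P Xc x := by
      rw [← funext hS, law_law]
    have e4 : law Q (fun ω => (ω.1, Xc ω.2)) (u, x) = w u * law (q u) Xc x := by
      rw [← law_section Q Prod.fst Prod.snd, ← law_mul_left]
      congr 1
      funext s
      exact law_prod_fst Q u s
    rw [e1, e2, e3, e4]
    have := (hq u).2 (x, y₁, y₂, z)
    simp only [Xc] at this ⊢
    linear_combination w u * this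

theorem fst_mem_condLaws {κ : (Src 𝒳 𝒴₁ 𝒴₂ 𝒵₁ → ℝ) × ℝ × ℝ} (h : κ ∈ hull₁ P) :
    κ.1 ∈ condLaws P := by
  have : hull₁ P ⊆ (LinearMap.fst ℝ (Src 𝒳 𝒴₁ 𝒴₂ 𝒵₁ → ℝ) (ℝ × ℝ)) ⁻¹' condLaws P := by
    refine convexHull_min ?_ ((convex_condLaws P).linear_preimage _)
    rintro _ ⟨q, hq, rfl⟩
    exact hq
  exact this h

theorem entropy_comp_snd {𝒰 τ : Type*} [Fintype 𝒰] [Fintype τ] {Q : 𝒰 × Src 𝒳 𝒴₁ 𝒴₂ 𝒵₁ → ℝ}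
    (hQ : IsAuxiliary P Q) (f : Src 𝒳 𝒴₁ 𝒴₂ 𝒵₁ → τ) :
    entropy Q (fun ω => f ω.2) = entropy P f := by
  rw [← funext hQ.2.1, entropy_law]

/-- Every point of `hull₀ P` over `P` comes from auxiliary random variables. -/
theorem exists_isAuxiliary_of_mem_hull₀ {c d a b : ℝ} (h : (P, c, d, a, b) ∈ hull₀ P) :
    ∃ (k₀ k₁ : ℕ) (Q : (Fin k₀ × Fin k₁) × Src 𝒳 𝒴₁ 𝒴₂ 𝒵₁ → ℝ), IsAuxiliary P Q ∧
      cEnt Q (fun ω => Y2c ω.2) (fun ω => ω.1.1) = c ∧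
      cEnt Q (fun ω => Z1c ω.2) (fun ω => ω.1.1) = d ∧
      cEnt Q (fun ω => Xc ω.2) (fun ω => (Z1c ω.2, ω.1.1, ω.1.2)) = a ∧
      cEnt Q (fun ω => Y1c ω.2) (fun ω => (Z1c ω.2, ω.1.1, ω.1.2)) = b := by
  obtain ⟨w, hw, z, hz, he⟩ := mem_convexHull_iff_exists_fin.1 h
  choose κ hκ hκz using hz
  choose v hv y hy hye using fun i => mem_convexHull_iff_exists_fin.1 (hκ i)
  choose q hq hqy using hy
  obtain rfl : (fun i => (fun κ : (Src 𝒳 𝒴₁ 𝒴₂ 𝒵₁ → ℝ) × ℝ × ℝ =>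
    (κ.1, entropy κ.1 Y2c, entropy κ.1 Z1c, κ.2.1, κ.2.2)) (κ i)) = z := funext hκz
  simp only [Prod.ext_iff, Prod.fst_sum, Prod.snd_sum, Prod.smul_fst, Prod.smul_snd,
    smul_eq_mul] at he
  obtain ⟨heP, hec, hed, hea, heb⟩ := he
  have hκ1 : ∀ i s, (κ i).1 s = ∑ j, v i j * q i j s := fun i s => by
    rw [← hye i, Prod.fst_sum, Finset.sum_apply]
    exact sum_congr rfl fun j _ => by rw [← hqy]; rfl
  have hκ2 : ∀ i, (κ i).2.1 = ∑ j, v i j * cEnt (q i j) Xc Z1c := fun i => by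
    rw [← hye i, Prod.snd_sum, Prod.fst_sum]
    exact sum_congr rfl fun j _ => by rw [← hqy]; rfl
  have hκ3 : ∀ i, (κ i).2.2 = ∑ j, v i j * cEnt (q i j) Y1c Z1c := fun i => by
    rw [← hye i, Prod.snd_sum, Prod.snd_sum]
    exact sum_congr rfl fun j _ => by rw [← hqy]; rfl
  have hPe : ∀ s, ∑ i, w i * (κ i).1 s = P s := fun s => by
    rw [← congrFun heP s, Finset.sum_apply]; rfl
  -- `U₀` is the index of the outer mixture and `U₁` that of the inner one.
  set Q : (Fin _ × Fin _) × Src 𝒳 𝒴₁ 𝒴₂ 𝒵₁ → ℝ :=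
    fun ω => (w ω.1.1 * v ω.1.1 ω.1.2) * q ω.1.1 ω.1.2 ω.2 with hQ
  have hQP : IsAuxiliary P Q := by
    refine isAuxiliary_of_condLaws (w := fun u : Fin _ × Fin _ => w u.1 * v u.1 u.2)
      (q := fun u => q u.1 u.2) (fun u => mul_nonneg (hw.1 _) ((hv _).1 _)) ?_
      (fun u => hq _ _) fun s => ?_
    · simp only [Fintype.sum_prod_type, ← mul_sum, (hv _).2, mul_one, hw.2]
    · simp only [Fintype.sum_prod_type, mul_assoc, ← mul_sum, ← hκ1, hPe]
  have hQ1 : ∀ i s, law Q (fun ω => (ω.1.1, ω.2)) (i, s) = w i * (κ i).1 s := fun i s => by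
    rw [← sum_law_pair Q (fun ω => (ω.1.1, ω.2)) fun ω => ω.1.2, hκ1, mul_sum]
    refine sum_congr rfl fun j _ => ?_
    rw [law_eq_of_iff Q _ _ ((i, j), s) fun ω => by simp [Prod.ext_iff]; tauto]
    simp only [hQ]; ring
  have hQ2 : ∀ u s, law Q (fun ω => ((ω.1.1, ω.1.2), ω.2)) (u, s) = (w u.1 * v u.1 u.2) *
      q u.1 u.2 s := fun u s => law_prod_fst Q u s
  refine ⟨_, _, Q, hQP, ?_, ?_, ?_, ?_⟩
  · rw [cEnt_mixture (fun ω => ω.1.1) (fun ω : (Fin _ × Fin _) × Src 𝒳 𝒴₁ 𝒴₂ 𝒵₁ => ω.2) w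
      (fun i => (κ i).1) (fun i => (fst_mem_condLaws (hκ i)).1) hQ1, hec]
  · rw [cEnt_mixture (fun ω => ω.1.1) (fun ω : (Fin _ × Fin _) × Src 𝒳 𝒴₁ 𝒴₂ 𝒵₁ => ω.2) w
      (fun i => (κ i).1) (fun i => (fst_mem_condLaws (hκ i)).1) hQ1, hed]
  · rw [cEnt_mixture₂ (fun ω => (ω.1.1, ω.1.2))
      (fun ω : (Fin _ × Fin _) × Src 𝒳 𝒴₁ 𝒴₂ 𝒵₁ => ω.2) (fun u => w u.1 * v u.1 u.2)
      (fun u => q u.1 u.2) (fun u => (hq _ _).1) hQ2, Fintype.sum_prod_type, ← hea]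
    simp only [mul_assoc, ← mul_sum, ← hκ2]
  · rw [cEnt_mixture₂ (fun ω => (ω.1.1, ω.1.2))
      (fun ω : (Fin _ × Fin _) × Src 𝒳 𝒴₁ 𝒴₂ 𝒵₁ => ω.2) (fun u => w u.1 * v u.1 u.2)
      (fun u => q u.1 u.2) (fun u => (hq _ _).1) hQ2, Fintype.sum_prod_type, ← heb]
    simp only [mul_assoc, ← mul_sum, ← hκ3]

/-- If `Z₁` is less noisy than `Y₂`, then `I(U₀; Y₂) ≤ I(U₀; Z₁)` on `hull₀ P`. -/
theorem LessNoisy.sub_le_sub (hZY : LessNoisy P) {c d a b : ℝ} (h : (P, c, d, a, b) ∈ hull₀ P) :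
    entropy P Y2c - c ≤ entropy P Z1c - d := by
  obtain ⟨w, hw, z, hz, he⟩ := mem_convexHull_iff_exists_fin.1 h
  choose κ hκ hκz using hz
  obtain rfl : (fun i => (fun κ : (Src 𝒳 𝒴₁ 𝒴₂ 𝒵₁ → ℝ) × ℝ × ℝ =>
    (κ.1, entropy κ.1 Y2c, entropy κ.1 Z1c, κ.2.1, κ.2.2)) (κ i)) = z := funext hκz
  simp only [Prod.ext_iff, Prod.fst_sum, Prod.snd_sum, Prod.smul_fst, Prod.smul_snd,
    smul_eq_mul] at he
  obtain ⟨heP, hec, hed, -, -⟩ := he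
  have hPe : ∀ s, ∑ i, w i * (κ i).1 s = P s := fun s => by
    rw [← congrFun heP s, Finset.sum_apply]; rfl
  have hQ := isAuxiliary_of_condLaws hw.1 hw.2 (fun i => fst_mem_condLaws (hκ i)) hPe
  have key := hZY _ _ hQ
  set Q : Fin _ × Src 𝒳 𝒴₁ 𝒴₂ 𝒵₁ → ℝ := fun ω => w ω.1 * (κ ω.1).1 ω.2
  rw [mutualInfo_eq hQ.1.1, mutualInfo_eq hQ.1.1, entropy_comp_snd hQ, entropy_comp_snd hQ,
    entropy_congr Q (fun ω => (ω.1, Y2c ω.2)) (fun ω => (Y2c ω.2, ω.1)) (by simp [and_comm]),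
    entropy_congr Q (fun ω => (ω.1, Z1c ω.2)) (fun ω => (Z1c ω.2, ω.1)) (by simp [and_comm])] at key
  have h1 := cEnt_mixture Prod.fst Prod.snd w (fun i => (κ i).1)
    (fun i => (fst_mem_condLaws (hκ i)).1) (p := Q) (fun i s => law_prod_fst Q i s) Y2c
  have h2 := cEnt_mixture Prod.fst Prod.snd w (fun i => (κ i).1)
    (fun i => (fst_mem_condLaws (hκ i)).1) (p := Q) (fun i s => law_prod_fst Q i s) Z1c
  rw [cEnt] at h1 h2
  linarith

/-- The chain `U₀ → X → Z₁` gives I(U₀;X) = I(U₀;Z₁) + I(U₀;X|Z₁), and the chain rule merges the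
last term with I(U₁;X|U₀,Z₁). In the new form `U₀` on its own meets only `Z₁`. Erasing `U₀`
therefore affects a single term, and that term can be compared with I(U₀;Y₂). -/
theorem rate_eq {k₀ k₁ : ℕ} {Q : (Fin k₀ × Fin k₁) × Src 𝒳 𝒴₁ 𝒴₂ 𝒵₁ → ℝ} (hQ : IsAuxiliary P Q) :
    mutualInfo Q (fun ω => ω.1.1) (fun ω => Xc ω.2) +
        condMutualInfo Q (fun ω => ω.1.2) (fun ω => Xc ω.2) (fun ω => (ω.1.1, Z1c ω.2)) =
      (entropy P Z1c - cEnt Q (fun ω => Z1c ω.2) (fun ω => ω.1.1)) +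
        (cEnt P Xc Z1c - cEnt Q (fun ω => Xc ω.2) (fun ω => (Z1c ω.2, ω.1.1, ω.1.2))) := by
  have h := entropy_markov_map hQ.1.1 hQ.2.2 Prod.fst fun y => y.2.2
  have e0 := entropy_comp_snd hQ fun s => (Xc s, Z1c s)
  have e1 := entropy_comp_snd hQ Z1c
  have e2 := entropy_congr Q (fun ω => (ω.1.2, ω.1.1, Z1c ω.2))
    (fun ω => (Z1c ω.2, ω.1.1, ω.1.2)) (by simp; tauto)
  have e3 := entropy_congr Q (fun ω => (Xc ω.2, ω.1.1, Z1c ω.2))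
    (fun ω => (ω.1.1, Xc ω.2, Z1c ω.2)) (by simp; tauto)
  have e4 := entropy_congr Q (fun ω => (ω.1.2, Xc ω.2, ω.1.1, Z1c ω.2))
    (fun ω => (Xc ω.2, Z1c ω.2, ω.1.1, ω.1.2)) (by simp; tauto)
  have e5 := entropy_congr Q (fun ω => (ω.1.1, Z1c ω.2)) (fun ω => (Z1c ω.2, ω.1.1))
    (by simp; tauto)
  rw [mutualInfo_eq hQ.1.1, condMutualInfo_eq hQ.1.1]
  simp only [cEnt] at h ⊢
  linarith

theorem condMutualInfo_eq_sub {k₀ k₁ : ℕ} {Q : (Fin k₀ × Fin k₁) × Src 𝒳 𝒴₁ 𝒴₂ 𝒵₁ → ℝ}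
    (hQ : IsAuxiliary P Q) :
    condMutualInfo Q (fun ω => (ω.1.1, ω.1.2)) (fun ω => Y1c ω.2) (fun ω => Z1c ω.2) =
      cEnt P Y1c Z1c - cEnt Q (fun ω => Y1c ω.2) (fun ω => (Z1c ω.2, ω.1.1, ω.1.2)) := by
  have e0 := entropy_comp_snd hQ fun s => (Y1c s, Z1c s)
  have e1 := entropy_comp_snd hQ Z1c
  have e2 := entropy_congr Q (fun ω => ((ω.1.1, ω.1.2), Z1c ω.2))
    (fun ω => (Z1c ω.2, ω.1.1, ω.1.2)) (by simp; tauto)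
  have e3 := entropy_congr Q (fun ω => ((ω.1.1, ω.1.2), Y1c ω.2, Z1c ω.2))
    (fun ω => (Y1c ω.2, Z1c ω.2, ω.1.1, ω.1.2)) (by simp; tauto)
  rw [condMutualInfo_eq hQ.1.1]
  simp only [cEnt]
  linarith

theorem mutualInfo_eq_sub {k₀ k₁ : ℕ} {Q : (Fin k₀ × Fin k₁) × Src 𝒳 𝒴₁ 𝒴₂ 𝒵₁ → ℝ}
    (hQ : IsAuxiliary P Q) :
    mutualInfo Q (fun ω => ω.1.1) (fun ω => Y2c ω.2) =
      entropy P Y2c - cEnt Q (fun ω => Y2c ω.2) (fun ω => ω.1.1) := by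
  have e1 := entropy_comp_snd hQ Y2c
  have e2 := entropy_congr Q (fun ω => (ω.1.1, Y2c ω.2)) (fun ω => (Y2c ω.2, ω.1.1))
    (by simp; tauto)
  rw [mutualInfo_eq hQ.1.1]
  simp only [cEnt]
  linarith

/-- The triples `(I(U₀, U₁; Y₁ | Z₁), I(U₀; Y₂), I(U₀; Z₁) + I(U₀, U₁; X | Z₁))`, relaxed
downwards, downwards and upwards. -/
def triples (P : Src 𝒳 𝒴₁ 𝒴₂ 𝒵₁ → ℝ) : Set (ℝ × ℝ × ℝ) :=
  {t | ∃ c d a b, (P, c, d, a, b) ∈ hull₀ P ∧ t.1 ≤ cEnt P Y1c Z1c - b ∧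
    t.2.1 ≤ entropy P Y2c - c ∧ (entropy P Z1c - d) + (cEnt P Xc Z1c - a) ≤ t.2.2}

/-- Turns a union over alphabets of all sizes into a section of one set, which compactness can
handle. -/
theorem mem_innerRegion_iff {R : ℝ} {θ : ℝ × ℝ} :
    θ ∈ innerRegion P R ↔ 0 ≤ θ.1 ∧ 0 ≤ θ.2 ∧ (θ.1, θ.2, R) ∈ triples P := by
  refine and_congr_right fun _ => and_congr_right fun _ => ⟨?_, ?_⟩
  · rintro ⟨k₀, k₁, Q, hQ, h1, h2, h3⟩
    rw [condMutualInfo_eq_sub hQ] at h1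
    rw [mutualInfo_eq_sub hQ] at h2
    rw [rate_eq hQ] at h3
    exact ⟨_, _, _, _, mem_hull₀_of_isMarkovChain hQ.1 (fun ω => ω.1.1) (fun ω => ω.1.2) Prod.snd
      hQ.2.1 hQ.2.2, h1, h2, h3⟩
  · rintro ⟨c, d, a, b, h, h1, h2, h3⟩
    obtain ⟨k₀, k₁, Q, hQ, rfl, rfl, rfl, rfl⟩ := exists_isAuxiliary_of_mem_hull₀ h
    exact ⟨k₀, k₁, Q, hQ, by rwa [condMutualInfo_eq_sub hQ], by rwa [mutualInfo_eq_sub hQ],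
      by rwa [rate_eq hQ]⟩

/-- The set is the projection, along the compact `hull₀ P`, of a set cut out by continuous
equalities and inequalities. -/
theorem isClosed_triples (P : Src 𝒳 𝒴₁ 𝒴₂ 𝒵₁ → ℝ) : IsClosed (triples P) := by
  have : CompactSpace (hull₀ P) := isCompact_iff_compactSpace.1 (isCompact_hull₀ P)
  have hc : IsClosed {x : hull₀ P × (ℝ × ℝ × ℝ) | x.1.1.1 = P ∧
      x.2.1 ≤ cEnt P Y1c Z1c - x.1.1.2.2.2.2 ∧ x.2.2.1 ≤ entropy P Y2c - x.1.1.2.1 ∧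
      (entropy P Z1c - x.1.1.2.2.1) + (cEnt P Xc Z1c - x.1.1.2.2.2.1) ≤ x.2.2.2} := by
    simp only [Set.ofPred_and]
    refine (isClosed_eq (by fun_prop) continuous_const).inter ((isClosed_le ?_ ?_).inter
      ((isClosed_le ?_ ?_).inter (isClosed_le ?_ ?_))) <;> fun_prop
  convert isClosedMap_snd_of_compactSpace _ hc using 1
  ext t
  constructor
  · rintro ⟨c, d, a, b, h, h1⟩
    exact ⟨(⟨_, h⟩, t), ⟨rfl, h1⟩, rfl⟩
  · rintro ⟨⟨⟨⟨q, c, d, a, b⟩, h⟩, t⟩, ⟨hq, h1⟩, rfl⟩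
    obtain rfl : q = P := hq
    exact ⟨c, d, a, b, h, h1⟩

theorem isClosed_innerRegion (P : Src 𝒳 𝒴₁ 𝒴₂ 𝒵₁ → ℝ) (R : ℝ) : IsClosed (innerRegion P R) := by
  have : innerRegion P R = {θ | 0 ≤ θ.1} ∩ ({θ | 0 ≤ θ.2} ∩
      (fun θ : ℝ × ℝ => (θ.1, θ.2, R)) ⁻¹' triples P) := by
    ext θ; exact mem_innerRegion_iff
  rw [this]
  exact (isClosed_le continuous_const continuous_fst).inter
    ((isClosed_le continuous_const continuous_snd).inter
      ((isClosed_triples P).preimage (by fun_prop)))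

/-- Moving `U₀` towards a constant. -/
theorem erase_mem_hull₀ {c d a b l : ℝ} (hl : 0 ≤ l)
    (hl1 : l ≤ 1) (h : (P, c, d, a, b) ∈ hull₀ P) :
    (P, (1 - l) * c + l * entropy P Y2c, (1 - l) * d + l * entropy P Z1c, a, b) ∈ hull₀ P := by
  -- `U₁` can take over the whole pair, because averaging over `U₀` stays inside the convex set
  -- `hull₁ P`. Mixing with the resulting point of constant `U₀` then changes neither `a` nor `b`.
  have h1 : (P, a, b) ∈ hull₁ P := by
    have hsub : hull₀ P ⊆ ((LinearMap.fst ℝ (Src 𝒳 𝒴₁ 𝒴₂ 𝒵₁ → ℝ) (ℝ × ℝ × ℝ × ℝ)).prod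
        ((LinearMap.snd ℝ ℝ (ℝ × ℝ)).comp ((LinearMap.snd ℝ ℝ (ℝ × ℝ × ℝ)).comp
          (LinearMap.snd ℝ (Src 𝒳 𝒴₁ 𝒴₂ 𝒵₁ → ℝ) (ℝ × ℝ × ℝ × ℝ))))) ⁻¹' hull₁ P := by
      refine convexHull_min ?_ ((convex_convexHull ℝ _).linear_preimage _)
      rintro _ ⟨κ, hκ, rfl⟩
      exact hκ
    exact hsub h
  have h2 : (P, entropy P Y2c, entropy P Z1c, a, b) ∈ hull₀ P := subset_convexHull ℝ _ ⟨_, h1, rfl⟩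
  have e : (P, (1 - l) * c + l * entropy P Y2c, (1 - l) * d + l * entropy P Z1c, a, b) =
      (1 - l) • (P, c, d, a, b) + l • (P, entropy P Y2c, entropy P Z1c, a, b) := by
    simp only [Prod.smul_mk, Prod.mk_add_mk, smul_eq_mul, Prod.mk.injEq, ← add_smul, true_and]
    exact ⟨by simp, by ring, by ring⟩
  rw [e]
  exact convex_convexHull ℝ _ h h2 (sub_nonneg.2 hl1) hl (by ring)

/-- Moving `(U₀, U₁)` towards a constant. -/
theorem scale_mem_triples (hP : P ∈ stdSimplex ℝ (Src 𝒳 𝒴₁ 𝒴₂ 𝒵₁)) {t : ℝ × ℝ × ℝ}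
    (h : t ∈ triples P) {l : ℝ} (hl : 0 ≤ l) (hl1 : l ≤ 1) : l • t ∈ triples P := by
  obtain ⟨c, d, a, b, h, h1, h2, h3⟩ := h
  have h1' : (P, cEnt P Xc Z1c, cEnt P Y1c Z1c) ∈ hull₁ P :=
    subset_convexHull ℝ _ ⟨P, self_mem_condLaws hP, rfl⟩
  have h2' : (P, entropy P Y2c, entropy P Z1c, cEnt P Xc Z1c, cEnt P Y1c Z1c) ∈ hull₀ P :=
    subset_convexHull ℝ _ ⟨_, h1', rfl⟩
  have key : (P, l * c + (1 - l) * entropy P Y2c, l * d + (1 - l) * entropy P Z1c,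
      l * a + (1 - l) * cEnt P Xc Z1c, l * b + (1 - l) * cEnt P Y1c Z1c) ∈ hull₀ P := by
    have e : (P, l * c + (1 - l) * entropy P Y2c, l * d + (1 - l) * entropy P Z1c,
        l * a + (1 - l) * cEnt P Xc Z1c, l * b + (1 - l) * cEnt P Y1c Z1c) = l • (P, c, d, a, b) +
        (1 - l) • (P, entropy P Y2c, entropy P Z1c, cEnt P Xc Z1c, cEnt P Y1c Z1c) := by
      simp only [Prod.smul_mk, Prod.mk_add_mk, smul_eq_mul, Prod.mk.injEq, ← add_smul, and_true]
      simp
    rw [e]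
    exact convex_convexHull ℝ _ h h2' hl (sub_nonneg.2 hl1) (by ring)
  refine ⟨_, _, _, _, key, ?_, ?_, ?_⟩ <;> simp only [Prod.smul_fst, Prod.smul_snd, smul_eq_mul]
  · linarith [mul_le_mul_of_nonneg_left h1 hl]
  · linarith [mul_le_mul_of_nonneg_left h2 hl]
  · linarith [mul_le_mul_of_nonneg_left h3 hl]

end

theorem sum_pi_prod {ι α : Type*} [Fintype ι] [DecidableEq ι] [Fintype α] (f : ι → α → ℝ) :
    ∑ s : ι → α, ∏ t, f t (s t) = ∏ t, ∑ a, f t a := by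
  rw [Finset.prod_univ_sum, Fintype.piFinset_univ]

/-! ### Hypothesis testing: type-II error against relative entropy. -/

section Testing

variable {Ω τ α β γ : Type*} [Fintype Ω] [Fintype τ] [Fintype α] [Fintype β] [Fintype γ]

theorem law_fin_two {p : Ω → ℝ} (hp : p ∈ stdSimplex ℝ Ω) (g : Ω → Fin 2) :
    law p g 0 = 1 - law p g 1 := by
  have := sum_law p g
  rw [Fin.sum_univ_two, hp.2] at this
  linarith

theorem law_le_one {p : Ω → ℝ} (hp : p ∈ stdSimplex ℝ Ω) (A : Ω → α) (a : α) : law p A a ≤ 1 := by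
  have h := law_mem_stdSimplex hp A
  rw [← h.2]
  exact single_le_sum (f := law p A) (fun a _ => h.1 a) (mem_univ a)

/-- The converse bound on the type-II error probability of a test. -/
theorem neg_mul_logb_le_sum {p q : τ → ℝ} (hp : p ∈ stdSimplex ℝ τ) (hq : q ∈ stdSimplex ℝ τ)
    (hpq : ∀ x, 0 < p x → 0 < q x) (g : τ → Fin 2) (hβ : 0 < law q g 0) :
    -law p g 0 * Real.logb 2 (law q g 0) ≤ ∑ x, p x * Real.logb 2 (p x / q x) + 1 := by
  classical
  set β := law q g 0
  -- Gibbs' inequality is applied to a measure of mass 1/2 on `g = 0` and at most 1/2 elsewhere. The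
  -- weight `1 / (2 * β)` yields the logarithm of `β`, and the halves yield the additive 1.
  set r : τ → ℝ := fun x => if g x = 0 then q x / (2 * β) else q x / 2 with hr
  have hrn : ∀ x, 0 ≤ r x := fun x => by
    simp only [hr]; split_ifs <;> have := hq.1 x <;> positivity
  have hrs : ∑ x, r x ≤ ∑ x, p x := by
    rw [hp.2]
    have h1 : ∀ x, r x ≤ (if g x = 0 then q x else 0) / (2 * β) + q x / 2 := fun x => by
      simp only [hr]; have := hq.1 x; split_ifs <;> simp <;> linarith
    have h2 : ∑ x, (if g x = 0 then q x else 0) = β := (law_eq_sum_ite q g 0).symm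
    calc _ ≤ _ := sum_le_sum fun x _ => h1 x
      _ = β / (2 * β) + 1 / 2 := by rw [sum_add_distrib, ← sum_div, ← sum_div, h2, hq.2]
      _ = 1 := by field_simp; norm_num
  have key := sum_mul_logb_div_nonpos hp.1 hrn
    (fun x hx => by simp only [hr]; have := hpq x hx; split_ifs <;> positivity) hrs
  have e : ∀ x, p x * Real.logb 2 (r x / p x) = -(p x * Real.logb 2 (p x / q x)) - p x -
      (if g x = 0 then p x else 0) * Real.logb 2 β := by
    intro x
    rcases (hp.1 x).eq_or_lt with h0 | h0
    · simp [← h0]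
    · have hqx := hpq x h0
      have l2 : Real.logb 2 2 = 1 := Real.logb_self_eq_one (by norm_num)
      simp only [hr]
      split_ifs
      · rw [Real.logb_div (by positivity) h0.ne', Real.logb_div hqx.ne' (by positivity),
          Real.logb_div h0.ne' hqx.ne', Real.logb_mul (by norm_num) hβ.ne', l2]
        ring
      · rw [Real.logb_div (by positivity) h0.ne', Real.logb_div hqx.ne' (by positivity),
          Real.logb_div h0.ne' hqx.ne', l2]
        ring
  have h3 : ∑ x, (if g x = 0 then p x else 0) = law p g 0 := (law_eq_sum_ite p g 0).symm
  rw [sum_congr rfl fun x _ => e x, sum_sub_distrib, sum_sub_distrib, sum_neg_distrib, hp.2,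
    ← sum_mul, h3] at key
  linarith

/-- By the identity `h` the divergence between the two laws of `T` is a combination of entropies
under `p` alone. The same identity forces absolute continuity, hence a positive type-II error. -/
theorem typeII_converse {p p' : Ω → ℝ} (hp : p ∈ stdSimplex ℝ Ω) (hp' : p' ∈ stdSimplex ℝ Ω)
    (T : Ω → τ) (g : τ → Fin 2) (A : Ω → α) (B : Ω → β) (C : Ω → γ)
    (h : ∀ ω, law p' T (T ω) * law p C (C ω) = law p A (A ω) * law p B (B ω)) {ε : ℝ}
    (hε1 : ε < 1) (hα : law p (fun ω => g (T ω)) 1 ≤ ε) :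
    0 < law p' (fun ω => g (T ω)) 0 ∧ -(1 - ε) * Real.logb 2 (law p' (fun ω => g (T ω)) 0) ≤
      entropy p A + entropy p B - entropy p C - entropy p T + 1 := by
  have hac : ∀ x, 0 < law p T x → 0 < law p' T x := by
    intro x hx
    refine (law_nonneg hp'.1 T x).lt_of_ne' fun h0 => hx.ne' ?_
    rw [law]
    refine sum_eq_zero fun ω hω => ?_
    simp only [mem_filter, mem_univ, true_and] at hω
    subst hω
    by_contra hne
    have hpos := (hp.1 ω).lt_of_ne' hne
    have := h ω
    rw [h0, zero_mul] at this
    exact (mul_pos (law_pos hp.1 A hpos) (law_pos hp.1 B hpos)).ne this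
  have h1 : 1 - ε ≤ law p (fun ω => g (T ω)) 0 := by
    rw [law_fin_two hp]; linarith
  have hβ : 0 < law p' (fun ω => g (T ω)) 0 := by
    rw [← law_law p' T g, law]
    rw [← law_law p T g, law] at h1
    obtain ⟨x, hx, hx0⟩ := exists_lt_of_sum_lt (s := univ.filter fun x => g x = 0)
      (f := fun _ => (0 : ℝ)) (g := law p T) (by
        simp only [sum_const_zero]; refine lt_of_lt_of_le (by linarith) (h1.trans (le_of_eq ?_))
        congr!)
    refine (hac x hx0).trans_le (single_le_sum (f := law p' T) (fun x _ => law_nonneg hp'.1 T x) ?_)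
    simpa using hx
  refine ⟨hβ, ?_⟩
  have key := neg_mul_logb_le_sum (law_mem_stdSimplex hp T) (law_mem_stdSimplex hp' T) hac g
    (by rwa [law_law])
  rw [law_law, law_law, sum_law_mul p T fun x => Real.logb 2 (law p T x / law p' T x)] at key
  have hD : ∑ ω, p ω * Real.logb 2 (law p T (T ω) / law p' T (T ω)) =
      entropy p A + entropy p B - entropy p C - entropy p T := by
    simp only [entropy_eq_sum]
    rw [← sub_eq_zero]
    simp only [sub_eq_add_neg, neg_neg, neg_add, ← sum_neg_distrib, ← sum_add_distrib]
    refine sum_eq_zero fun ω _ => ?_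
    rcases (hp.1 ω).eq_or_lt with h0 | h0
    · simp [← h0]
    · have hA := (law_pos hp.1 A h0).ne'
      have hB := (law_pos hp.1 B h0).ne'
      have hC := (law_pos hp.1 C h0).ne'
      have hT := law_pos hp.1 T h0
      have hT' := (hac _ hT).ne'
      have := congrArg (Real.logb 2) (h ω)
      rw [Real.logb_mul hT' hC, Real.logb_mul hA hB] at this
      rw [Real.logb_div hT.ne' hT']
      linear_combination -p ω * this
  rw [hD] at key
  -- Since this logarithm is nonpositive, the acceptance probability may be lowered to `1 - ε`.
  have hlog : Real.logb 2 (law p' (fun ω => g (T ω)) 0) ≤ 0 :=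
    Real.logb_nonpos (by norm_num) hβ.le (law_le_one hp' _ _)
  nlinarith

end Testing

/-! ### Joint laws of source letters and message under both hypotheses. -/

section Joint

variable {𝒳 𝒴₁ 𝒴₂ 𝒵₁ : Type*} [Fintype 𝒳] [Fintype 𝒴₁] [Fintype 𝒴₂] [Fintype 𝒵₁]
  {P Q : Src 𝒳 𝒴₁ 𝒴₂ 𝒵₁ → ℝ} {n : ℕ} {R : ℝ} (c : Code 𝒳 𝒴₁ 𝒴₂ 𝒵₁ n R)
  {α β : Type*} [Fintype α]

theorem jointLaw_mem (hQ : Q ∈ stdSimplex ℝ (Src 𝒳 𝒴₁ 𝒴₂ 𝒵₁)) : c.jointLaw Q ∈ stdSimplex ℝ _ := by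
  refine ⟨fun ω => mul_nonneg (prod_nonneg fun t _ => hQ.1 _) ((c.enc_mem _).1 _), ?_⟩
  simp only [Code.jointLaw, Fintype.sum_prod_type, ← mul_sum, (c.enc_mem _).2, mul_one]
  rw [sum_pi_prod fun _ => Q]
  simp [hQ.2]

theorem law_jointLaw_fst (s : Fin n → Src 𝒳 𝒴₁ 𝒴₂ 𝒵₁) :
    law (c.jointLaw Q) Prod.fst s = ∏ t, Q (s t) := by
  classical
  rw [← sum_law_pair (c.jointLaw Q) Prod.fst Prod.snd]
  have : ∀ m, law (c.jointLaw Q) (fun ω => (ω.1, ω.2)) (s, m) = c.jointLaw Q (s, m) := fun m =>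
    law_eq_of_iff _ _ _ _ fun ω => by simp
  simp only [this, Code.jointLaw, ← mul_sum, (c.enc_mem _).2, mul_one]

theorem law_pi {σ : Type*} [Fintype σ] {Q : σ → ℝ} (f : σ → β) (y : Fin n → β) :
    law (fun s : Fin n → σ => ∏ t, Q (s t)) (fun s t => f (s t)) y =
      ∏ t, law Q f (y t) := by
  classical
  simp only [law_eq_sum_ite]
  rw [← sum_pi_prod fun t a => if f a = y t then Q a else 0]
  refine sum_congr rfl fun s _ => ?_
  rw [prod_ite_zero]
  simp [funext_iff]

theorem law_seq (f : Src 𝒳 𝒴₁ 𝒴₂ 𝒵₁ → β) (y : Fin n → β) :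
    law (c.jointLaw Q) (fun ω t => f (ω.1 t)) y = ∏ t, law Q f (y t) := by
  rw [← law_law (c.jointLaw Q) Prod.fst fun s t => f (s t), ← law_pi]
  congr 1
  funext s
  exact law_jointLaw_fst c s

theorem law_letter (hQ : Q ∈ stdSimplex ℝ (Src 𝒳 𝒴₁ 𝒴₂ 𝒵₁)) (t : Fin n) (a : Src 𝒳 𝒴₁ 𝒴₂ 𝒵₁) :
    law (c.jointLaw Q) (fun ω => ω.1 t) a = Q a := by
  classical
  rw [← law_law (c.jointLaw Q) Prod.fst fun s => s t, law_eq_sum_ite]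
  simp only [law_jointLaw_fst]
  have : ∀ s : Fin n → Src 𝒳 𝒴₁ 𝒴₂ 𝒵₁, (if s t = a then ∏ r, Q (s r) else 0) =
      ∏ r, if r = t then (if s r = a then Q (s r) else 0) else Q (s r) := fun s => by
    split_ifs with h
    · exact prod_congr rfl fun r _ => by split_ifs with h1 h2 <;> simp_all
    · exact (prod_eq_zero (mem_univ t) (by simp [h])).symm
  rw [sum_congr rfl fun s _ => this s,
    sum_pi_prod fun r b => if r = t then (if b = a then Q b else 0) else Q b]
  rw [prod_eq_single t (fun r _ hr => by simp [hr, hQ.2]) (by simp)]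
  simp

theorem entropy_seq (hP : P ∈ stdSimplex ℝ (Src 𝒳 𝒴₁ 𝒴₂ 𝒵₁)) (f : Src 𝒳 𝒴₁ 𝒴₂ 𝒵₁ → α) :
    entropy (c.jointLaw P) (fun ω t => f (ω.1 t)) = n * entropy P f := by
  have hp := jointLaw_mem c hP
  have e : ∀ t, entropy P f =
      -∑ ω, c.jointLaw P ω * Real.logb 2 (law P f (f (ω.1 t))) := fun t => by
    rw [entropy_eq_sum, ← sum_law_mul (c.jointLaw P) (fun ω => ω.1 t)
      fun a => Real.logb 2 (law P f (f a)), funext (law_letter c hP t)]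
  have e2 : (n : ℝ) * entropy P f = ∑ t : Fin n, entropy P f := by simp
  rw [e2, sum_congr rfl fun t _ => e t, sum_neg_distrib, sum_comm, entropy_eq_sum]
  congr 1
  refine sum_congr rfl fun ω _ => ?_
  rcases (hp.1 ω).eq_or_lt with h0 | h0
  · simp [← h0]
  · have := law_pos hp.1 (fun ω t => f (ω.1 t)) h0
    rw [law_seq] at this ⊢
    rw [Real.logb_prod _ _ fun t ht h => this.ne' (prod_eq_zero ht h), mul_sum]

theorem law_message_seq (f : Src 𝒳 𝒴₁ 𝒴₂ 𝒵₁ → β) (m : Message n R) (y : Fin n → β) :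
    law (c.jointLaw Q) (fun ω => (ω.2, fun t => f (ω.1 t))) (m, y) =
      ∑ x : Fin n → 𝒳, c.enc x m * ∏ t, law Q (fun s => (Xc s, f s)) (x t, y t) := by
  classical
  have h1 : ∀ x : Fin n → 𝒳, ∏ t, law Q (fun s => (Xc s, f s)) (x t, y t) =
      ∑ s : Fin n → Src 𝒳 𝒴₁ 𝒴₂ 𝒵₁, if (fun t => Xc (s t)) = x then
        (if (fun t => f (s t)) = y then ∏ t, Q (s t) else 0) else 0 := fun x => by
    simp only [law_eq_sum_ite]
    rw [← sum_pi_prod fun t a => if (Xc a, f a) = (x t, y t) then Q a else 0]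
    refine sum_congr rfl fun s _ => ?_
    rw [prod_ite_zero, ← ite_and]
    simp [funext_iff, forall_and]
  simp only [h1, mul_sum]
  rw [sum_comm, law_eq_sum_ite, Fintype.sum_prod_type]
  refine sum_congr rfl fun s _ => ?_
  rw [Fintype.sum_eq_single m fun m' hm => by simp [hm],
    Fintype.sum_eq_single (fun t => Xc (s t)) fun x hx => by simp [hx.symm]]
  simp [Code.jointLaw, mul_comm]

theorem law_altLaw_X_Y1_Z1 (hP : P ∈ stdSimplex ℝ (Src 𝒳 𝒴₁ 𝒴₂ 𝒵₁)) (x : 𝒳) (y : 𝒴₁) (z : 𝒵₁) :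
    law (altLaw P) (fun s => (Xc s, Y1c s, Z1c s)) (x, y, z) =
      law P (fun s => (Xc s, Z1c s)) (x, z) *
        (law P (fun s => (Y1c s, Z1c s)) (y, z) / law P Z1c z) := by
  rw [← sum_law_pair (altLaw P) _ Y2c]
  have : ∀ b, law (altLaw P) (fun s => ((Xc s, Y1c s, Z1c s), Y2c s)) ((x, y, z), b) =
      law P (fun s => (Xc s, Z1c s)) (x, z) *
        (law P (fun s => (Y1c s, Z1c s)) (y, z) / law P Z1c z) * law P Y2c b := fun b =>
    law_eq_of_iff _ _ _ (x, y, b, z) fun s => by simp [Xc, Y1c, Y2c, Z1c, Prod.ext_iff]; tauto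
  simp only [this, ← mul_sum, sum_law, hP.2, mul_one]

theorem law_altLaw_X_Y2 (hP : P ∈ stdSimplex ℝ (Src 𝒳 𝒴₁ 𝒴₂ 𝒵₁)) (x : 𝒳) (y : 𝒴₂) :
    law (altLaw P) (fun s => (Xc s, Y2c s)) (x, y) = law P Xc x * law P Y2c y := by
  rw [← sum_law_pair (altLaw P) _ fun s => (Z1c s, Y1c s)]
  have : ∀ b : 𝒵₁ × 𝒴₁, law (altLaw P) (fun s => ((Xc s, Y2c s), Z1c s, Y1c s)) ((x, y), b) =
      law P (fun s => (Xc s, Z1c s)) (x, b.1) *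
        (law P (fun s => (Y1c s, Z1c s)) (b.2, b.1) / law P Z1c b.1) * law P Y2c y := fun b =>
    law_eq_of_iff _ _ _ (x, b.2, y, b.1) fun s => by
      simp [Xc, Y1c, Y2c, Z1c, Prod.ext_iff]; tauto
  simp only [this, Fintype.sum_prod_type, ← sum_mul, ← mul_sum, ← sum_div, sum_law_pair']
  congr 1
  rw [← sum_law_pair P Xc Z1c]
  refine sum_congr rfl fun z _ => ?_
  -- At a null `z` the quotient is 0 by convention, and the joint probability of `x` and `z` is 0 as
  -- well.
  by_cases h : law P Z1c z = 0
  · rw [h, div_zero, mul_zero]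
    refine le_antisymm (law_nonneg hP.1 _ _) (h ▸ law_le_of_imp hP.1 _ _ _ _ fun s hs => ?_)
    simpa using congrArg Prod.snd hs
  · rw [div_self h, mul_one]

theorem altLaw_mem (hP : P ∈ stdSimplex ℝ (Src 𝒳 𝒴₁ 𝒴₂ 𝒵₁)) :
    altLaw P ∈ stdSimplex ℝ (Src 𝒳 𝒴₁ 𝒴₂ 𝒵₁) := by
  refine ⟨fun w => mul_nonneg (mul_nonneg (law_nonneg hP.1 _ _)
    (div_nonneg (law_nonneg hP.1 _ _) (law_nonneg hP.1 _ _))) (law_nonneg hP.1 _ _), ?_⟩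
  rw [← sum_law (altLaw P) fun s => (Xc s, Y2c s)]
  simp only [Fintype.sum_prod_type, law_altLaw_X_Y2 hP, ← mul_sum, sum_law, hP.2, mul_one]

theorem law_message (m : Message n R) :
    law (c.jointLaw Q) (fun ω => ω.2) m = ∑ x : Fin n → 𝒳, c.enc x m * ∏ t, law Q Xc (x t) := by
  rw [law_congr (c.jointLaw Q) (fun ω => ω.2) (fun ω => (ω.2, fun _ : Fin n => ())) m
    (m, fun _ => ()) fun ω => by simp, law_message_seq c fun _ => ()]
  refine sum_congr rfl fun x _ => ?_
  congr 1
  exact prod_congr rfl fun t _ => law_congr _ _ _ _ _ fun s => by simp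

theorem div_law_mul_cancel (hP : P ∈ stdSimplex ℝ (Src 𝒳 𝒴₁ 𝒴₂ 𝒵₁)) (y : 𝒴₁) (z : 𝒵₁) :
    law P (fun s => (Y1c s, Z1c s)) (y, z) / law P Z1c z * law P Z1c z =
      law P (fun s => (Y1c s, Z1c s)) (y, z) := by
  by_cases h : law P Z1c z = 0
  · rw [h, mul_zero]
    refine (le_antisymm (h ▸ law_le_of_imp hP.1 _ _ _ _ fun s hs => ?_) (law_nonneg hP.1 _ _)).symm
    simpa using congrArg Prod.snd hs
  · exact div_mul_cancel₀ _ h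

/-- The alternative preserves the laws of (M,Z₁ⁿ) and (Y₁ⁿ,Z₁ⁿ) and makes M and Y₁ⁿ independent
given Z₁ⁿ, so the divergence is I(M;Y₁ⁿ|Z₁ⁿ). -/
theorem typeII₁_converse (hP : P ∈ stdSimplex ℝ (Src 𝒳 𝒴₁ 𝒴₂ 𝒵₁)) {ε : ℝ} (hε : ε < 1)
    (hα : c.typeI₁ P ≤ ε) :
    0 < c.typeII₁ P ∧ -(1 - ε) * Real.logb 2 (c.typeII₁ P) ≤
      entropy (c.jointLaw P) (fun ω => (ω.2, fun t => Z1c (ω.1 t))) + n * cEnt P Y1c Z1c -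
        entropy (c.jointLaw P) (fun ω => (ω.2, fun t => (Y1c (ω.1 t), Z1c (ω.1 t)))) + 1 := by
  have key := typeII_converse (jointLaw_mem c hP) (jointLaw_mem c (altLaw_mem hP))
    (fun ω => (ω.2, fun t => (Y1c (ω.1 t), Z1c (ω.1 t))))
    (fun x => c.dec₁ (fun t => (x.2 t).1) (fun t => (x.2 t).2) x.1)
    (fun ω => (ω.2, fun t => Z1c (ω.1 t))) (fun ω t => (Y1c (ω.1 t), Z1c (ω.1 t)))
    (fun ω t => Z1c (ω.1 t)) (fun ω => ?_) hε hα
  · refine ⟨key.1, key.2.trans (le_of_eq ?_)⟩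
    rw [entropy_seq c hP fun s => (Y1c s, Z1c s), entropy_seq c hP Z1c, cEnt]
    ring
  · rw [law_message_seq c fun s => (Y1c s, Z1c s), law_message_seq c Z1c,
      law_seq c fun s => (Y1c s, Z1c s), law_seq c Z1c, sum_mul, sum_mul]
    refine sum_congr rfl fun x _ => ?_
    simp only [law_altLaw_X_Y1_Z1 hP, mul_assoc, ← prod_mul_distrib, div_law_mul_cancel hP]

/-- The alternative makes M and Y₂ⁿ independent with unchanged marginals, so the divergence is
I(M;Y₂ⁿ); a constant plays the role of the conditioning variable. -/
theorem typeII₂_converse (hP : P ∈ stdSimplex ℝ (Src 𝒳 𝒴₁ 𝒴₂ 𝒵₁)) {ε : ℝ} (hε : ε < 1)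
    (hα : c.typeI₂ P ≤ ε) :
    0 < c.typeII₂ P ∧ -(1 - ε) * Real.logb 2 (c.typeII₂ P) ≤
      entropy (c.jointLaw P) (fun ω => ω.2) + n * entropy P Y2c -
        entropy (c.jointLaw P) (fun ω => (ω.2, fun t => Y2c (ω.1 t))) + 1 := by
  have hp := jointLaw_mem c hP
  have key := typeII_converse hp (jointLaw_mem c (altLaw_mem hP))
    (fun ω => (ω.2, fun t => Y2c (ω.1 t))) (fun x => c.dec₂ x.2 x.1)
    (fun ω => ω.2) (fun ω t => Y2c (ω.1 t)) (fun _ => ()) (fun ω => ?_) hε hα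
  · refine ⟨key.1, key.2.trans (le_of_eq ?_)⟩
    rw [entropy_seq c hP Y2c, entropy_const hp.2 (fun _ => ()) fun _ _ => rfl]
    ring
  · have h1 : law (c.jointLaw P) (fun _ => ()) () = 1 := by
      have := sum_law (c.jointLaw P) fun _ => ()
      rw [hp.2] at this
      simpa using this
    rw [h1, mul_one, law_message_seq c Y2c, law_message, law_seq c Y2c, sum_mul]
    refine sum_congr rfl fun x _ => ?_
    simp only [law_altLaw_X_Y2 hP, mul_assoc, ← prod_mul_distrib]

/-- Given Xⁿ, the message is independent of the remaining source components: the encoder contributes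
the same factor to both products of laws. -/
theorem entropy_message_source (hP : P ∈ stdSimplex ℝ (Src 𝒳 𝒴₁ 𝒴₂ 𝒵₁)) :
    entropy (c.jointLaw P) (fun ω => ω) + n * entropy P Xc =
      entropy (c.jointLaw P) (fun ω => (ω.2, fun t => Xc (ω.1 t))) +
        n * entropy P (fun s => s) := by
  have hp := jointLaw_mem c hP
  rw [← entropy_seq c hP, ← entropy_seq c hP]
  refine entropy_add_eq hp.1 _ _ _ _ fun ω => ?_
  classical
  rw [law_eq_of_iff _ _ _ ω fun ω' => Iff.rfl, law_message_seq c Xc, law_seq c Xc,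
    law_seq c fun s => s]
  rw [Fintype.sum_eq_single fun t => Xc (ω.1 t)]
  · have h1 : ∀ a, law P (fun s => s) a = P a := fun a => law_eq_of_iff _ _ _ _ fun _ => Iff.rfl
    have h2 : ∀ x, law P (fun s => (Xc s, Xc s)) (x, x) = law P Xc x := fun x =>
      law_congr _ _ _ _ _ fun s => by simp
    simp only [h1, h2, Code.jointLaw]
    ring
  · intro x hx
    obtain ⟨t, ht⟩ := Function.ne_iff.1 hx
    rw [prod_eq_zero (mem_univ t), mul_zero]
    rw [law_eq_sum_ite]
    refine sum_eq_zero fun s _ => if_neg fun h => ht ?_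
    simp only [Prod.mk.injEq] at h
    exact h.1.symm.trans h.2

/-- Under a product pmf, requiring coordinate `t` to equal `a` amounts to overwriting it with `a`
and paying the factor `Q a`. -/
theorem sum_mul_update {σ : Type*} [Fintype σ] [DecidableEq σ] {Q : σ → ℝ} (hQ : Q ∈ stdSimplex ℝ σ)
    (t : Fin n) (a : σ) (G : (Fin n → σ) → ℝ) :
    ∑ s : Fin n → σ, (if s t = a then (∏ r, Q (s r)) * G s else 0) =
      Q a * ∑ s : Fin n → σ, (∏ r, Q (s r)) * G (Function.update s t a) := by
  have hprod : ∀ (b : σ) (r : {j // j ≠ t} → σ),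
      ∏ j, Q ((Equiv.funSplitAt t σ).symm (b, r) j) = Q b * ∏ j, Q (r j) := by
    intro b r
    rw [Fintype.prod_eq_mul_prod_subtype_ne _ t]
    congr 1
    · simp [Equiv.funSplitAt]
    · refine prod_congr rfl fun j _ => ?_
      simp [Equiv.funSplitAt, j.2]
  rw [← (Equiv.funSplitAt t σ).symm.sum_comp,
    ← (Equiv.funSplitAt t σ).symm.sum_comp, Fintype.sum_prod_type,
    Fintype.sum_prod_type]
  simp only [hprod]
  have h1 : ∀ (b : σ) (r : {j // j ≠ t} → σ),
      Function.update ((Equiv.funSplitAt t σ).symm (b, r)) t a =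
        (Equiv.funSplitAt t σ).symm (a, r) := by
    intro b r
    funext j
    by_cases hj : j = t
    · subst hj; simp [Equiv.funSplitAt]
    · simp [Equiv.funSplitAt, hj]
  have h2 : ∀ (b : σ) (r : {j // j ≠ t} → σ),
      (Equiv.funSplitAt t σ).symm (b, r) t = b := by
    intro b r; simp [Equiv.funSplitAt]
  simp only [h1, h2]
  rw [Fintype.sum_eq_single a fun b hb => by simp [hb]]
  simp only [if_true, mul_assoc, ← mul_sum]
  rw [← sum_mul, hQ.2, one_mul]

/-- A random variable that does not involve the `t`-th letter depends on it through `X` only. -/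
theorem isMarkovChain_letter (hP : P ∈ stdSimplex ℝ (Src 𝒳 𝒴₁ 𝒴₂ 𝒵₁)) (t : Fin n)
    (A : (Fin n → Src 𝒳 𝒴₁ 𝒴₂ 𝒵₁) × Message n R → β)
    (hA : ∀ s a m, A (Function.update s t a, m) = A (s, m)) :
    IsMarkovChain (c.jointLaw P) A (fun ω => Xc (ω.1 t))
      (fun ω => (Y1c (ω.1 t), Y2c (ω.1 t), Z1c (ω.1 t))) := by
  classical
  have hS := law_letter c hP t
  obtain ⟨K, hK⟩ : ∃ K : β → 𝒳 → ℝ, ∀ b a,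
      law (c.jointLaw P) (fun ω => (A ω, ω.1 t)) (b, a) = K b (Xc a) * P a := by
    -- The weight averages over all letters but overwrites the `X` component at time `t` seen by the
    -- encoder. That component is all that matters of the letter, since `A` ignores it.
    refine ⟨fun b x => ∑ s : Fin n → Src 𝒳 𝒴₁ 𝒴₂ 𝒵₁, (∏ r, P (s r)) * ∑ m, if A (s, m) = b then
      c.enc (Function.update (fun r => Xc (s r)) t x) m else 0, fun b a => ?_⟩
    have h1 := sum_mul_update hP t a fun s => ∑ m, if A (s, m) = b then
      c.enc (fun r => Xc (s r)) m else 0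
    have h2 : ∀ s : Fin n → Src 𝒳 𝒴₁ 𝒴₂ 𝒵₁, (fun r => Xc (Function.update s t a r)) =
        Function.update (fun r => Xc (s r)) t (Xc a) := fun s => by
      funext r
      by_cases hr : r = t
      · subst hr; simp
      · simp [hr]
    simp only [hA, h2] at h1
    refine Eq.trans ?_ (h1.trans (mul_comm _ _))
    rw [law_eq_sum_ite, Fintype.sum_prod_type]
    refine sum_congr rfl fun s _ => ?_
    by_cases hs : s t = a
    · simp [hs, Code.jointLaw, mul_sum]
    · simp [hs]
  intro b x y
  obtain ⟨y₁, y₂, z⟩ := y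
  have e1 : law (c.jointLaw P) (fun ω => (A ω, Xc (ω.1 t), Y1c (ω.1 t), Y2c (ω.1 t), Z1c (ω.1 t)))
      (b, x, y₁, y₂, z) = K b x * P (x, y₁, y₂, z) := by
    rw [show K b x = K b (Xc (x, y₁, y₂, z)) from rfl, ← hK]
    exact law_congr _ _ _ _ _ fun ω => by simp [Xc, Y1c, Y2c, Z1c, Prod.ext_iff]
  have e2 : law (c.jointLaw P) (fun ω => (Xc (ω.1 t), Y1c (ω.1 t), Y2c (ω.1 t), Z1c (ω.1 t)))
      (x, y₁, y₂, z) = P (x, y₁, y₂, z) := by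
    rw [← hS]
    exact law_congr _ _ _ _ _ fun ω => by simp [Xc, Y1c, Y2c, Z1c, Prod.ext_iff]
  have e3 : law (c.jointLaw P) (fun ω => Xc (ω.1 t)) x = law P Xc x := by
    rw [← law_law _ (fun ω : (Fin n → Src 𝒳 𝒴₁ 𝒴₂ 𝒵₁) × Message n R => ω.1 t), funext hS]
  have e4 : law (c.jointLaw P) (fun ω => (A ω, Xc (ω.1 t))) (b, x) = K b x * law P Xc x := by
    rw [← law_section (c.jointLaw P) A (fun ω => ω.1 t), ← law_mul_left, law_eq_sum_ite,
      law_eq_sum_ite]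
    refine sum_congr rfl fun a _ => ?_
    split_ifs with h
    · rw [hK, h]
    · rfl
  rw [e1, e2, e3, e4]
  ring

end Joint

/-! ### Single-letterization: chain rules and the sum identity. -/

section SingleLetter

variable {𝒳 𝒴₁ 𝒴₂ 𝒵₁ : Type*} {n : ℕ} {μ α : Type*}

/-- The letters before time `k`. -/
def before (k : ℕ) (f : Src 𝒳 𝒴₁ 𝒴₂ 𝒵₁ → α) (ω : (Fin n → Src 𝒳 𝒴₁ 𝒴₂ 𝒵₁) × μ) :
    {s : Fin n // s.1 < k} → α := fun s => f (ω.1 s)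

/-- The letters from time `k` on. -/
def since (k : ℕ) (f : Src 𝒳 𝒴₁ 𝒴₂ 𝒵₁ → α) (ω : (Fin n → Src 𝒳 𝒴₁ 𝒴₂ 𝒵₁) × μ) :
    {s : Fin n // k ≤ s.1} → α := fun s => f (ω.1 s)

/-- The letters at times other than `t`. -/
def except (t : Fin n) (f : Src 𝒳 𝒴₁ 𝒴₂ 𝒵₁ → α) (ω : (Fin n → Src 𝒳 𝒴₁ 𝒴₂ 𝒵₁) × μ) :
    {s : Fin n // s ≠ t} → α := fun s => f (ω.1 s)

theorem before_eq_iff {k : ℕ} {f : Src 𝒳 𝒴₁ 𝒴₂ 𝒵₁ → α} {ω ω' : (Fin n → Src 𝒳 𝒴₁ 𝒴₂ 𝒵₁) × μ} :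
    before k f ω = before k f ω' ↔ ∀ s : Fin n, s.1 < k → f (ω.1 s) = f (ω'.1 s) := by
  simp [before, funext_iff]

theorem since_eq_iff {k : ℕ} {f : Src 𝒳 𝒴₁ 𝒴₂ 𝒵₁ → α} {ω ω' : (Fin n → Src 𝒳 𝒴₁ 𝒴₂ 𝒵₁) × μ} :
    since k f ω = since k f ω' ↔ ∀ s : Fin n, k ≤ s.1 → f (ω.1 s) = f (ω'.1 s) := by
  simp [since, funext_iff]

theorem except_eq_iff {t : Fin n} {f : Src 𝒳 𝒴₁ 𝒴₂ 𝒵₁ → α}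
    {ω ω' : (Fin n → Src 𝒳 𝒴₁ 𝒴₂ 𝒵₁) × μ} :
    except t f ω = except t f ω' ↔ ∀ s : Fin n, s ≠ t → f (ω.1 s) = f (ω'.1 s) := by
  simp [except, funext_iff]

theorem forall_lt_succ_iff (t : Fin n) (p : Fin n → Prop) :
    (∀ s : Fin n, s.1 < t.1 + 1 → p s) ↔ p t ∧ ∀ s : Fin n, s.1 < t.1 → p s := by
  refine ⟨fun h => ⟨h t (by omega), fun s hs => h s (by omega)⟩, fun h s hs => ?_⟩
  rcases Nat.lt_succ_iff_lt_or_eq.1 hs with h1 | h1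
  · exact h.2 s h1
  · rw [Fin.ext h1]; exact h.1

theorem forall_le_iff (t : Fin n) (p : Fin n → Prop) :
    (∀ s : Fin n, t.1 ≤ s.1 → p s) ↔ p t ∧ ∀ s : Fin n, t.1 + 1 ≤ s.1 → p s := by
  refine ⟨fun h => ⟨h t le_rfl, fun s hs => h s (by omega)⟩, fun h s hs => ?_⟩
  rcases hs.eq_or_lt with h1 | h1
  · rw [← Fin.ext h1]; exact h.1
  · exact h.2 s h1

theorem sum_fin_sub (F : ℕ → ℝ) (n : ℕ) : ∑ t : Fin n, (F (t.1 + 1) - F t.1) = F n - F 0 := by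
  rw [Fin.sum_univ_eq_sum_range fun k => F (k + 1) - F k, sum_range_sub]

variable [Fintype 𝒳] [Fintype 𝒴₁] [Fintype 𝒴₂] [Fintype 𝒵₁] [Fintype μ]
  {p : (Fin n → Src 𝒳 𝒴₁ 𝒴₂ 𝒵₁) × μ → ℝ}

/-- The auxiliary random variable of receiver 2. -/
def auxV (t : Fin n) (ω : (Fin n → Src 𝒳 𝒴₁ 𝒴₂ 𝒵₁) × μ) :
    μ × ({s : Fin n // s.1 < t.1} → 𝒴₂) × ({s : Fin n // t.1 + 1 ≤ s.1} → 𝒵₁) :=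
  (ω.2, before t.1 Y2c ω, since (t.1 + 1) Z1c ω)

/-- The additional auxiliary random variable of receiver 1. -/
def auxW (t : Fin n) (ω : (Fin n → Src 𝒳 𝒴₁ 𝒴₂ 𝒵₁) × μ) :
    ({s : Fin n // s.1 < t.1} → 𝒴₁ × 𝒴₂) × ({s : Fin n // s ≠ t} → 𝒵₁) :=
  (before t.1 (fun s => (Y1c s, Y2c s)) ω, except t Z1c ω)

/-- Csiszár's sum identity. `F k` is the entropy of the message with a hybrid sequence, `Y₂` before
`k` and `Z₁` from `k` on. Time `t` exchanges one letter of the hybrid, and the sum telescopes. -/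
theorem sum_cEnt_auxV (p : (Fin n → Src 𝒳 𝒴₁ 𝒴₂ 𝒵₁) × μ → ℝ) :
    ∑ t : Fin n, (cEnt p (fun ω => Y2c (ω.1 t)) (auxV t) - cEnt p (fun ω => Z1c (ω.1 t)) (auxV t)) =
      entropy p (fun ω => (ω.2, fun t => Y2c (ω.1 t))) -
        entropy p (fun ω => (ω.2, fun t => Z1c (ω.1 t))) := by
  set F : ℕ → ℝ := fun k => entropy p fun ω => (ω.2, before k Y2c ω, since k Z1c ω) with hF
  have h : ∀ t : Fin n, cEnt p (fun ω => Y2c (ω.1 t)) (auxV t) -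
      cEnt p (fun ω => Z1c (ω.1 t)) (auxV t) = F (t.1 + 1) - F t.1 := by
    intro t
    have e1 : entropy p (fun ω => (Y2c (ω.1 t), auxV t ω)) = F (t.1 + 1) :=
      entropy_congr _ _ _ fun ω ω' => by
        simp only [auxV, Prod.mk.injEq, before_eq_iff, since_eq_iff, forall_lt_succ_iff]; tauto
    have e2 : entropy p (fun ω => (Z1c (ω.1 t), auxV t ω)) = F t.1 :=
      entropy_congr _ _ _ fun ω ω' => by
        simp only [auxV, Prod.mk.injEq, before_eq_iff, since_eq_iff, forall_le_iff]; tauto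
    rw [cEnt, cEnt, e1, e2]
    ring
  rw [sum_congr rfl fun t _ => h t, sum_fin_sub]
  congr 1
  · exact entropy_congr _ _ _ fun ω ω' => by
      simp only [Prod.mk.injEq, before_eq_iff, since_eq_iff]
      simp [funext_iff, Nat.not_le.2]
  · exact entropy_congr _ _ _ fun ω ω' => by
      simp only [Prod.mk.injEq, before_eq_iff, since_eq_iff]
      simp [funext_iff]

/-- Chain rule for Z₁ⁿ given M from the last letter to the first; `auxV t` contains the past of `Y₂`
in addition. The gap in this inequality is the slack that erasure later absorbs. -/
theorem sum_cEnt_Z1_auxV_le (hp : p ∈ stdSimplex ℝ _) :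
    ∑ t : Fin n, cEnt p (fun ω => Z1c (ω.1 t)) (auxV t) ≤
      entropy p (fun ω => (ω.2, fun t => Z1c (ω.1 t))) - entropy p (fun ω => ω.2) := by
  set F : ℕ → ℝ := fun k => -entropy p fun ω => (ω.2, since k Z1c ω) with hF
  have h : ∀ t : Fin n, cEnt p (fun ω => Z1c (ω.1 t)) (auxV t) ≤ F (t.1 + 1) - F t.1 := by
    intro t
    have e1 : entropy p (fun ω => (Z1c (ω.1 t), ω.2, since (t.1 + 1) Z1c ω)) =
        entropy p fun ω => (ω.2, since t.1 Z1c ω) :=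
      entropy_congr _ _ _ fun ω ω' => by
        simp only [Prod.mk.injEq, since_eq_iff, forall_le_iff]; tauto
    have := entropy_sub_anti hp.1 (fun ω => Z1c (ω.1 t)) (auxV t)
      (fun ω => (ω.2, since (t.1 + 1) Z1c ω)) fun ω ω' => by
        simp only [auxV, Prod.mk.injEq]; tauto
    rw [e1] at this
    simp only [hF, cEnt]
    linarith
  refine (sum_le_sum fun t _ => h t).trans (le_of_eq ?_)
  rw [sum_fin_sub]
  have e1 : entropy p (fun ω => (ω.2, since n Z1c ω)) = entropy p fun ω => ω.2 :=
    entropy_congr _ _ _ fun ω ω' => by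
      simp [Prod.mk.injEq, since_eq_iff, Nat.not_le.2]
  have e2 : entropy p (fun ω => (ω.2, since 0 Z1c ω)) =
      entropy p (fun ω => (ω.2, fun t => Z1c (ω.1 t))) :=
    entropy_congr _ _ _ fun ω ω' => by
      simp only [Prod.mk.injEq, since_eq_iff]
      simp [funext_iff]
  simp only [hF, e1, e2]
  ring

/-- Chain rule for Y₁ⁿ given (M,Z₁ⁿ): the variables conditioned on at time `t` determine M, all of
Z₁ⁿ and the past of Y₁. -/
theorem sum_cEnt_Y1_le (hp : p ∈ stdSimplex ℝ _) :
    ∑ t : Fin n, cEnt p (fun ω => Y1c (ω.1 t)) (fun ω => (Z1c (ω.1 t), auxV t ω, auxW t ω)) ≤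
      entropy p (fun ω => (ω.2, fun t => (Y1c (ω.1 t), Z1c (ω.1 t)))) -
        entropy p (fun ω => (ω.2, fun t => Z1c (ω.1 t))) := by
  set F : ℕ → ℝ := fun k => entropy p fun ω => (ω.2, (fun t => Z1c (ω.1 t)), before k Y1c ω) with hF
  have h : ∀ t : Fin n, cEnt p (fun ω => Y1c (ω.1 t))
      (fun ω => (Z1c (ω.1 t), auxV t ω, auxW t ω)) ≤ F (t.1 + 1) - F t.1 := by
    intro t
    have e1 : entropy p (fun ω => (Y1c (ω.1 t), ω.2, (fun t => Z1c (ω.1 t)), before t.1 Y1c ω)) =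
        F (t.1 + 1) :=
      entropy_congr _ _ _ fun ω ω' => by
        simp only [Prod.mk.injEq, before_eq_iff, forall_lt_succ_iff]; tauto
    have := entropy_sub_anti hp.1 (fun ω => Y1c (ω.1 t))
      (fun ω => (Z1c (ω.1 t), auxV t ω, auxW t ω))
      (fun ω => (ω.2, (fun t => Z1c (ω.1 t)), before t.1 Y1c ω)) fun ω ω' => by
        simp only [auxV, auxW, Prod.mk.injEq, before_eq_iff, except_eq_iff]
        simp only [funext_iff]
        rintro ⟨h1, ⟨h2, -⟩, h3, h4⟩
        refine ⟨h2, fun s => ?_, fun s hs => (h3 s hs).1⟩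
        by_cases hs : s = t
        · rw [hs, h1]
        · exact h4 s hs
    rw [e1] at this
    exact this
  refine (sum_le_sum fun t _ => h t).trans (le_of_eq ?_)
  rw [sum_fin_sub]
  congr 1
  · exact entropy_congr _ _ _ fun ω ω' => by
      simp only [Prod.mk.injEq, before_eq_iff]
      simp [funext_iff, forall_and, and_comm]
  · exact entropy_congr _ _ _ fun ω ω' => by
      simp only [Prod.mk.injEq, before_eq_iff]
      simp [funext_iff]

/-- Chain rule for the full source letters given (M,Z₁ⁿ). Once X and Z₁ at time `t` are known,
(Y₁,Y₂) adds at most its single-letter conditional entropy, which is subtracted on the left. The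
full past and Z₁ⁿ determine the auxiliary variables, so conditioning on them gives a lower bound for
the entropy of X. -/
theorem le_sum_cEnt_X (hp : p ∈ stdSimplex ℝ _) {P : Src 𝒳 𝒴₁ 𝒴₂ 𝒵₁ → ℝ}
    (hS : ∀ (t : Fin n) a, law p (fun ω => ω.1 t) a = P a) :
    entropy p (fun ω => ω) - entropy p (fun ω => (ω.2, fun t => Z1c (ω.1 t))) -
        n * (entropy P (fun s => s) - entropy P (fun s => (Xc s, Z1c s))) ≤
      ∑ t : Fin n, cEnt p (fun ω => Xc (ω.1 t)) (fun ω => (Z1c (ω.1 t), auxV t ω, auxW t ω)) := by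
  set F : ℕ → ℝ := fun k => entropy p fun ω =>
    (ω.2, (fun t => Z1c (ω.1 t)), before k (fun s => s) ω) with hF
  have h : ∀ t : Fin n, F (t.1 + 1) - F t.1 -
      (entropy P (fun s => s) - entropy P (fun s => (Xc s, Z1c s))) ≤ cEnt p (fun ω => Xc (ω.1 t))
      (fun ω => (Z1c (ω.1 t), auxV t ω, auxW t ω)) := by
    intro t
    have h1 := entropy_sub_anti hp.1 (fun ω => Xc (ω.1 t))
      (fun ω => (ω.2, (fun t => Z1c (ω.1 t)), before t.1 (fun s => s) ω))
      (fun ω => (Z1c (ω.1 t), auxV t ω, auxW t ω)) fun ω ω' => by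
        simp only [auxV, auxW, Prod.mk.injEq, before_eq_iff, except_eq_iff, since_eq_iff]
        simp only [funext_iff]
        rintro ⟨h1, h2, h3⟩
        exact ⟨h2 t, ⟨h1, fun s hs => by rw [h3 s hs], fun s _ => h2 s⟩,
          fun s hs => by simp [h3 s hs], fun s _ => h2 s⟩
    have h2 := entropy_sub_anti hp.1 (fun ω => (Y1c (ω.1 t), Y2c (ω.1 t)))
      (fun ω => (Xc (ω.1 t), ω.2, (fun t => Z1c (ω.1 t)), before t.1 (fun s => s) ω))
      (fun ω => (Xc (ω.1 t), Z1c (ω.1 t))) fun ω ω' => by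
        simp only [Prod.mk.injEq, funext_iff]
        rintro ⟨h1, -, h2, -⟩
        exact ⟨h1, h2 t⟩
    have e1 : entropy p (fun ω => ((Y1c (ω.1 t), Y2c (ω.1 t)), Xc (ω.1 t), ω.2,
        (fun t => Z1c (ω.1 t)), before t.1 (fun s => s) ω)) = F (t.1 + 1) :=
      entropy_congr _ _ _ fun ω ω' => by
        simp only [Prod.mk.injEq, before_eq_iff, forall_lt_succ_iff]
        simp only [funext_iff]
        constructor
        · rintro ⟨⟨h1, h2⟩, h3, h4, h5, h6⟩
          exact ⟨h4, h5, Prod.ext h3 (Prod.ext h1 (Prod.ext h2 (h5 t))), h6⟩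
        · rintro ⟨h1, h2, h3, h4⟩
          simp only [h3]
          exact ⟨⟨trivial, trivial⟩, trivial, h1, h2, h4⟩
    have e2 : entropy p (fun ω => ((Y1c (ω.1 t), Y2c (ω.1 t)), Xc (ω.1 t), Z1c (ω.1 t))) =
        entropy P fun s => s := by
      rw [← funext (hS t), entropy_law]
      exact entropy_congr _ _ _ fun ω ω' => by
        simp only [Xc, Y1c, Y2c, Z1c, Prod.ext_iff]; tauto
    have e3 : entropy p (fun ω => (Xc (ω.1 t), Z1c (ω.1 t))) =
        entropy P fun s => (Xc s, Z1c s) := by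
      rw [← funext (hS t), entropy_law]
    rw [e1, e2, e3] at h2
    simp only [hF, cEnt] at h1 h2 ⊢
    linarith
  have hs := sum_le_sum fun t (_ : t ∈ (univ : Finset (Fin n))) => h t
  rw [sum_sub_distrib, sum_fin_sub] at hs
  have e1 : F n = entropy p fun ω => ω := entropy_congr _ _ _ fun ω ω' => by
    simp only [Prod.mk.injEq, before_eq_iff]
    exact ⟨fun h => Prod.ext (funext fun s => h.2.2 s s.2) h.1, fun h => by subst h; simp⟩
  have e2 : F 0 = entropy p fun ω => (ω.2, fun t => Z1c (ω.1 t)) :=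
    entropy_congr _ _ _ fun ω ω' => by
      simp only [Prod.mk.injEq, before_eq_iff]
      simp [funext_iff]
  rw [e1, e2] at hs
  simp only [sum_const, card_univ, Fintype.card_fin, nsmul_eq_mul] at hs
  exact hs

end SingleLetter

/-! ### The single-letter converse for one code. -/

section Converse

variable {𝒳 𝒴₁ 𝒴₂ 𝒵₁ : Type*} [Fintype 𝒳] [Fintype 𝒴₁] [Fintype 𝒴₂] [Fintype 𝒵₁]
  {P : Src 𝒳 𝒴₁ 𝒴₂ 𝒵₁ → ℝ} {n : ℕ} {R : ℝ}

/-- The single-letter converse. -/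
theorem mem_triples_of_code (hP : P ∈ stdSimplex ℝ (Src 𝒳 𝒴₁ 𝒴₂ 𝒵₁)) (hZY : LessNoisy P)
    (hn : 0 < n) (c : Code 𝒳 𝒴₁ 𝒴₂ 𝒵₁ n R) :
    ((entropy (c.jointLaw P) (fun ω => (ω.2, fun t => Z1c (ω.1 t))) + n * cEnt P Y1c Z1c -
        entropy (c.jointLaw P) (fun ω => (ω.2, fun t => (Y1c (ω.1 t), Z1c (ω.1 t))))) / n,
      (entropy (c.jointLaw P) (fun ω => ω.2) + n * entropy P Y2c -
        entropy (c.jointLaw P) (fun ω => (ω.2, fun t => Y2c (ω.1 t)))) / n,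
      Real.logb 2 (Fintype.card (Message n R)) / n) ∈ triples P := by
  have hp := jointLaw_mem c hP
  set p := c.jointLaw P
  have hn' : (0 : ℝ) < n := by exact_mod_cast hn
  have h1 := sum_cEnt_auxV p
  have h2 := sum_cEnt_Z1_auxV_le hp
  have h3 := sum_cEnt_Y1_le hp
  have h4 := le_sum_cEnt_X hp (law_letter c hP)
  have h5 := entropy_message_source c hP
  have h6 := entropy_le_logb_card hp fun ω => ω.2
  have h7 := entropy_le_of_determines hp.1 (fun ω => (ω.2, fun t => Xc (ω.1 t)))
    (fun ω t => Xc (ω.1 t)) fun ω ω' => by simp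
  have h8 := entropy_pair_le hp (fun ω => ω.2) fun ω t => Y2c (ω.1 t)
  rw [entropy_seq c hP Xc] at h7
  rw [entropy_seq c hP Y2c] at h8
  have hmem : ∀ t : Fin n, (P, cEnt p (fun ω => Y2c (ω.1 t)) (auxV t),
      cEnt p (fun ω => Z1c (ω.1 t)) (auxV t),
      cEnt p (fun ω => Xc (ω.1 t)) (fun ω => (Z1c (ω.1 t), auxV t ω, auxW t ω)),
      cEnt p (fun ω => Y1c (ω.1 t)) (fun ω => (Z1c (ω.1 t), auxV t ω, auxW t ω))) ∈ hull₀ P := by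
    intro t
    refine mem_hull₀_of_isMarkovChain hp (auxV t) (auxW t) (fun ω => ω.1 t) (law_letter c hP t)
      (isMarkovChain_letter c hP t _ fun s a m => ?_)
    have e : ∀ r : Fin n, r ≠ t → Function.update s t a r = s r := fun r hr => by simp [hr]
    simp only [auxV, auxW, Prod.mk.injEq, before_eq_iff, except_eq_iff, since_eq_iff, true_and]
    refine ⟨⟨fun r hr => ?_, fun r hr => ?_⟩, fun r hr => ?_, fun r hr => ?_⟩ <;>
      simp only [e r (by rintro rfl; omega), and_self]
  -- Averaging over `t` stays in the hull; this replaces a time-sharing variable inside `U₀`.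
  have havg := (convex_convexHull ℝ _ : Convex ℝ (hull₀ P)).sum_mem (t := univ)
    (w := fun _ : Fin n => (n : ℝ)⁻¹) (fun _ _ => by positivity) (by simp [hn'.ne'])
    (fun t _ => hmem t)
  rw [← smul_sum] at havg
  set C := ∑ t : Fin n, cEnt p (fun ω => Y2c (ω.1 t)) (auxV t) with hC
  set D := ∑ t : Fin n, cEnt p (fun ω => Z1c (ω.1 t)) (auxV t) with hD
  set A := ∑ t : Fin n, cEnt p (fun ω => Xc (ω.1 t))
    (fun ω => (Z1c (ω.1 t), auxV t ω, auxW t ω)) with hA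
  set B := ∑ t : Fin n, cEnt p (fun ω => Y1c (ω.1 t))
    (fun ω => (Z1c (ω.1 t), auxV t ω, auxW t ω)) with hB
  have hpt : (P, C / n, D / n, A / n, B / n) ∈ hull₀ P := by
    refine Set.mem_of_eq_of_mem ?_ havg
    refine Prod.ext ?_ (Prod.ext ?_ (Prod.ext ?_ (Prod.ext ?_ ?_))) <;>
      simp only [Prod.smul_fst, Prod.smul_snd, Prod.fst_sum, Prod.snd_sum, smul_eq_mul]
    · funext s
      simp [hn'.ne']
    · rw [hC]; ring
    · rw [hD]; ring
    · rw [hA]; ring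
    · rw [hB]; ring
  rw [sum_sub_distrib] at h1
  have hln := hZY.sub_le_sub hpt
  set HM := entropy p fun ω => ω.2
  set HZ := entropy p (fun ω => (ω.2, fun t => Z1c (ω.1 t)))
  set HY := entropy p (fun ω => (ω.2, fun t => Y2c (ω.1 t)))
  set I₂ := entropy P Y2c - C / n with hI₂
  -- `τ` is the gap of `sum_cEnt_Z1_auxV_le` per letter. It lowers both quantities alike: I(M;Y₂ⁿ)/n
  -- is `I₂ - τ`, and I(M;Z₁ⁿ)/n is `entropy P Z1c - D / n - τ`.
  set τ := (HZ - HM - D) / n with hτ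
  have hτ0 : 0 ≤ τ := div_nonneg (by linarith) hn'.le
  have hτI : (HM + n * entropy P Y2c - HY) / n = I₂ - τ := by
    rw [hI₂, hτ]; field_simp; linarith
  have hnn : 0 ≤ I₂ - τ := by
    rw [← hτI]; exact div_nonneg (by linarith) hn'.le
  -- `l` is the erasure probability, chosen so that I(U₀;Y₂) drops by exactly `τ`. If `I₂ = 0` then
  -- `τ = 0` and nothing is erased.
  obtain ⟨l, hl0, hl1, hl⟩ : ∃ l : ℝ, 0 ≤ l ∧ l ≤ 1 ∧ l * I₂ = τ := by
    rcases (hτ0.trans (sub_nonneg.1 hnn)).eq_or_lt with h0 | h0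
    · exact ⟨0, le_rfl, zero_le_one, by linarith⟩
    · exact ⟨τ / I₂, div_nonneg hτ0 h0.le, (div_le_one h0).2 (by linarith),
        div_mul_cancel₀ _ h0.ne'⟩
  refine ⟨_, _, _, _, erase_mem_hull₀ hl0 hl1 hpt, ?_, ?_, ?_⟩
  · simp only
    rw [div_le_iff₀ hn', sub_mul, div_mul_cancel₀ _ hn'.ne']
    linarith
  · simp only
    rw [hτI, ← hl, hI₂]
    linarith
  · simp only
    have hr : τ * n = HZ - HM - D := div_mul_cancel₀ _ hn'.ne'
    -- Less noisiness enters here: the erasure removes at least `τ` from I(U₀;Z₁), as much as the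
    -- rate bound lacks.
    have h9 : l * I₂ ≤ l * (entropy P Z1c - D / n) := mul_le_mul_of_nonneg_left hln hl0
    have h10 : (entropy P Z1c - D / n) - τ + (cEnt P Xc Z1c - A / n) ≤
        Real.logb 2 (Fintype.card (Message n R)) / n := by
      rw [le_div_iff₀ hn']
      have e : (entropy P Z1c - D / n - τ + (cEnt P Xc Z1c - A / n)) * n =
        n * entropy P Z1c - D - τ * n + n * cEnt P Xc Z1c - A := by field_simp; ring
      rw [e, hr, cEnt]
      linarith
    linarith

end Converse

/-! ### Error exponents against bounds at finite blocklength. -/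

section Exponent

open Filter Topology

theorem coe_mul_elog2 (x : ℝ) {b : ℝ} (hb : 0 < b) :
    (x : EReal) * elog2 b = ((x * Real.logb 2 b : ℝ) : EReal) := by
  rw [elog2, if_neg hb.ne', EReal.coe_mul]

theorem le_errorExponent {β : ℕ → ℝ} {θ : ℝ} (h0 : ∀ n, 0 ≤ β n)
    (h : ∀ᶠ n : ℕ in atTop, β n ≤ 2 ^ (-((n : ℝ) * θ))) : (θ : EReal) ≤ errorExponent β := by
  rw [errorExponent, EReal.le_neg]
  refine limsup_le_of_le (by isBoundedDefault) ?_
  filter_upwards [h, eventually_gt_atTop 0] with n hn hn0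
  have hn' : (0 : ℝ) < n := by exact_mod_cast hn0
  rcases (h0 n).eq_or_lt with hb | hb
  · rw [elog2, if_pos hb.symm, EReal.coe_mul_bot_of_pos (by positivity)]
    exact bot_le
  · rw [coe_mul_elog2 _ hb, ← EReal.coe_neg, EReal.coe_le_coe_iff]
    have := Real.logb_le_logb_of_le (b := 2) (by norm_num) hb hn
    rw [Real.logb_rpow (by norm_num) (by norm_num)] at this
    calc 1 / (n : ℝ) * Real.logb 2 (β n) ≤ 1 / (n : ℝ) * (-((n : ℝ) * θ)) := by gcongr
      _ = -θ := by field_simp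

theorem eventually_of_lt_errorExponent {β : ℕ → ℝ} {θ : ℝ} (h : (θ : EReal) < errorExponent β) :
    ∀ᶠ n : ℕ in atTop, 0 < β n → θ ≤ -(Real.logb 2 (β n)) / n := by
  rw [errorExponent, EReal.lt_neg_comm] at h
  filter_upwards [eventually_lt_of_limsup_lt h] with n hn hb
  rw [coe_mul_elog2 _ hb, ← EReal.coe_neg, EReal.coe_lt_coe_iff] at hn
  have e : -(Real.logb 2 (β n)) / n = -(1 / (n : ℝ) * Real.logb 2 (β n)) := by ring
  rw [e]
  linarith

end Exponent

/-! ### The exponents region lies in the inner region. -/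

section Region

open Filter Topology

variable {𝒳 𝒴₁ 𝒴₂ 𝒵₁ : Type*} [Fintype 𝒳] [Fintype 𝒴₁] [Fintype 𝒴₂] [Fintype 𝒵₁]
  {P : Src 𝒳 𝒴₁ 𝒴₂ 𝒵₁ → ℝ} {R : ℝ}

theorem triples_mono {t t' : ℝ × ℝ × ℝ} (h : t ∈ triples P) (h1 : t'.1 ≤ t.1)
    (h2 : t'.2.1 ≤ t.2.1) (h3 : t.2.2 ≤ t'.2.2) : t' ∈ triples P := by
  obtain ⟨c, d, a, b, h, k1, k2, k3⟩ := h
  exact ⟨c, d, a, b, h, h1.trans k1, h2.trans k2, k3.trans h3⟩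

theorem logb_card_message_le (hR : 0 ≤ R) (n : ℕ) :
    Real.logb 2 (Fintype.card (Message n R)) ≤ n * R + 1 := by
  have h1 : (1 : ℝ) ≤ 2 ^ ((n : ℝ) * R) := Real.one_le_rpow (by norm_num) (by positivity)
  rw [Fintype.card_fin]
  have h2 : ((⌊(2 : ℝ) ^ ((n : ℝ) * R)⌋₊ + 1 : ℕ) : ℝ) ≤ 2 ^ ((n : ℝ) * R + 1) := by
    push_cast
    rw [Real.rpow_add (by norm_num), Real.rpow_one]
    linarith [Nat.floor_le (zero_le_one.trans h1)]
  calc _ ≤ Real.logb 2 (2 ^ ((n : ℝ) * R + 1)) :=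
        Real.logb_le_logb_of_le (by norm_num) (by positivity) h2
    _ = n * R + 1 := Real.logb_rpow (by norm_num) (by norm_num)

/-- One long block suffices. The factor `1 - ε` is the loss of the weak converse, the inner `ε` pays
for passing from the limit to a finite `n`, and the outer ones absorb the terms `1 / n`. -/
theorem mem_triples_of_epsAchievable (hP : P ∈ stdSimplex ℝ (Src 𝒳 𝒴₁ 𝒴₂ 𝒵₁))
    (hZY : LessNoisy P) (hR : 0 ≤ R) {ε θ₁ θ₂ : ℝ} (hε0 : 0 < ε) (hε1 : ε < 1)
    (h : EpsAchievable P ε θ₁ θ₂ R) :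
    ((1 - ε) * (θ₁ - ε) - ε, (1 - ε) * (θ₂ - ε) - ε, R + ε) ∈ triples P := by
  obtain ⟨c, hα, h1, h2⟩ := h
  have hlt : ∀ θ : ℝ, ((θ - ε : ℝ) : EReal) < (θ : EReal) := fun θ => by
    rw [EReal.coe_lt_coe_iff]; linarith
  have hlarge : ∀ᶠ n : ℕ in atTop, 1 / ε < (n : ℝ) :=
    tendsto_natCast_atTop_atTop.eventually_gt_atTop (1 / ε)
  obtain ⟨n, hn, hnα, hn1, hn2, hnε⟩ := ((eventually_gt_atTop 0).and (hα.and
    ((eventually_of_lt_errorExponent ((hlt θ₁).trans_le h1)).and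
      ((eventually_of_lt_errorExponent ((hlt θ₂).trans_le h2)).and hlarge)))).exists
  have hn' : (0 : ℝ) < n := by exact_mod_cast hn
  have h1n : 1 / (n : ℝ) ≤ ε := by
    rw [div_le_iff₀ hn']; rw [div_lt_iff₀ hε0] at hnε; linarith
  obtain ⟨hb1, hd1⟩ := typeII₁_converse (c n) hP hε1 hnα.1
  obtain ⟨hb2, hd2⟩ := typeII₂_converse (c n) hP hε1 hnα.2
  have hstep : ∀ {θ L D : ℝ}, θ - ε ≤ -L / n → -(1 - ε) * L ≤ D + 1 →
      (1 - ε) * (θ - ε) - ε ≤ D / n := by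
    intro θ L D ha hb
    have : (1 - ε) * (-L / n) ≤ (D + 1) / n := by
      rw [← mul_div_assoc]; gcongr; linarith
    rw [add_div] at this
    have := mul_le_mul_of_nonneg_left ha (sub_nonneg.2 hε1.le)
    linarith
  refine triples_mono (mem_triples_of_code hP hZY hn (c n)) (hstep (hn1 hb1) hd1)
    (hstep (hn2 hb2) hd2) ?_
  have := logb_card_message_le hR n
  calc Real.logb 2 (Fintype.card (Message n R)) / n ≤ (n * R + 1) / n := by gcongr
    _ = R + 1 / n := by field_simp
    _ ≤ R + ε := by linarith

theorem region_subset_innerRegion (hP : P ∈ stdSimplex ℝ (Src 𝒳 𝒴₁ 𝒴₂ 𝒵₁))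
    (hZY : LessNoisy P) (hR : 0 ≤ R) : region P R ⊆ innerRegion P R := by
  refine closure_minimal ?_ (isClosed_innerRegion P R)
  rintro ⟨θ₁, θ₂⟩ ⟨h1, h2, h⟩
  rw [mem_innerRegion_iff]
  refine ⟨h1, h2, ?_⟩
  have hlim : Tendsto (fun ε : ℝ => ((1 - ε) * (θ₁ - ε) - ε, (1 - ε) * (θ₂ - ε) - ε, R + ε))
      (𝓝[>] 0) (𝓝 (θ₁, θ₂, R)) := by
    have : Continuous fun ε : ℝ =>
      ((1 - ε) * (θ₁ - ε) - ε, (1 - ε) * (θ₂ - ε) - ε, R + ε) := by fun_prop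
    have := this.tendsto 0
    simp only [sub_zero, one_mul, add_zero] at this
    exact this.mono_left nhdsWithin_le_nhds
  refine (isClosed_triples P).mem_of_tendsto hlim ?_
  filter_upwards [Ioo_mem_nhdsGT (show (0 : ℝ) < 1 by norm_num)] with ε hε
  exact mem_triples_of_epsAchievable hP hZY hR hε.1 hε.2 (h ε hε)

end Region

/-! ### Second moments of sums of i.i.d. random variables. -/

section Product

variable {ι A : Type*} [Fintype ι] {μ : A → ℝ}

/-- The product pmf. -/
def piLaw (ι : Type*) [Fintype ι] {A : Type*} (μ : A → ℝ) (c : ι → A) : ℝ := ∏ i, μ (c i)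

theorem piLaw_nonneg (hμ : ∀ a, 0 ≤ μ a) (c : ι → A) : 0 ≤ piLaw ι μ c :=
  prod_nonneg fun _ _ => hμ _

variable [DecidableEq ι] [Fintype A]

theorem sum_piLaw_mul_prod (f : ι → A → ℝ) :
    ∑ c : ι → A, piLaw ι μ c * ∏ i, f i (c i) = ∏ i, ∑ a, μ a * f i a := by
  rw [← sum_pi_prod fun i a => μ a * f i a]
  simp only [piLaw, prod_mul_distrib]

theorem sum_piLaw (hμ : μ ∈ stdSimplex ℝ A) : ∑ c : ι → A, piLaw ι μ c = 1 := by
  have := sum_piLaw_mul_prod (μ := μ) (ι := ι) fun _ _ => 1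
  simpa [hμ.2] using this

theorem piLaw_mem (hμ : μ ∈ stdSimplex ℝ A) : piLaw ι μ ∈ stdSimplex ℝ (ι → A) :=
  ⟨piLaw_nonneg hμ.1, sum_piLaw hμ⟩

theorem sum_piLaw_mul_apply (hμ : μ ∈ stdSimplex ℝ A) (i : ι) (f : A → ℝ) :
    ∑ c : ι → A, piLaw ι μ c * f (c i) = ∑ a, μ a * f a := by
  have h := sum_piLaw_mul_prod (μ := μ) (ι := ι) fun j a => if j = i then f a else 1
  rw [prod_eq_single i (fun j _ hj => by simp [hj, hμ.2]) (by simp)] at h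
  simp only [if_true] at h
  rw [← h]
  refine sum_congr rfl fun c _ => ?_
  congr 1
  simp

theorem sum_piLaw_mul_apply_mul_apply (hμ : μ ∈ stdSimplex ℝ A) {i j : ι} (hij : i ≠ j)
    (f g : A → ℝ) : ∑ c : ι → A, piLaw ι μ c * (f (c i) * g (c j)) =
      (∑ a, μ a * f a) * ∑ a, μ a * g a := by
  have h := sum_piLaw_mul_prod (μ := μ) (ι := ι)
    fun k a => if k = i then f a else if k = j then g a else 1
  rw [prod_eq_mul i j hij (fun k _ hk => by simp [hk.1, hk.2, hμ.2]) (by simp) (by simp)] at h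
  simp only [if_true, hij.symm, if_false] at h
  rw [← h]
  refine sum_congr rfl fun c _ => ?_
  congr 1
  rw [prod_eq_mul i j hij (fun k _ hk => by simp [hk.1, hk.2]) (by simp) (by simp)]
  simp [hij.symm]

/-- The second moment of a centred sum of i.i.d. random variables. -/
theorem sum_piLaw_mul_sq_centred (hμ : μ ∈ stdSimplex ℝ A) {f : A → ℝ} (hf : ∑ a, μ a * f a = 0) :
    ∑ c : ι → A, piLaw ι μ c * (∑ i, f (c i)) ^ 2 = Fintype.card ι * ∑ a, μ a * f a ^ 2 := by
  have h1 : ∀ c : ι → A, piLaw ι μ c * (∑ i, f (c i)) ^ 2 =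
      ∑ i, ∑ j, piLaw ι μ c * (f (c i) * f (c j)) := fun c => by
    rw [sq, sum_mul_sum, mul_sum]
    exact sum_congr rfl fun i _ => mul_sum _ _ _
  rw [sum_congr rfl fun c _ => h1 c, sum_comm]
  have h2 : ∀ i : ι, ∑ c : ι → A, ∑ j, piLaw ι μ c * (f (c i) * f (c j)) =
      ∑ a, μ a * f a ^ 2 := fun i => by
    rw [sum_comm, Fintype.sum_eq_single i fun j hj => by
      rw [sum_piLaw_mul_apply_mul_apply hμ hj.symm, hf, zero_mul]]
    rw [← sum_piLaw_mul_apply hμ i fun a => f a ^ 2]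
    exact sum_congr rfl fun c _ => by rw [sq]
  rw [sum_congr rfl fun i _ => h2 i]
  simp

theorem sum_mul_sub_sq (hμ : μ ∈ stdSimplex ℝ A) (f : A → ℝ) :
    ∑ a, μ a * (f a - ∑ a, μ a * f a) ^ 2 = ∑ a, μ a * f a ^ 2 - (∑ a, μ a * f a) ^ 2 := by
  set m := ∑ a, μ a * f a with hm
  have : ∀ a, μ a * (f a - m) ^ 2 = μ a * f a ^ 2 - 2 * m * (μ a * f a) + m ^ 2 * μ a :=
    fun a => by ring
  rw [sum_congr rfl fun a _ => this a, sum_add_distrib, sum_sub_distrib, ← mul_sum, ← mul_sum, hμ.2,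
    ← hm]
  ring

theorem sum_piLaw_mul_sq_sub (hμ : μ ∈ stdSimplex ℝ A) (f : A → ℝ) :
    ∑ c : ι → A, piLaw ι μ c * (∑ i, f (c i) - Fintype.card ι * ∑ a, μ a * f a) ^ 2 =
      Fintype.card ι * (∑ a, μ a * f a ^ 2 - (∑ a, μ a * f a) ^ 2) := by
  rw [← sum_mul_sub_sq hμ f, ← sum_piLaw_mul_sq_centred hμ]
  · refine sum_congr rfl fun c _ => ?_
    rw [sum_sub_distrib]
    simp
  · simp only [mul_sub, sum_sub_distrib, ← sum_mul, hμ.2, one_mul, sub_self]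

theorem sum_piLaw_mul_sq_sub_le (hμ : μ ∈ stdSimplex ℝ A) (f : A → ℝ) :
    ∑ c : ι → A, piLaw ι μ c * (∑ i, f (c i) - Fintype.card ι * ∑ a, μ a * f a) ^ 2 ≤
      Fintype.card ι * ∑ a, μ a * f a ^ 2 := by
  rw [sum_piLaw_mul_sq_sub hμ]
  gcongr
  linarith [sq_nonneg (∑ a, μ a * f a)]

theorem sum_piLaw_mul_sq_le (hμ : μ ∈ stdSimplex ℝ A) (f : A → ℝ) :
    ∑ c : ι → A, piLaw ι μ c * (∑ i, f (c i)) ^ 2 ≤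
      Fintype.card ι * ∑ a, μ a * f a ^ 2 + (Fintype.card ι * ∑ a, μ a * f a) ^ 2 := by
  have h1 := sum_piLaw_mul_sq_sub_le (ι := ι) hμ f
  have h2 := sum_mul_sub_sq (piLaw_mem (ι := ι) hμ) fun c => ∑ i, f (c i)
  have h3 : ∑ c : ι → A, piLaw ι μ c * ∑ i, f (c i) = Fintype.card ι * ∑ a, μ a * f a := by
    simp only [mul_sum]
    rw [sum_comm, sum_congr rfl fun i _ => sum_piLaw_mul_apply hμ i f]
    simp [mul_sum]
  rw [h3] at h2
  linarith

theorem sum_mul_abs_le_sqrt (hμ : μ ∈ stdSimplex ℝ A) (f : A → ℝ) :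
    ∑ a, μ a * |f a| ≤ Real.sqrt (∑ a, μ a * f a ^ 2) := by
  refine Real.le_sqrt_of_sq_le ?_
  have h1 := sum_mul_sub_sq hμ fun a => |f a|
  have h2 : 0 ≤ ∑ a, μ a * (|f a| - ∑ a, μ a * |f a|) ^ 2 :=
    sum_nonneg fun a _ => mul_nonneg (hμ.1 a) (sq_nonneg _)
  simp only [sq_abs] at h1
  linarith

end Product

/-! ### Soft covering by superposition codebooks. -/

section Cloud

variable {U V K I : Type*} [Fintype U] [Fintype V] [Fintype K] [DecidableEq K]
  [Fintype I] [DecidableEq I] {a : U → ℝ} {b : U → V → ℝ}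

/-- The law of a cloud centre together with its satellites. -/
def cloudLaw (K : Type*) [Fintype K] (a : U → ℝ) (b : U → V → ℝ) (c : U × (K → V)) : ℝ :=
  a c.1 * piLaw K (b c.1) c.2

theorem cloudLaw_mem (ha : a ∈ stdSimplex ℝ U) (hb : ∀ u, b u ∈ stdSimplex ℝ V) :
    cloudLaw K a b ∈ stdSimplex ℝ (U × (K → V)) := by
  refine ⟨fun c => mul_nonneg (ha.1 _) (piLaw_nonneg (hb _).1 _), ?_⟩
  simp only [cloudLaw, Fintype.sum_prod_type, ← mul_sum, sum_piLaw (hb _), mul_one, ha.2]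

theorem sum_cloudLaw_mul (g : U → (K → V) → ℝ) :
    ∑ c, cloudLaw K a b c * g c.1 c.2 = ∑ u, a u * ∑ v, piLaw K (b u) v * g u v := by
  simp only [cloudLaw, Fintype.sum_prod_type, mul_assoc, ← mul_sum]

theorem sum_cloudLaw_mul_apply (hb : ∀ u, b u ∈ stdSimplex ℝ V) (k : K) (f : U → V → ℝ) :
    ∑ c, cloudLaw K a b c * f c.1 (c.2 k) = ∑ u, a u * ∑ v, b u v * f u v := by
  rw [sum_cloudLaw_mul fun u v => f u (v k)]
  exact sum_congr rfl fun u _ => by rw [sum_piLaw_mul_apply (hb u) k (f u)]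

theorem sum_cloudLaw_mul_sum (hb : ∀ u, b u ∈ stdSimplex ℝ V) (f : U → V → ℝ) :
    ∑ c, cloudLaw K a b c * ∑ k, f c.1 (c.2 k) =
      Fintype.card K * ∑ u, a u * ∑ v, b u v * f u v := by
  simp only [mul_sum (s := (univ : Finset K))]
  rw [sum_comm, sum_congr rfl fun k _ => sum_cloudLaw_mul_apply hb k f]
  simp

theorem sum_cloudLaw_mul_apply_mul_apply (hb : ∀ u, b u ∈ stdSimplex ℝ V) {k l : K} (hkl : k ≠ l)
    (f g : U → V → ℝ) : ∑ c, cloudLaw K a b c * (f c.1 (c.2 k) * g c.1 (c.2 l)) =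
      ∑ u, a u * ((∑ v, b u v * f u v) * ∑ v, b u v * g u v) := by
  rw [sum_cloudLaw_mul fun u v => f u (v k) * g u (v l)]
  exact sum_congr rfl fun u _ => by
    rw [sum_piLaw_mul_apply_mul_apply (hb u) hkl (f u) (g u)]

open Classical in
/-- Soft covering by a superposition codebook, at one point of the output alphabet. -/
theorem soft_covering [Nonempty I] [Nonempty K] (ha : a ∈ stdSimplex ℝ U)
    (hb : ∀ u, b u ∈ stdSimplex ℝ V)
    {w : U → V → ℝ} (hw : ∀ u v, 0 ≤ w u v) (good : U → V → Prop) {q G₀ G₁ : ℝ}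
    (hq : ∑ u, a u * ∑ v, b u v * w u v = q) (hG₀ : 0 ≤ G₀) (hG₁ : 0 ≤ G₁)
    (h1 : ∀ u v, good u v → w u v ≤ G₁ * q) (h0 : ∀ u v, good u v → ∑ v, b u v * w u v ≤ G₀ * q) :
    ∑ c : I → U × (K → V), piLaw I (cloudLaw K a b) c *
        |q - (∑ i, ∑ k, w (c i).1 ((c i).2 k)) / (Fintype.card I * Fintype.card K)| ≤
      q * Real.sqrt (G₁ / (Fintype.card I * Fintype.card K) + G₀ / Fintype.card I) +
        2 * ∑ u, a u * ∑ v, b u v * (if good u v then 0 else w u v) := by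
  -- The second-moment method needs bounded weights, so `w` is truncated to good pairs. The
  -- remainder `w''` is controlled in mean only, once in `q` and once in the codebook average,
  -- whence the factor 2.
  set w' : U → V → ℝ := fun u v => if good u v then w u v else 0 with hw'
  set w'' : U → V → ℝ := fun u v => if good u v then 0 else w u v with hw''
  have hsplit : ∀ u v, w u v = w' u v + w'' u v := fun u v => by
    simp only [hw', hw'']; split_ifs <;> simp
  have hw'n : ∀ u v, 0 ≤ w' u v := fun u v => by
    simp only [hw']; split_ifs; exacts [hw u v, le_rfl]
  have hw''n : ∀ u v, 0 ≤ w'' u v := fun u v => by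
    simp only [hw'']; split_ifs; exacts [le_rfl, hw u v]
  have hw'le : ∀ u v, w' u v ≤ w u v := fun u v => by linarith [hsplit u v, hw''n u v]
  set q' := ∑ u, a u * ∑ v, b u v * w' u v with hq'
  set q'' := ∑ u, a u * ∑ v, b u v * w'' u v with hq''
  have hqq : q = q' + q'' := by
    rw [← hq, hq', hq'', ← sum_add_distrib]
    refine sum_congr rfl fun u _ => ?_
    rw [← mul_add, ← sum_add_distrib]
    simp only [hsplit, mul_add]
  have hq''0 : 0 ≤ q'' := sum_nonneg fun u _ => mul_nonneg (ha.1 u)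
    (sum_nonneg fun v _ => mul_nonneg ((hb u).1 v) (hw''n u v))
  have hq'0 : 0 ≤ q' := sum_nonneg fun u _ => mul_nonneg (ha.1 u)
    (sum_nonneg fun v _ => mul_nonneg ((hb u).1 v) (hw'n u v))
  have hq0 : 0 ≤ q := by linarith
  have hν := cloudLaw_mem (K := K) ha hb
  have hνI := piLaw_mem (ι := I) hν
  set nI : ℝ := (Fintype.card I : ℝ) with hnI
  set nK : ℝ := (Fintype.card K : ℝ) with hnK
  have hI : 0 < nI := by rw [hnI]; exact_mod_cast Fintype.card_pos
  have hK : 0 < nK := by rw [hnK]; exact_mod_cast Fintype.card_pos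
  set F' : U × (K → V) → ℝ := fun c => ∑ k, w' c.1 (c.2 k) with hF'
  set F'' : U × (K → V) → ℝ := fun c => ∑ k, w'' c.1 (c.2 k) with hF''
  have hEF' : ∑ c, cloudLaw K a b c * F' c = nK * q' := sum_cloudLaw_mul_sum hb w'
  have hEF'' : ∑ c, cloudLaw K a b c * F'' c = nK * q'' := sum_cloudLaw_mul_sum hb w''
  -- Satellites are independent given their centre: the second moments of single satellites give the
  -- term in `G₁`, the squared conditional mean the term in `G₀`.
  have hmom : ∑ c, cloudLaw K a b c * F' c ^ 2 ≤ nK * (G₁ * q ^ 2) + nK ^ 2 * (G₀ * q ^ 2) := by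
    rw [sum_cloudLaw_mul fun u v => (∑ k, w' u (v k)) ^ 2]
    have hu : ∀ u, ∑ v, piLaw K (b u) v * (∑ k, w' u (v k)) ^ 2 ≤
        nK * (G₁ * q * ∑ v, b u v * w' u v) + nK ^ 2 * (G₀ * q * ∑ v, b u v * w' u v) := by
      intro u
      refine (sum_piLaw_mul_sq_le (hb u) (w' u)).trans (add_le_add ?_ ?_)
      · refine mul_le_mul_of_nonneg_left ?_ hK.le
        rw [mul_sum]
        refine sum_le_sum fun v _ => ?_
        have : w' u v ≤ G₁ * q := by
          simp only [hw']
          split_ifs with h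
          · exact h1 u v h
          · positivity
        nlinarith [mul_nonneg (mul_nonneg ((hb u).1 v) (hw'n u v)) (sub_nonneg.2 this)]
      · rw [mul_pow]
        refine mul_le_mul_of_nonneg_left ?_ (by positivity)
        rw [sq]
        refine mul_le_mul_of_nonneg_right ?_ (sum_nonneg fun v _ =>
          mul_nonneg ((hb u).1 v) (hw'n u v))
        -- `h0` bounds the conditional mean at `u` only if some `v` is good; otherwise the truncated
        -- weight vanishes at `u`.
        by_cases h : ∃ v, good u v
        · obtain ⟨v, hv⟩ := h
          exact (sum_le_sum fun v _ => mul_le_mul_of_nonneg_left (hw'le u v) ((hb u).1 v)).trans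
            (h0 u v hv)
        · simp only [not_exists] at h
          simp only [hw', h, if_false, mul_zero, sum_const_zero]
          positivity
    calc _ ≤ ∑ u, a u * (nK * (G₁ * q * ∑ v, b u v * w' u v) +
            nK ^ 2 * (G₀ * q * ∑ v, b u v * w' u v)) :=
          sum_le_sum fun u _ => mul_le_mul_of_nonneg_left (hu u) (ha.1 u)
      _ = nK * (G₁ * q * q') + nK ^ 2 * (G₀ * q * q') := by
          rw [hq', mul_sum, mul_sum, mul_sum, mul_sum, ← sum_add_distrib]
          exact sum_congr rfl fun u _ => by ring
      _ ≤ nK * (G₁ * q * q) + nK ^ 2 * (G₀ * q * q) := by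
          have : q' ≤ q := by linarith
          gcongr
      _ = _ := by ring
  have habs : ∀ c : I → U × (K → V),
      |q - (∑ i, ∑ k, w (c i).1 ((c i).2 k)) / (nI * nK)| ≤
        |(∑ i, F' (c i) - nI * (nK * q')) / (nI * nK)| + (q'' + (∑ i, F'' (c i)) / (nI * nK)) := by
    intro c
    have e : q - (∑ i, ∑ k, w (c i).1 ((c i).2 k)) / (nI * nK) =
        -((∑ i, F' (c i) - nI * (nK * q')) / (nI * nK)) +
          (q'' - (∑ i, F'' (c i)) / (nI * nK)) := by
      simp only [hF', hF'', hsplit, sum_add_distrib]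
      rw [hqq]
      field_simp
      ring
    have hpos : 0 ≤ (∑ i, F'' (c i)) / (nI * nK) :=
      div_nonneg (sum_nonneg fun i _ => sum_nonneg fun k _ => hw''n _ _) (by positivity)
    rw [e]
    refine (abs_add_le _ _).trans (add_le_add (abs_neg _).le ?_)
    rw [abs_le]
    constructor <;> linarith
  calc _ ≤ ∑ c : I → U × (K → V), piLaw I (cloudLaw K a b) c *
        (|(∑ i, F' (c i) - nI * (nK * q')) / (nI * nK)| +
          (q'' + (∑ i, F'' (c i)) / (nI * nK))) :=
        sum_le_sum fun c _ => mul_le_mul_of_nonneg_left (habs c) (hνI.1 c)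
    _ = ∑ c : I → U × (K → V), piLaw I (cloudLaw K a b) c *
        |(∑ i, F' (c i) - nI * (nK * q')) / (nI * nK)| + 2 * q'' := by
        simp only [mul_add, sum_add_distrib, ← sum_mul, hνI.2, one_mul]
        have : ∑ c : I → U × (K → V), piLaw I (cloudLaw K a b) c *
            ((∑ i, F'' (c i)) / (nI * nK)) = q'' := by
          simp only [← mul_div_assoc, ← sum_div, mul_sum]
          rw [sum_comm, sum_congr rfl fun i _ => sum_piLaw_mul_apply hν i F'', hEF'']
          simp only [sum_const, card_univ, nsmul_eq_mul]
          rw [← hnI]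
          field_simp
        rw [this]
        ring
    _ ≤ q * Real.sqrt (G₁ / (nI * nK) + G₀ / nI) + 2 * q'' := by
        gcongr
        refine (sum_mul_abs_le_sqrt hνI _).trans ?_
        rw [← Real.sqrt_sq hq0, ← Real.sqrt_mul (sq_nonneg q)]
        refine Real.sqrt_le_sqrt ?_
        simp only [div_pow, ← mul_div_assoc, ← sum_div]
        rw [div_le_iff₀ (by positivity)]
        have := sum_piLaw_mul_sq_sub_le (ι := I) hν F'
        rw [hEF', ← hnI] at this
        refine this.trans ((mul_le_mul_of_nonneg_left hmom hI.le).trans (le_of_eq ?_))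
        field_simp

end Cloud

/-! ### One-shot coding: likelihood encoder, superposition and binning. -/

section OneShot

theorem exists_le_of_sum_mul_le {A : Type*} [Fintype A] {μ : A → ℝ} (hμ : μ ∈ stdSimplex ℝ A)
    {f : A → ℝ} {B : ℝ} (h : ∑ a, μ a * f a ≤ B) : ∃ a, f a ≤ B := by
  by_contra! hn
  obtain ⟨a, ha⟩ : ∃ a, 0 < μ a := by
    by_contra! h0
    have : ∑ a, μ a = 0 := sum_eq_zero fun a _ => le_antisymm (h0 a) (hμ.1 a)
    rw [hμ.2] at this
    exact one_ne_zero this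
  have : ∑ a, μ a * B < ∑ a, μ a * f a :=
    sum_lt_sum (fun a _ => mul_le_mul_of_nonneg_left (hn a).le (hμ.1 a))
      ⟨a, mem_univ a, mul_lt_mul_of_pos_left (hn a) ha⟩
  rw [← sum_mul, hμ.2, one_mul] at this
  linarith

variable {U V : Type*} [Fintype U] [Fintype V] {a : U → ℝ} {b : U → V → ℝ}

theorem sum_codebook_mul {I K : Type*} [Fintype I] [DecidableEq I] [Nonempty I] [Fintype K]
    [DecidableEq K] [Nonempty K] (ha : a ∈ stdSimplex ℝ U) (hb : ∀ u, b u ∈ stdSimplex ℝ V)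
    (f : U → V → ℝ) :
    ∑ c : I → U × (K → V), piLaw I (cloudLaw K a b) c *
        ((∑ i, ∑ k, f (c i).1 ((c i).2 k)) / (Fintype.card I * Fintype.card K)) =
      ∑ u, a u * ∑ v, b u v * f u v := by
  have hν := cloudLaw_mem (K := K) ha hb
  have hI : (Fintype.card I : ℝ) ≠ 0 := by exact_mod_cast Fintype.card_ne_zero
  have hK : (Fintype.card K : ℝ) ≠ 0 := by exact_mod_cast Fintype.card_ne_zero
  simp only [← mul_div_assoc, ← sum_div, mul_sum]
  rw [sum_comm]
  simp only [← mul_sum]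
  rw [sum_congr rfl fun i _ => sum_piLaw_mul_apply hν i fun c => ∑ k, f c.1 (c.2 k),
    sum_cloudLaw_mul_sum hb f]
  simp only [sum_const, card_univ, nsmul_eq_mul]
  field_simp

/-- Distinct satellites in one bin are independent given their centre, and each has `L` competitors.
This is the union bound over wrong indices within the bin. -/
theorem sum_codebook_mul_pairs {I : Type*} [Fintype I] [DecidableEq I] [Nonempty I] {N L : ℕ}
    (hN : 0 < N) (ha : a ∈ stdSimplex ℝ U) (hb : ∀ u, b u ∈ stdSimplex ℝ V) (f g : U → V → ℝ) :
    ∑ c : I → U × (Fin N × Fin (L + 1) → V), piLaw I (cloudLaw _ a b) c *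
        ((∑ i, ∑ k : Fin N × Fin (L + 1), ∑ l ∈ univ.erase k.2,
          f (c i).1 ((c i).2 k) * g (c i).1 ((c i).2 (k.1, l))) /
            (Fintype.card I * Fintype.card (Fin N × Fin (L + 1)))) =
      L * ∑ u, a u * ((∑ v, b u v * f u v) * ∑ v, b u v * g u v) := by
  have hν := cloudLaw_mem (K := Fin N × Fin (L + 1)) ha hb
  have hI : (Fintype.card I : ℝ) ≠ 0 := by exact_mod_cast Fintype.card_ne_zero
  have hN' : (N : ℝ) ≠ 0 := by exact_mod_cast hN.ne'
  have hL : (L : ℝ) + 1 ≠ 0 := by positivity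
  simp only [← mul_div_assoc, ← sum_div, mul_sum (s := (univ : Finset I))]
  rw [sum_comm]
  rw [sum_congr rfl fun i _ => sum_piLaw_mul_apply hν i fun c =>
    ∑ k : Fin N × Fin (L + 1), ∑ l ∈ univ.erase k.2, f c.1 (c.2 k) * g c.1 (c.2 (k.1, l))]
  have h : ∀ k : Fin N × Fin (L + 1), ∑ c, cloudLaw (Fin N × Fin (L + 1)) a b c *
      ∑ l ∈ univ.erase k.2, f c.1 (c.2 k) * g c.1 (c.2 (k.1, l)) =
        L * ∑ u, a u * ((∑ v, b u v * f u v) * ∑ v, b u v * g u v) := by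
    intro k
    simp only [mul_sum (s := univ.erase k.2)]
    rw [sum_comm, sum_congr rfl fun l hl => sum_cloudLaw_mul_apply_mul_apply hb
      (k := k) (l := (k.1, l)) (fun h => (mem_erase.1 hl).1 (congrArg Prod.snd h).symm) f g]
    simp [card_erase_of_mem]
  simp only [mul_sum (s := (univ : Finset (Fin N × Fin (L + 1))))]
  simp only [sum_comm (s := (univ : Finset (U × (Fin N × Fin (L + 1) → V)))), h]
  simp only [sum_const, card_univ, nsmul_eq_mul, Fintype.card_prod, Fintype.card_fin]
  push_cast
  field_simp

open Classical in
/-- One-shot achievability with a likelihood encoder, superposition coding and binning. -/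
theorem exists_oneShot_code {X S Z : Type*} [Fintype X] [Fintype S] (ha : a ∈ stdSimplex ℝ U)
    (hb : ∀ u, b u ∈ stdSimplex ℝ V) {W : U → V → X → ℝ} (hW : ∀ u v x, 0 ≤ W u v x) {q : X → ℝ}
    (hq : ∀ x, ∑ u, a u * ∑ v, b u v * W u v x = q x) (hq1 : ∑ x, q x = 1) (ξ : S → X) (ζ : S → Z)
    {T : S → ℝ} (hT : ∀ s, 0 ≤ T s) (hT1 : ∀ x, law T ξ x ≤ 1)
    (good : U → V → X → Prop) (G : U → V → Z → Prop) (T₁ : U × V → S → Prop) (T₂ : U → S → Prop)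
    {G₀ G₁ : ℝ} (hG₀ : 0 ≤ G₀) (hG₁ : 0 ≤ G₁)
    (h1 : ∀ u v x, good u v x → W u v x ≤ G₁ * q x)
    (h0 : ∀ u v x, good u v x → ∑ v, b u v * W u v x ≤ G₀ * q x)
    {N₀ N₁ : ℕ} (hN₀ : 0 < N₀) (hN₁ : 0 < N₁) (L : ℕ) :
    ∃ enc : X → Fin N₀ × Fin N₁ → ℝ, (∀ x, enc x ∈ stdSimplex ℝ (Fin N₀ × Fin N₁)) ∧
    ∃ (φ₁ : Fin N₀ × Fin N₁ → Z → U × V) (φ₂ : Fin N₀ × Fin N₁ → U),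
      ∑ s, q (ξ s) * T s * ∑ m, enc (ξ s) m * (if T₁ (φ₁ m (ζ s)) s then 0 else 1) +
      ∑ s, q (ξ s) * T s * ∑ m, enc (ξ s) m * (if T₂ (φ₂ m) s then 0 else 1) ≤
        2 * (Real.sqrt (G₁ / (N₀ * (N₁ * (L + 1))) + G₀ / N₀) +
          2 * ∑ x, ∑ u, a u * ∑ v, b u v * (if good u v x then 0 else W u v x)) +
        ∑ s, T s * ∑ u, a u * ∑ v, b u v * (W u v (ξ s) * ((if T₁ (u, v) s then 0 else 1) +
          (if G u v (ζ s) then 0 else 1) + (if T₂ u s then 0 else 1))) +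
        L * ∑ s, T s * ∑ u, a u * ((∑ v, b u v * W u v (ξ s)) *
          ∑ v, b u v * (if G u v (ζ s) then 1 else 0)) := by
  have : Nonempty (Fin N₀) := ⟨⟨0, hN₀⟩⟩
  have : Nonempty (Fin N₁) := ⟨⟨0, hN₁⟩⟩
  set D : ℝ := Fintype.card (Fin N₀) * Fintype.card (Fin N₁ × Fin (L + 1)) with hD
  have hDe : D = N₀ * (N₁ * (L + 1)) := by simp [hD]
  have hDpos : 0 < D := by
    rw [hDe]
    have h1 : (0 : ℝ) < N₀ := by exact_mod_cast hN₀
    have h2 : (0 : ℝ) < N₁ := by exact_mod_cast hN₁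
    positivity
  have hν := cloudLaw_mem (K := Fin N₁ × Fin (L + 1)) ha hb
  have hνI := piLaw_mem (ι := Fin N₀) hν
  -- `Qc` is the output law of the codebook for a uniform codeword; `wm` is the share of message
  -- `m`, summed over the index inside its bin.
  let Qc : (Fin N₀ → U × (Fin N₁ × Fin (L + 1) → V)) → X → ℝ := fun c x =>
    (∑ i, ∑ k, W (c i).1 ((c i).2 k) x) / D
  let wm : (Fin N₀ → U × (Fin N₁ × Fin (L + 1) → V)) → X → Fin N₀ × Fin N₁ → ℝ := fun c x m =>
    (∑ l, W (c m.1).1 ((c m.1).2 (m.2, l)) x) / D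
  have hwm0 : ∀ c x m, 0 ≤ wm c x m := fun c x m =>
    div_nonneg (sum_nonneg fun l _ => hW _ _ _) hDpos.le
  have hwmQ : ∀ c x, ∑ m, wm c x m = Qc c x := fun c x => by
    simp only [wm, Qc, ← sum_div, Fintype.sum_prod_type]
  let m₀ : Fin N₀ × Fin N₁ := (⟨0, hN₀⟩, ⟨0, hN₁⟩)
  -- The likelihood encoder is the posterior of the message given `x`. On an `x` to which the
  -- codebook gives no mass a fixed message is sent.
  let enc : (Fin N₀ → U × (Fin N₁ × Fin (L + 1) → V)) → X → Fin N₀ × Fin N₁ → ℝ := fun c x m =>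
    if Qc c x = 0 then (if m = m₀ then 1 else 0) else wm c x m / Qc c x
  have henc : ∀ c x, enc c x ∈ stdSimplex ℝ (Fin N₀ × Fin N₁) := by
    intro c x
    by_cases h : Qc c x = 0
    · refine ⟨fun m => ?_, ?_⟩
      · simp only [enc, h, if_true]; split_ifs <;> norm_num
      · simp [enc, h]
    · refine ⟨fun m => ?_, ?_⟩
      · simp only [enc, h, if_false]
        exact div_nonneg (hwm0 _ _ _) (hwmQ c x ▸ sum_nonneg fun m _ => hwm0 c x m)
      · simp only [enc, h, if_false, ← sum_div, hwmQ, div_self h]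
  -- Change of measure: at the cost of the covering error, message and input behave as if a uniform
  -- codeword had been sent through `W`.
  have hkey : ∀ c x m, q x * enc c x m ≤ |q x - Qc c x| * enc c x m + wm c x m := by
    intro c x m
    by_cases h : Qc c x = 0
    · rw [h, sub_zero]
      have := mul_le_mul_of_nonneg_right (le_abs_self (q x)) ((henc c x).1 m)
      linarith [hwm0 c x m]
    · have e : wm c x m = Qc c x * enc c x m := by
        simp only [enc, h, if_false]; rw [mul_div_cancel₀ _ h]
      have := mul_le_mul_of_nonneg_right (le_abs_self (q x - Qc c x)) ((henc c x).1 m)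
      rw [e]; linarith
  let dl : (Fin N₀ → U × (Fin N₁ × Fin (L + 1) → V)) → Fin N₀ × Fin N₁ → Z → Fin (L + 1) :=
      fun c m z =>
    if h : ∃ l, G (c m.1).1 ((c m.1).2 (m.2, l)) z then h.choose else 0
  let φ₁ : (Fin N₀ → U × (Fin N₁ × Fin (L + 1) → V)) → Fin N₀ × Fin N₁ → Z → U × V := fun c m z =>
    ((c m.1).1, (c m.1).2 (m.2, dl c m z))
  let φ₂ : (Fin N₀ → U × (Fin N₁ × Fin (L + 1) → V)) → Fin N₀ × Fin N₁ → U := fun c m => (c m.1).1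
  -- If receiver 1 rejects, then the true satellite `l` fails the test, or it does not fit the side
  -- information, or another satellite of the bin does.
  have hdl : ∀ c m s l, (if T₁ (φ₁ c m (ζ s)) s then (0 : ℝ) else 1) ≤
      (if T₁ ((c m.1).1, (c m.1).2 (m.2, l)) s then 0 else 1) +
      (if G (c m.1).1 ((c m.1).2 (m.2, l)) (ζ s) then 0 else 1) +
      ∑ l' ∈ univ.erase l, if G (c m.1).1 ((c m.1).2 (m.2, l')) (ζ s) then (1 : ℝ) else 0 := by
    intro c m s l
    have hsum : (0 : ℝ) ≤ ∑ l' ∈ univ.erase l,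
        if G (c m.1).1 ((c m.1).2 (m.2, l')) (ζ s) then (1 : ℝ) else 0 :=
      sum_nonneg fun l' _ => by split_ifs <;> norm_num
    by_cases hl : dl c m (ζ s) = l
    · have : φ₁ c m (ζ s) = ((c m.1).1, (c m.1).2 (m.2, l)) := by simp only [φ₁, hl]
      rw [this]
      have : (0 : ℝ) ≤ if G (c m.1).1 ((c m.1).2 (m.2, l)) (ζ s) then 0 else 1 := by
        split_ifs <;> norm_num
      linarith
    · have hle : (if T₁ (φ₁ c m (ζ s)) s then (0 : ℝ) else 1) ≤ 1 := by split_ifs <;> norm_num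
      have hn : (0 : ℝ) ≤ if T₁ ((c m.1).1, (c m.1).2 (m.2, l)) s then 0 else 1 := by
        split_ifs <;> norm_num
      by_cases hg : G (c m.1).1 ((c m.1).2 (m.2, l)) (ζ s)
      · have hex : ∃ l, G (c m.1).1 ((c m.1).2 (m.2, l)) (ζ s) := ⟨l, hg⟩
        have hd : G (c m.1).1 ((c m.1).2 (m.2, dl c m (ζ s))) (ζ s) := by
          simp only [dl, dif_pos hex]; exact hex.choose_spec
        have h1 : (1 : ℝ) ≤ ∑ l' ∈ univ.erase l,
            if G (c m.1).1 ((c m.1).2 (m.2, l')) (ζ s) then (1 : ℝ) else 0 := by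
          refine le_trans (by rw [if_pos hd]) (single_le_sum
            (f := fun l' => if G (c m.1).1 ((c m.1).2 (m.2, l')) (ζ s) then (1 : ℝ) else 0)
            (fun l' _ => by split_ifs <;> norm_num) (mem_erase.2 ⟨hl, mem_univ _⟩))
        rw [if_pos hg]
        linarith
      · rw [if_neg hg]
        linarith
  have herr : ∀ c (e : Fin N₀ × Fin N₁ → S → ℝ), (∀ m s, 0 ≤ e m s) → (∀ m s, e m s ≤ 1) →
      ∑ s, q (ξ s) * T s * ∑ m, enc c (ξ s) m * e m s ≤
        ∑ x, |q x - Qc c x| + ∑ s, T s * ∑ m, wm c (ξ s) m * e m s := by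
    intro c e he0 he1
    have h2 : ∑ s, T s * |q (ξ s) - Qc c (ξ s)| ≤ ∑ x, |q x - Qc c x| := by
      rw [← sum_law_mul T ξ fun x => |q x - Qc c x|]
      exact sum_le_sum fun x _ => mul_le_of_le_one_left (abs_nonneg _) (hT1 x)
    refine le_trans ?_ (add_le_add_left h2 _)
    rw [← sum_add_distrib]
    refine sum_le_sum fun s _ => ?_
    rw [mul_comm (q _), mul_assoc, ← mul_add]
    refine mul_le_mul_of_nonneg_left ?_ (hT s)
    calc q (ξ s) * ∑ m, enc c (ξ s) m * e m s = ∑ m, q (ξ s) * enc c (ξ s) m * e m s := by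
          rw [mul_sum]; exact sum_congr rfl fun m _ => by ring
      _ ≤ ∑ m, (|q (ξ s) - Qc c (ξ s)| * enc c (ξ s) m + wm c (ξ s) m * e m s) := by
          refine sum_le_sum fun m _ => ?_
          have k1 := mul_le_mul_of_nonneg_right (hkey c (ξ s) m) (he0 m s)
          have k2 : |q (ξ s) - Qc c (ξ s)| * enc c (ξ s) m * e m s ≤
              |q (ξ s) - Qc c (ξ s)| * enc c (ξ s) m :=
            mul_le_of_le_one_right (mul_nonneg (abs_nonneg _) ((henc c _).1 m)) (he1 m s)
          linarith
      _ = _ := by rw [sum_add_distrib, ← mul_sum, (henc c _).2, mul_one]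
  let f : S → U → V → ℝ := fun s u v => W u v (ξ s) * ((if T₁ (u, v) s then 0 else 1) +
    (if G u v (ζ s) then 0 else 1) + (if T₂ u s then 0 else 1))
  let g : S → U → V → ℝ := fun s u v => if G u v (ζ s) then 1 else 0
  let h : S → U → V → ℝ := fun s u v => W u v (ξ s)
  have htot : ∀ c, ∑ s, q (ξ s) * T s * ∑ m, enc c (ξ s) m *
        (if T₁ (φ₁ c m (ζ s)) s then 0 else 1) +
      ∑ s, q (ξ s) * T s * ∑ m, enc c (ξ s) m * (if T₂ (φ₂ c m) s then 0 else 1) ≤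
      2 * ∑ x, |q x - Qc c x| + (∑ s, T s * ((∑ i, ∑ k, f s (c i).1 ((c i).2 k)) / D) +
        ∑ s, T s * ((∑ i, ∑ k : Fin N₁ × Fin (L + 1), ∑ l ∈ univ.erase k.2,
          h s (c i).1 ((c i).2 k) * g s (c i).1 ((c i).2 (k.1, l))) / D)) := by
    intro c
    have k1 := herr c (fun m s => if T₁ (φ₁ c m (ζ s)) s then 0 else 1)
      (fun m s => by split_ifs <;> norm_num) (fun m s => by split_ifs <;> norm_num)
    have k2 := herr c (fun m s => if T₂ (φ₂ c m) s then 0 else 1)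
      (fun m s => by split_ifs <;> norm_num) (fun m s => by split_ifs <;> norm_num)
    refine (add_le_add k1 k2).trans ?_
    have k3 : ∑ s, T s * ∑ m, wm c (ξ s) m * (if T₁ (φ₁ c m (ζ s)) s then 0 else 1) +
        ∑ s, T s * ∑ m, wm c (ξ s) m * (if T₂ (φ₂ c m) s then 0 else 1) ≤
        ∑ s, T s * ((∑ i, ∑ k, f s (c i).1 ((c i).2 k)) / D) +
        ∑ s, T s * ((∑ i, ∑ k : Fin N₁ × Fin (L + 1), ∑ l ∈ univ.erase k.2,
          h s (c i).1 ((c i).2 k) * g s (c i).1 ((c i).2 (k.1, l))) / D) := by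
      rw [← sum_add_distrib, ← sum_add_distrib]
      refine sum_le_sum fun s _ => ?_
      rw [← mul_add, ← mul_add]
      refine mul_le_mul_of_nonneg_left ?_ (hT s)
      rw [← sum_add_distrib, ← add_div, ← sum_add_distrib, Fintype.sum_prod_type, sum_div]
      refine sum_le_sum fun i _ => ?_
      rw [← sum_add_distrib, Fintype.sum_prod_type, sum_div]
      refine sum_le_sum fun j _ => ?_
      rw [← mul_add]
      simp only [wm]
      rw [div_mul_eq_mul_div, sum_mul]
      refine div_le_div_of_nonneg_right (sum_le_sum fun l _ => ?_) hDpos.le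
      have k4 := mul_le_mul_of_nonneg_left (hdl c (i, j) s l) (hW (c i).1 ((c i).2 (j, l)) (ξ s))
      simp only [f, g, h, ← mul_sum]
      simp only [φ₂]
      linarith
    linarith
  have hcov : ∑ c : Fin N₀ → U × (Fin N₁ × Fin (L + 1) → V),
      piLaw (Fin N₀) (cloudLaw _ a b) c * ∑ x, |q x - Qc c x| ≤
      Real.sqrt (G₁ / (N₀ * (N₁ * (L + 1))) + G₀ / N₀) +
        2 * ∑ x, ∑ u, a u * ∑ v, b u v * (if good u v x then 0 else W u v x) := by
    simp only [mul_sum (s := (univ : Finset X))]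
    rw [sum_comm]
    calc _ ≤ ∑ x, (q x * Real.sqrt (G₁ / (N₀ * (N₁ * (L + 1))) + G₀ / N₀) +
          2 * ∑ u, a u * ∑ v, b u v * (if good u v x then 0 else W u v x)) := by
          refine sum_le_sum fun x _ => ?_
          have := soft_covering (I := Fin N₀) (K := Fin N₁ × Fin (L + 1)) ha hb
            (fun u v => hW u v x)
            (fun u v => good u v x) (hq x) hG₀ hG₁ (fun u v => h1 u v x) fun u v => h0 u v x
          rw [← hD, hDe, Fintype.card_fin] at this
          simpa only [Qc, hDe] using this
      _ = _ := by rw [sum_add_distrib, ← sum_mul, hq1, one_mul]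
  have hswap : ∀ F : S → (Fin N₀ → U × (Fin N₁ × Fin (L + 1) → V)) → ℝ,
      ∑ c : Fin N₀ → U × (Fin N₁ × Fin (L + 1) → V),
        piLaw (Fin N₀) (cloudLaw _ a b) c * ∑ s, T s * F s c =
        ∑ s, T s * ∑ c : Fin N₀ → U × (Fin N₁ × Fin (L + 1) → V),
          piLaw (Fin N₀) (cloudLaw _ a b) c * F s c := fun F => by
    simp only [mul_sum]
    rw [sum_comm]
    exact sum_congr rfl fun s _ => sum_congr rfl fun c _ => by ring
  have hE1 : ∑ c : Fin N₀ → U × (Fin N₁ × Fin (L + 1) → V), piLaw (Fin N₀) (cloudLaw _ a b) c *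
      ∑ s, T s * ((∑ i, ∑ k, f s (c i).1 ((c i).2 k)) / D) =
        ∑ s, T s * ∑ u, a u * ∑ v, b u v * f s u v := by
    rw [hswap fun s c => (∑ i, ∑ k, f s (c i).1 ((c i).2 k)) / D]
    exact sum_congr rfl fun s _ => by rw [hD, sum_codebook_mul ha hb (f s)]
  have hE2 : ∑ c : Fin N₀ → U × (Fin N₁ × Fin (L + 1) → V), piLaw (Fin N₀) (cloudLaw _ a b) c *
      ∑ s, T s * ((∑ i, ∑ k : Fin N₁ × Fin (L + 1), ∑ l ∈ univ.erase k.2,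
          h s (c i).1 ((c i).2 k) * g s (c i).1 ((c i).2 (k.1, l))) / D) =
        L * ∑ s, T s * ∑ u, a u * ((∑ v, b u v * h s u v) * ∑ v, b u v * g s u v) := by
    rw [hswap fun s c => (∑ i, ∑ k : Fin N₁ × Fin (L + 1), ∑ l ∈ univ.erase k.2,
          h s (c i).1 ((c i).2 k) * g s (c i).1 ((c i).2 (k.1, l))) / D, mul_sum]
    refine sum_congr rfl fun s _ => ?_
    rw [hD, sum_codebook_mul_pairs hN₁ ha hb (h s) (g s)]
    ring
  -- Adding the errors of both receivers lets one codebook be chosen that is good for both.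
  obtain ⟨c, hc⟩ := exists_le_of_sum_mul_le hνI
    (f := fun c => 2 * ∑ x, |q x - Qc c x| +
      (∑ s, T s * ((∑ i, ∑ k, f s (c i).1 ((c i).2 k)) / D) +
        ∑ s, T s * ((∑ i, ∑ k : Fin N₁ × Fin (L + 1), ∑ l ∈ univ.erase k.2,
          h s (c i).1 ((c i).2 k) * g s (c i).1 ((c i).2 (k.1, l))) / D)))
    (B := 2 * (Real.sqrt (G₁ / (N₀ * (N₁ * (L + 1))) + G₀ / N₀) +
          2 * ∑ x, ∑ u, a u * ∑ v, b u v * (if good u v x then 0 else W u v x)) +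
        (∑ s, T s * ∑ u, a u * ∑ v, b u v * f s u v +
        L * ∑ s, T s * ∑ u, a u * ((∑ v, b u v * h s u v) * ∑ v, b u v * g s u v))) (by
      simp only [mul_add (piLaw _ _ _), sum_add_distrib, hE1, hE2]
      refine add_le_add ?_ le_rfl
      simp only [mul_left_comm (piLaw _ _ _) (2 : ℝ), ← mul_sum (a := (2 : ℝ))]
      linarith)
  refine ⟨enc c, henc c, φ₁ c, φ₂ c, (htot c).trans (hc.trans (le_of_eq ?_))⟩
  simp only [f, g, h]
  ring

end OneShot

/-! ### Conditional probabilities and likelihood-ratio estimates. -/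

section CondProb

open Filter Topology

variable {Ω α β : Type*} [Fintype Ω]

/-- The conditional probability `Pr[A = a | B = b]`, zero if `Pr[B = b] = 0`. -/
def cProb (p : Ω → ℝ) (A : Ω → α) (B : Ω → β) (a : α) (b : β) : ℝ :=
  law p (fun ω => (A ω, B ω)) (a, b) / law p B b

theorem cProb_nonneg {p : Ω → ℝ} (hp : ∀ ω, 0 ≤ p ω) (A : Ω → α) (B : Ω → β) (a : α) (b : β) :
    0 ≤ cProb p A B a b :=
  div_nonneg (law_nonneg hp _ _) (law_nonneg hp _ _)

theorem cProb_pos {p : Ω → ℝ} (hp : ∀ ω, 0 ≤ p ω) (A : Ω → α) (B : Ω → β) {ω : Ω} (h : 0 < p ω) :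
    0 < cProb p A B (A ω) (B ω) :=
  div_pos (law_pos hp (fun ω => (A ω, B ω)) h) (law_pos hp B h)

theorem law_pair_le {p : Ω → ℝ} (hp : ∀ ω, 0 ≤ p ω) (A : Ω → α) (B : Ω → β) (a : α) (b : β) :
    law p (fun ω => (A ω, B ω)) (a, b) ≤ law p B b :=
  law_le_of_imp hp _ _ _ _ fun _ h => (Prod.ext_iff.1 h).2

theorem cProb_mul_law {p : Ω → ℝ} (hp : ∀ ω, 0 ≤ p ω) (A : Ω → α) (B : Ω → β) (a : α) (b : β) :
    cProb p A B a b * law p B b = law p (fun ω => (A ω, B ω)) (a, b) := by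
  by_cases h : law p B b = 0
  · have := law_pair_le hp A B a b
    rw [h] at this
    rw [h, mul_zero, le_antisymm this (law_nonneg hp _ _)]
  · exact div_mul_cancel₀ _ h

theorem sum_cProb [Fintype α] (p : Ω → ℝ) (A : Ω → α) (B : Ω → β) {b : β} (h : law p B b ≠ 0) :
    ∑ a, cProb p A B a b = 1 := by
  simp only [cProb, ← sum_div]
  rw [sum_law_pair' p B A b, div_self h]

theorem sum_cProb_le_one [Fintype α] (p : Ω → ℝ) (A : Ω → α) (B : Ω → β) (b : β) :
    ∑ a, cProb p A B a b ≤ 1 := by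
  by_cases h : law p B b = 0
  · simp [cProb, h]
  · exact (sum_cProb p A B h).le

theorem sum_mul_logb_cProb [Fintype α] [Fintype β] {p : Ω → ℝ} (hp : ∀ ω, 0 ≤ p ω) (A : Ω → α)
    (B : Ω → β) : ∑ ω, p ω * Real.logb 2 (cProb p A B (A ω) (B ω)) = -cEnt p A B := by
  rw [cEnt, entropy_eq_sum, entropy_eq_sum, ← sub_eq_zero]
  have : ∀ ω, p ω * Real.logb 2 (cProb p A B (A ω) (B ω)) =
      p ω * Real.logb 2 (law p (fun ω => (A ω, B ω)) (A ω, B ω)) -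
        p ω * Real.logb 2 (law p B (B ω)) := by
    intro ω
    rcases (hp ω).eq_or_lt with h | h
    · simp [← h]
    · rw [cProb, Real.logb_div (law_pos hp (fun ω => (A ω, B ω)) h).ne' (law_pos hp B h).ne',
        mul_sub]
  rw [sum_congr rfl fun ω _ => this ω, sum_sub_distrib]
  ring

theorem sum_mul_logb_law [Fintype α] (p : Ω → ℝ) (A : Ω → α) :
    ∑ ω, p ω * Real.logb 2 (law p A (A ω)) = -entropy p A := by
  rw [entropy_eq_sum, neg_neg]

/-- The weak law of large numbers for likelihood ratios. -/
theorem tendsto_sum_piLaw_mul_ite {A : Type*} [Fintype A] {μ : A → ℝ} (hμ : μ ∈ stdSimplex ℝ A)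
    {f g : A → ℝ} (hf : ∀ a, 0 < μ a → 0 < f a) (hg : ∀ a, 0 < μ a → 0 < g a) {m : ℝ}
    (hm : ∑ a, μ a * Real.logb 2 (f a) - ∑ a, μ a * Real.logb 2 (g a) < m)
    [∀ (n : ℕ) (c : Fin n → A),
      Decidable (∏ t, f (c t) ≤ (2 : ℝ) ^ ((n : ℝ) * m) * ∏ t, g (c t))] :
    Tendsto (fun n : ℕ => ∑ c : Fin n → A, piLaw (Fin n) μ c *
      (if ∏ t, f (c t) ≤ (2 : ℝ) ^ ((n : ℝ) * m) * ∏ t, g (c t) then (0 : ℝ) else 1))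
      atTop (𝓝 0) := by
  set F : A → ℝ := fun a => Real.logb 2 (f a) - Real.logb 2 (g a) with hF
  set e := ∑ a, μ a * F a with he
  have hem : e < m := by
    rw [he]; simp only [hF, mul_sub, sum_sub_distrib]; exact hm
  set δ := m - e with hδ
  have hδ0 : 0 < δ := sub_pos.2 hem
  have hlim : Tendsto (fun n : ℕ => ((∑ a, μ a * F a ^ 2) / δ ^ 2) / (n : ℝ)) atTop (𝓝 0) :=
    tendsto_const_div_atTop_nhds_zero_nat _
  refine squeeze_zero' (Eventually.of_forall fun n => sum_nonneg fun c _ =>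
    mul_nonneg (piLaw_nonneg hμ.1 c) (by split_ifs <;> norm_num)) ?_ hlim
  filter_upwards [eventually_gt_atTop 0] with n hn
  have hn0 : (0 : ℝ) < n := by exact_mod_cast hn
  -- Chebyshev's inequality: when the comparison fails, the log-likelihood ratio exceeds its mean by
  -- more than `n * δ`.
  have key : ∀ c : Fin n → A, piLaw (Fin n) μ c *
      (if ∏ t, f (c t) ≤ (2 : ℝ) ^ ((n : ℝ) * m) * ∏ t, g (c t) then (0 : ℝ) else 1) ≤
      piLaw (Fin n) μ c * (∑ i, F (c i) - Fintype.card (Fin n) * e) ^ 2 / (n * δ) ^ 2 := by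
    intro c
    rcases (piLaw_nonneg hμ.1 c).eq_or_lt with h0 | h0
    · simp [← h0]
    · rw [mul_div_assoc]
      refine mul_le_mul_of_nonneg_left ?_ h0.le
      split_ifs with hc
      · positivity
      · have hpos : ∀ t, 0 < μ (c t) := fun t => (hμ.1 _).lt_of_ne' fun h =>
          h0.ne' (prod_eq_zero (mem_univ t) h)
        have hfp : 0 < ∏ t, f (c t) := prod_pos fun t _ => hf _ (hpos t)
        have hgp : 0 < ∏ t, g (c t) := prod_pos fun t _ => hg _ (hpos t)
        have h2 : 0 < (2 : ℝ) ^ ((n : ℝ) * m) := by positivity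
        have := Real.logb_lt_logb one_lt_two (mul_pos h2 hgp) (not_le.1 hc)
        rw [Real.logb_mul h2.ne' hgp.ne', Real.logb_rpow two_pos (by norm_num),
          Real.logb_prod _ _ fun t _ => (hf _ (hpos t)).ne',
          Real.logb_prod _ _ fun t _ => (hg _ (hpos t)).ne'] at this
        rw [one_le_div (by positivity)]
        refine pow_le_pow_left₀ (by positivity) ?_ 2
        simp only [hF, sum_sub_distrib, Fintype.card_fin]
        rw [hδ]
        linarith
  refine (sum_le_sum fun c _ => key c).trans ?_
  rw [← sum_div]
  refine (div_le_div_of_nonneg_right (sum_piLaw_mul_sq_sub_le (ι := Fin n) hμ F)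
    (by positivity)).trans (le_of_eq ?_)
  rw [Fintype.card_fin]
  field_simp

/-- Markov's inequality for a product likelihood ratio. -/
theorem sum_prod_mul_ite_le {ι A : Type*} [Fintype ι] [DecidableEq ι] [Fintype A]
    {h f g : ι → A → ℝ}
    (hh : ∀ t a, 0 ≤ h t a) (hf : ∀ t a, 0 ≤ f t a) (hg : ∀ t a, 0 ≤ g t a)
    (hfh : ∀ t a, f t a = 0 → h t a = 0) (hs : ∀ t, ∑ a, h t a / f t a * g t a ≤ 1) {K : ℝ}
    (hK : 0 ≤ K) [∀ c : ι → A, Decidable (∏ t, f t (c t) ≤ K * ∏ t, g t (c t))] :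
    ∑ c : ι → A, (∏ t, h t (c t)) *
      (if ∏ t, f t (c t) ≤ K * ∏ t, g t (c t) then (1 : ℝ) else 0) ≤ K := by
  calc _ ≤ ∑ c : ι → A, K * ∏ t, h t (c t) / f t (c t) * g t (c t) := by
        refine sum_le_sum fun c _ => ?_
        have hhf : 0 ≤ ∏ t, h t (c t) / f t (c t) :=
          prod_nonneg fun t _ => div_nonneg (hh _ _) (hf _ _)
        rw [prod_mul_distrib]
        split_ifs with hc
        · have e : ∏ t, h t (c t) = (∏ t, h t (c t) / f t (c t)) * ∏ t, f t (c t) := by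
            rw [← prod_mul_distrib]
            refine prod_congr rfl fun t _ => ?_
            by_cases h0 : f t (c t) = 0
            · rw [hfh _ _ h0]; simp
            · rw [div_mul_cancel₀ _ h0]
          rw [mul_one, e]
          calc _ ≤ (∏ t, h t (c t) / f t (c t)) * (K * ∏ t, g t (c t)) :=
                mul_le_mul_of_nonneg_left hc hhf
            _ = _ := by ring
        · rw [mul_zero]
          exact mul_nonneg hK (mul_nonneg hhf (prod_nonneg fun t _ => hg _ _))
    _ = K * ∏ t, ∑ a, h t a / f t a * g t a := by
        rw [← mul_sum, sum_pi_prod fun t a => h t a / f t a * g t a]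
    _ ≤ K := mul_le_of_le_one_right hK (prod_le_one (fun t _ => sum_nonneg fun a _ =>
        mul_nonneg (div_nonneg (hh _ _) (hf _ _)) (hg _ _)) fun t _ => hs t)

/-- The bound on type-II errors: with `f` the law under the alternative, a likelihood-ratio test
accepts with probability at most its threshold `K`. -/
theorem sum_prod_cProb_mul_ite_le {ι A : Type*} [Fintype ι] [DecidableEq ι] [Fintype A]
    {f g : ι → A → ℝ}
    (hf : ∀ t a, 0 ≤ f t a) (hg : ∀ t a, 0 ≤ g t a) (hs : ∀ t, ∑ a, g t a ≤ 1) {K : ℝ}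
    (hK : 0 ≤ K) [∀ c : ι → A, Decidable (∏ t, f t (c t) ≤ K * ∏ t, g t (c t))] :
    ∑ c : ι → A, (∏ t, f t (c t)) *
      (if ∏ t, f t (c t) ≤ K * ∏ t, g t (c t) then (1 : ℝ) else 0) ≤ K := by
  refine sum_prod_mul_ite_le hf hf hg (fun _ _ h => h) (fun t => (sum_le_sum fun a _ => ?_).trans
    (hs t)) hK
  exact mul_le_of_le_one_left (hg t a) (div_self_le_one _)

theorem sum_seq_prod {ι A B : Type*} [Fintype ι] [DecidableEq ι] [Fintype A] [Fintype B]
    (F : (ι → A) → (ι → B) → ℝ) :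
    ∑ c : ι → A × B, F (fun t => (c t).1) (fun t => (c t).2) = ∑ x, ∑ y, F x y := by
  rw [← Fintype.sum_prod_type']
  exact Fintype.sum_equiv (Equiv.arrowProdEquivProdArrow ι (fun _ => A) (fun _ => B)) _ _
    fun _ => rfl

end CondProb

/-! ### The one-shot code for memoryless laws. -/

section Block

variable {U V X S Z : Type*} [Fintype U] [Fintype V] [Fintype X] [Fintype S]

open Classical in
/-- `exists_oneShot_code` for memoryless laws. -/
theorem exists_block_code {n : ℕ} {a : U → ℝ} {b : U → V → ℝ} {W : U → V → X → ℝ} {q : X → ℝ}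
    {ξ : S → X} {ζ : S → Z} {T : S → ℝ} {P : S → ℝ} {Q : (U × V) × S → ℝ} {μ : U × V × X → ℝ}
    (ha : a ∈ stdSimplex ℝ U) (hb : ∀ u, b u ∈ stdSimplex ℝ V) (hW : ∀ u v x, 0 ≤ W u v x)
    (hq : ∀ x, ∑ u, a u * ∑ v, b u v * W u v x = q x) (hq1 : ∑ x, q x = 1)
    (hT : ∀ s, 0 ≤ T s) (hT1 : ∀ x, law T ξ x ≤ 1) (hP : ∀ s, q (ξ s) * T s = P s)
    (hQ : ∀ u v s, a u * b u v * W u v (ξ s) * T s = Q ((u, v), s))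
    (hμ : ∀ u v x, a u * b u v * W u v x = μ (u, v, x))
    {g₁ g₀ : U × V × X → ℝ} {B₁ B₀ : ℝ} (hB₁ : 0 ≤ B₁) (hB₀ : 0 ≤ B₀)
    (hgood : ∀ u v x, W u v x = g₁ (u, v, x))
    (hgood₀ : ∀ u v x, ∑ v, b u v * W u v x = g₀ (u, v, x))
    (G : (Fin n → U) → (Fin n → V) → (Fin n → Z) → Prop)
    (T₁ : (Fin n → U) × (Fin n → V) → (Fin n → S) → Prop) (T₂ : (Fin n → U) → (Fin n → S) → Prop)
    {N₀ N₁ : ℕ} (hN₀ : 0 < N₀) (hN₁ : 0 < N₁) (L : ℕ) {K : ℝ}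
    (hG : ∑ s : Fin n → S, ∑ u : Fin n → U, ∑ v : Fin n → V,
      (∏ t, a (u t) * (∑ v, b (u t) v * W (u t) v (ξ (s t))) * T (s t) * b (u t) (v t)) *
        (if G u v (fun t => ζ (s t)) then 1 else 0) ≤ K) :
    ∃ enc : (Fin n → X) → Fin N₀ × Fin N₁ → ℝ, (∀ x, enc x ∈ stdSimplex ℝ (Fin N₀ × Fin N₁)) ∧
    ∃ (φ₁ : Fin N₀ × Fin N₁ → (Fin n → Z) → (Fin n → U) × (Fin n → V))
      (φ₂ : Fin N₀ × Fin N₁ → Fin n → U),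
      ∑ s : Fin n → S, (∏ t, P (s t)) * ∑ m, enc (fun t => ξ (s t)) m *
          (if T₁ (φ₁ m fun t => ζ (s t)) s then 0 else 1) +
      ∑ s : Fin n → S, (∏ t, P (s t)) * ∑ m, enc (fun t => ξ (s t)) m *
          (if T₂ (φ₂ m) s then 0 else 1) ≤
        2 * (Real.sqrt (B₁ / (N₀ * (N₁ * (L + 1))) + B₀ / N₀) +
          2 * (∑ c : Fin n → U × V × X, piLaw (Fin n) μ c *
              (if ∏ t, g₁ (c t) ≤ B₁ * ∏ t, q (c t).2.2 then 0 else 1) +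
            ∑ c : Fin n → U × V × X, piLaw (Fin n) μ c *
              (if ∏ t, g₀ (c t) ≤ B₀ * ∏ t, q (c t).2.2 then 0 else 1))) +
        ∑ c : Fin n → (U × V) × S, piLaw (Fin n) Q c *
          ((if T₁ (fun t => (c t).1.1, fun t => (c t).1.2) (fun t => (c t).2) then 0 else 1) +
          (if G (fun t => (c t).1.1) (fun t => (c t).1.2) (fun t => ζ (c t).2) then 0 else 1) +
          (if T₂ (fun t => (c t).1.1) (fun t => (c t).2) then 0 else 1)) + L * K := by
  have hbW : ∀ (u : Fin n → U) (x : Fin n → X),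
      ∑ v : Fin n → V, (∏ t, b (u t) (v t)) * ∏ t, W (u t) (v t) (x t) =
        ∏ t, ∑ v, b (u t) v * W (u t) v (x t) := fun u x => by
    simp only [← prod_mul_distrib]
    exact sum_pi_prod fun t v => b (u t) v * W (u t) v (x t)
  have hq' : ∀ x : Fin n → X, ∑ u : Fin n → U, piLaw (Fin n) a u *
      ∑ v : Fin n → V, (∏ t, b (u t) (v t)) * ∏ t, W (u t) (v t) (x t) = ∏ t, q (x t) := fun x => by
    simp only [hbW]
    simp only [piLaw, ← prod_mul_distrib]
    rw [sum_pi_prod fun t u => a u * ∑ v, b u v * W u v (x t)]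
    simp only [hq]
  have hsum : ∀ F : (Fin n → U) → (Fin n → V) → (Fin n → X) → ℝ,
      ∑ x : Fin n → X, ∑ u : Fin n → U, piLaw (Fin n) a u * ∑ v : Fin n → V,
        (∏ t, b (u t) (v t)) * ((∏ t, W (u t) (v t) (x t)) * F u v x) =
      ∑ c : Fin n → U × V × X, piLaw (Fin n) μ c *
        F (fun t => (c t).1) (fun t => (c t).2.1) (fun t => (c t).2.2) := fun F => by
    refine Eq.symm ((sum_seq_prod fun (u : Fin n → U) (vx : Fin n → V × X) =>
      (∏ t, μ (u t, vx t)) * F u (fun t => (vx t).1) (fun t => (vx t).2)).trans ?_)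
    rw [sum_comm (s := (univ : Finset (Fin n → X)))]
    refine sum_congr rfl fun u _ => (sum_seq_prod fun (v : Fin n → V) (x : Fin n → X) =>
      (∏ t, μ (u t, v t, x t)) * F u v x).trans ?_
    simp only [mul_sum, piLaw]
    rw [sum_comm (s := (univ : Finset (Fin n → X)))]
    refine sum_congr rfl fun v _ => sum_congr rfl fun x _ => ?_
    simp only [← hμ, prod_mul_distrib]
    ring
  obtain ⟨enc, henc, φ₁, φ₂, h⟩ := exists_oneShot_code (a := piLaw (Fin n) a)
    (b := fun (u : Fin n → U) (v : Fin n → V) => ∏ t, b (u t) (v t)) (piLaw_mem ha)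
    (fun u => ⟨fun v => prod_nonneg fun t _ => (hb _).1 _, by
      rw [sum_pi_prod fun t v => b (u t) v]; simp [(hb _).2]⟩)
    (W := fun u v (x : Fin n → X) => ∏ t, W (u t) (v t) (x t))
    (fun u v x => prod_nonneg fun t _ => hW _ _ _) (q := fun x => ∏ t, q (x t)) hq'
    (by rw [sum_pi_prod fun _ x => q x]; simp [hq1]) (fun (s : Fin n → S) t => ξ (s t))
    (fun s t => ζ (s t)) (T := fun s => ∏ t, T (s t)) (fun s => prod_nonneg fun t _ => hT _)
    (fun x => by
      rw [law_pi]
      exact prod_le_one (fun t _ => law_nonneg hT _ _) fun t _ => hT1 _)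
    -- A good triple obeys both likelihood bounds; the union bound splits its failure into the two
    -- sums of the claim.
    (fun u v x => ∏ t, W (u t) (v t) (x t) ≤ B₁ * ∏ t, q (x t) ∧
      ∏ t, ∑ v, b (u t) v * W (u t) v (x t) ≤ B₀ * ∏ t, q (x t)) G T₁ T₂ hB₀ hB₁
    (fun u v x h => h.1) (fun u v x h => by rw [hbW]; exact h.2) hN₀ hN₁ L
  refine ⟨enc, henc, φ₁, φ₂, ?_⟩
  simp only [← prod_mul_distrib, hP] at h
  refine h.trans (add_le_add (add_le_add ?_ (le_of_eq ?_)) ?_)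
  · refine mul_le_mul_of_nonneg_left (add_le_add le_rfl (mul_le_mul_of_nonneg_left ?_
      two_pos.le)) two_pos.le
    have e := hsum fun u v x => @ite ℝ (∏ t, W (u t) (v t) (x t) ≤ B₁ * ∏ t, q (x t) ∧
      ∏ t, ∑ v, b (u t) v * W (u t) v (x t) ≤ B₀ * ∏ t, q (x t)) (Classical.propDecidable _) 0 1
    have hite : ∀ (p : Prop) (w : ℝ), (if p then 0 else w) = w * if p then 0 else 1 :=
      fun p w => by split_ifs <;> simp
    simp only [hite _ (∏ t, W _ _ _)]
    rw [e, ← sum_add_distrib]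
    refine sum_le_sum fun c _ => ?_
    have h0 : 0 ≤ piLaw (Fin n) μ c := piLaw_nonneg (fun p => by
      rw [← hμ p.1 p.2.1 p.2.2]
      exact mul_nonneg (mul_nonneg (ha.1 _) ((hb _).1 _)) (hW _ _ _)) c
    have e₁ : ∏ t, W (c t).1 (c t).2.1 (c t).2.2 = ∏ t, g₁ (c t) :=
      prod_congr rfl fun t _ => hgood _ _ _
    have e₀ : ∏ t, ∑ v, b (c t).1 v * W (c t).1 v (c t).2.2 = ∏ t, g₀ (c t) :=
      prod_congr rfl fun t _ => hgood₀ _ (c t).2.1 _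
    simp only [e₁, e₀]
    rw [← mul_add]
    refine mul_le_mul_of_nonneg_left ?_ h0
    have hand : ∀ {p r : Prop} {_ : Decidable p} {_ : Decidable r} {_ : Decidable (p ∧ r)},
        (if p ∧ r then (0 : ℝ) else 1) ≤ (if p then 0 else 1) + (if r then 0 else 1) := by
      intro p r _ _ _
      by_cases h1 : p <;> by_cases h2 : r <;> simp [h1, h2]
    exact hand
  · refine Eq.symm ((sum_seq_prod fun (uv : Fin n → U × V) (s : Fin n → S) =>
      (∏ t, Q (uv t, s t)) *
      ((if T₁ (fun t => (uv t).1, fun t => (uv t).2) s then (0 : ℝ) else 1) +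
        (if G (fun t => (uv t).1) (fun t => (uv t).2) (fun t => ζ (s t)) then 0 else 1) +
        (if T₂ (fun t => (uv t).1) s then 0 else 1))).trans ?_)
    rw [sum_comm]
    refine sum_congr rfl fun s _ => (sum_seq_prod fun (u : Fin n → U) (v : Fin n → V) =>
      (∏ t, Q ((u t, v t), s t)) * ((if T₁ (u, v) s then (0 : ℝ) else 1) +
        (if G u v (fun t => ζ (s t)) then 0 else 1) + (if T₂ u s then 0 else 1))).trans ?_
    simp only [mul_sum, piLaw]
    refine sum_congr rfl fun u _ => sum_congr rfl fun v _ => ?_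
    simp only [← hQ, prod_mul_distrib]
    ring
  · refine mul_le_mul_of_nonneg_left (le_trans (le_of_eq ?_) hG) (Nat.cast_nonneg _)
    refine sum_congr rfl fun s _ => ?_
    rw [mul_sum]
    refine sum_congr rfl fun u _ => ?_
    simp only [prod_mul_distrib] at hbW ⊢
    rw [hbW, mul_sum, mul_sum, mul_sum]
    refine sum_congr rfl fun v _ => ?_
    simp only [piLaw]
    ring

end Block

/-! ### Codes assembled from an encoder and one test per message. -/

section CodeOfTests

variable {𝒳 𝒴₁ 𝒴₂ 𝒵₁ : Type*} [Fintype 𝒳] [Fintype 𝒴₁] [Fintype 𝒴₂] [Fintype 𝒵₁]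
  {P : Src 𝒳 𝒴₁ 𝒴₂ 𝒵₁ → ℝ} {n : ℕ} {R : ℝ}

theorem law_jointLaw (c : Code 𝒳 𝒴₁ 𝒴₂ 𝒵₁ n R) (Q : Src 𝒳 𝒴₁ 𝒴₂ 𝒵₁ → ℝ)
    (D : (Fin n → Src 𝒳 𝒴₁ 𝒴₂ 𝒵₁) × Message n R → Fin 2) (d : Fin 2) :
    law (c.jointLaw Q) D d = ∑ s : Fin n → Src 𝒳 𝒴₁ 𝒴₂ 𝒵₁, (∏ t, Q (s t)) *
      ∑ m, c.enc (fun t => Xc (s t)) m * (if D (s, m) = d then 1 else 0) := by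
  rw [law_eq_sum_ite, Fintype.sum_prod_type]
  refine sum_congr rfl fun s _ => ?_
  rw [mul_sum]
  refine sum_congr rfl fun m _ => ?_
  simp only [Code.jointLaw]
  split_ifs <;> simp

theorem sum_piLaw_mul_comp {σ τ : Type*} [Fintype σ] [Fintype τ] (Q : σ → ℝ) (f : σ → τ)
    (g : (Fin n → τ) → ℝ) :
    ∑ s : Fin n → σ, (∏ t, Q (s t)) * g (fun t => f (s t)) =
      ∑ y : Fin n → τ, (∏ t, law Q f (y t)) * g y := by
  simp only [← law_pi]
  exact (sum_law_mul _ _ g).symm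

open Classical in
/-- A message set smaller than the one allowed and a test for each message give a code. -/
theorem exists_code_of_tests (hP : P ∈ stdSimplex ℝ (Src 𝒳 𝒴₁ 𝒴₂ 𝒵₁)) {M : Type*} [Fintype M]
    [Nonempty M] (hM : Fintype.card M ≤ Fintype.card (Message n R)) (enc : (Fin n → 𝒳) → M → ℝ)
    (henc : ∀ x, enc x ∈ stdSimplex ℝ M) (t₁ : M → (Fin n → 𝒴₁) → (Fin n → 𝒵₁) → Prop)
    (t₂ : M → (Fin n → 𝒴₂) → Prop) {K₁ K₂ : ℝ}
    (h₁ : ∀ m (z : Fin n → 𝒵₁), ∑ y : Fin n → 𝒴₁, (∏ t, cProb P Y1c Z1c (y t) (z t)) *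
      (if t₁ m y z then 1 else 0) ≤ K₁)
    (h₂ : ∀ m, ∑ y : Fin n → 𝒴₂, (∏ t, law P Y2c (y t)) * (if t₂ m y then 1 else 0) ≤ K₂) :
    ∃ c : Code 𝒳 𝒴₁ 𝒴₂ 𝒵₁ n R,
      c.typeI₁ P = ∑ s : Fin n → Src 𝒳 𝒴₁ 𝒴₂ 𝒵₁, (∏ t, P (s t)) *
        ∑ m, enc (fun t => Xc (s t)) m *
          (if t₁ m (fun t => Y1c (s t)) (fun t => Z1c (s t)) then 0 else 1) ∧
      c.typeI₂ P = ∑ s : Fin n → Src 𝒳 𝒴₁ 𝒴₂ 𝒵₁, (∏ t, P (s t)) *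
        ∑ m, enc (fun t => Xc (s t)) m * (if t₂ m (fun t => Y2c (s t)) then 0 else 1) ∧
      c.typeII₁ P ≤ K₁ ∧ c.typeII₂ P ≤ K₂ := by
  -- Messages are embedded in the allowed set and the receivers invert the embedding; symbols
  -- outside its range are never sent.
  obtain ⟨f⟩ := Function.Embedding.nonempty_of_card_le hM
  have hf : ∀ m, Function.invFun f (f m) = m := Function.leftInverse_invFun f.injective
  let c : Code 𝒳 𝒴₁ 𝒴₂ 𝒵₁ n R :=
    { enc := fun x => law (enc x) f
      enc_mem := fun x => law_mem_stdSimplex (henc x) f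
      dec₁ := fun y z m => if t₁ (Function.invFun f m) y z then 0 else 1
      dec₂ := fun y m => if t₂ (Function.invFun f m) y then 0 else 1 }
  have hdec : ∀ p : Prop, ((if p then (0 : Fin 2) else 1) = 1) = ¬p := fun p => by
    split_ifs with h <;> simp [h]
  have hdec' : ∀ p : Prop, ((if p then (0 : Fin 2) else 1) = 0) = p := fun p => by
    split_ifs with h <;> simp [h]
  refine ⟨c, ?_, ?_, ?_, ?_⟩
  · simp only [Code.typeI₁, law_jointLaw, c, sum_law_mul, Code.decision₁, hf, hdec, ite_not]
  · simp only [Code.typeI₂, law_jointLaw, c, sum_law_mul, Code.decision₂, hf, hdec, ite_not]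
  · simp only [Code.typeII₁, law_jointLaw, c, sum_law_mul, Code.decision₁, hf, hdec']
    refine (sum_piLaw_mul_comp (altLaw P) (fun s => (Xc s, Y1c s, Z1c s)) fun w =>
      ∑ m, enc (fun t => (w t).1) m *
        (if t₁ m (fun t => (w t).2.1) (fun t => (w t).2.2) then 1 else 0)).trans_le ?_
    refine (sum_seq_prod fun (x : Fin n → 𝒳) (yz : Fin n → 𝒴₁ × 𝒵₁) =>
      (∏ t, law (altLaw P) (fun s => (Xc s, Y1c s, Z1c s)) (x t, yz t)) * ∑ m, enc x m *
        (if t₁ m (fun t => (yz t).1) (fun t => (yz t).2) then 1 else 0)).trans_le ?_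
    -- Under the alternative, `y` is drawn given `z` without regard to the message, so a bound
    -- uniform in the message survives averaging over the encoder.
    have hle : ∀ (x : Fin n → 𝒳) (z : Fin n → 𝒵₁), ∑ y : Fin n → 𝒴₁,
        (∏ t, law (altLaw P) (fun s => (Xc s, Y1c s, Z1c s)) (x t, y t, z t)) *
          ∑ m, enc x m * (if t₁ m y z then (1 : ℝ) else 0) ≤
        K₁ * ∏ t, law P (fun s => (Xc s, Z1c s)) (x t, z t) := by
      intro x z
      simp only [law_altLaw_X_Y1_Z1 hP, prod_mul_distrib, mul_sum]
      rw [sum_comm]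
      have h0 : 0 ≤ ∏ t, law P (fun s => (Xc s, Z1c s)) (x t, z t) :=
        prod_nonneg fun t _ => law_nonneg hP.1 _ _
      calc _ = ∑ m, enc x m * ((∏ t, law P (fun s => (Xc s, Z1c s)) (x t, z t)) *
            ∑ y : Fin n → 𝒴₁, (∏ t, cProb P Y1c Z1c (y t) (z t)) *
              (if t₁ m y z then 1 else 0)) := by
            simp only [mul_sum]
            refine sum_congr rfl fun m _ => sum_congr rfl fun y _ => ?_
            simp only [cProb]
            ring
        _ ≤ ∑ m, enc x m * ((∏ t, law P (fun s => (Xc s, Z1c s)) (x t, z t)) * K₁) :=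
            sum_le_sum fun m _ => mul_le_mul_of_nonneg_left
              (mul_le_mul_of_nonneg_left (h₁ m z) h0) ((henc x).1 m)
        _ = _ := by rw [← sum_mul, (henc x).2, one_mul, mul_comm]
    calc _ ≤ ∑ x : Fin n → 𝒳, ∑ z : Fin n → 𝒵₁,
          K₁ * ∏ t, law P (fun s => (Xc s, Z1c s)) (x t, z t) := by
          refine sum_le_sum fun x _ => ?_
          refine (sum_seq_prod fun (y : Fin n → 𝒴₁) (z : Fin n → 𝒵₁) =>
            (∏ t, law (altLaw P) (fun s => (Xc s, Y1c s, Z1c s)) (x t, y t, z t)) *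
              ∑ m, enc x m * (if t₁ m y z then 1 else 0)).trans_le ?_
          rw [sum_comm]
          exact sum_le_sum fun z _ => hle x z
      _ = K₁ := by
          simp only [← mul_sum]
          rw [← sum_seq_prod fun x z => ∏ t, law P (fun s => (Xc s, Z1c s)) (x t, z t),
            sum_pi_prod fun _ w => law P (fun s => (Xc s, Z1c s)) w, sum_law, hP.2]
          simp
  · simp only [Code.typeII₂, law_jointLaw, c, sum_law_mul, Code.decision₂, hf, hdec']
    refine (sum_piLaw_mul_comp (altLaw P) (fun s => (Xc s, Y2c s)) fun w =>
      ∑ m, enc (fun t => (w t).1) m * (if t₂ m (fun t => (w t).2) then 1 else 0)).trans_le ?_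
    refine (sum_seq_prod fun (x : Fin n → 𝒳) (y : Fin n → 𝒴₂) =>
      (∏ t, law (altLaw P) (fun s => (Xc s, Y2c s)) (x t, y t)) * ∑ m, enc x m *
        (if t₂ m y then 1 else 0)).trans_le ?_
    have hle : ∀ x : Fin n → 𝒳, ∑ y : Fin n → 𝒴₂,
        (∏ t, law (altLaw P) (fun s => (Xc s, Y2c s)) (x t, y t)) *
          ∑ m, enc x m * (if t₂ m y then (1 : ℝ) else 0) ≤ K₂ * ∏ t, law P Xc (x t) := by
      intro x
      simp only [law_altLaw_X_Y2 hP, prod_mul_distrib, mul_sum]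
      rw [sum_comm]
      have h0 : 0 ≤ ∏ t, law P Xc (x t) := prod_nonneg fun t _ => law_nonneg hP.1 _ _
      calc _ = ∑ m, enc x m * ((∏ t, law P Xc (x t)) *
            ∑ y : Fin n → 𝒴₂, (∏ t, law P Y2c (y t)) * (if t₂ m y then 1 else 0)) := by
            simp only [mul_sum]
            refine sum_congr rfl fun m _ => sum_congr rfl fun y _ => ?_
            ring
        _ ≤ ∑ m, enc x m * ((∏ t, law P Xc (x t)) * K₂) :=
            sum_le_sum fun m _ => mul_le_mul_of_nonneg_left
              (mul_le_mul_of_nonneg_left (h₂ m) h0) ((henc x).1 m)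
        _ = _ := by rw [← sum_mul, (henc x).2, one_mul, mul_comm]
    refine (sum_le_sum fun x _ => hle x).trans (le_of_eq ?_)
    rw [← mul_sum, sum_pi_prod fun _ x => law P Xc x, sum_law, hP.2]
    simp

end CodeOfTests

/-! ### Single-letter kernels extracted from the auxiliary law. -/

section Letters

variable {𝒳 𝒴₁ 𝒴₂ 𝒵₁ : Type*} [Fintype 𝒳] [Fintype 𝒴₁] [Fintype 𝒴₂] [Fintype 𝒵₁]
  {P : Src 𝒳 𝒴₁ 𝒴₂ 𝒵₁ → ℝ} {U V : Type*} [Fintype U] [Fintype V]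
  {Q : (U × V) × Src 𝒳 𝒴₁ 𝒴₂ 𝒵₁ → ℝ}

open Classical in
/-- A version of the conditional pmf of `U₁` given `U₀` that is a pmf for every value of `U₀`. -/
def satKernel (Q : (U × V) × Src 𝒳 𝒴₁ 𝒴₂ 𝒵₁ → ℝ) (u : U) (v : V) : ℝ :=
  if law Q (fun ω => ω.1.1) u = 0 then law Q (fun ω => ω.1.2) v
  else cProb Q (fun ω => ω.1.2) (fun ω => ω.1.1) v u

theorem satKernel_mem (hQ : Q ∈ stdSimplex ℝ ((U × V) × Src 𝒳 𝒴₁ 𝒴₂ 𝒵₁)) (u : U) :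
    satKernel Q u ∈ stdSimplex ℝ V := by
  by_cases h : law Q (fun ω => ω.1.1) u = 0
  · have : satKernel Q u = law Q fun ω => ω.1.2 := by funext v; simp [satKernel, h]
    rw [this]
    exact law_mem_stdSimplex hQ _
  · have : satKernel Q u = fun v => cProb Q (fun ω => ω.1.2) (fun ω => ω.1.1) v u := by
      funext v; simp [satKernel, h]
    rw [this]
    exact ⟨fun v => cProb_nonneg hQ.1 _ _ _ _, sum_cProb Q _ _ h⟩

theorem law_mul_satKernel (hQ : ∀ ω, 0 ≤ Q ω) (u : U) (v : V) :
    law Q (fun ω => ω.1.1) u * satKernel Q u v = law Q Prod.fst (u, v) := by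
  have h2 : law Q (fun ω => (ω.1.2, ω.1.1)) (v, u) = law Q Prod.fst (u, v) :=
    law_congr _ _ _ _ _ fun ω => by simp [Prod.ext_iff, and_comm]
  by_cases h : law Q (fun ω => ω.1.1) u = 0
  · have := law_le_of_imp hQ Prod.fst (fun ω => ω.1.1) (u, v) u fun ω h => by rw [h]
    rw [h] at this
    rw [h, zero_mul, le_antisymm this (law_nonneg hQ _ _)]
  · rw [← h2, ← cProb_mul_law hQ (fun ω => ω.1.2) (fun ω => ω.1.1) v u]
    simp [satKernel, h, mul_comm]

theorem law_mul_satKernel_mul_cProb (hQ : ∀ ω, 0 ≤ Q ω) {τ : Type*}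
    (f : Src 𝒳 𝒴₁ 𝒴₂ 𝒵₁ → τ) (u : U) (v : V) (x : τ) :
    law Q (fun ω => ω.1.1) u * satKernel Q u v * cProb Q (fun ω => f ω.2) Prod.fst x (u, v) =
      law Q (fun ω => (ω.1.1, ω.1.2, f ω.2)) (u, v, x) := by
  rw [law_mul_satKernel hQ, mul_comm, cProb_mul_law hQ]
  exact law_congr _ _ _ _ _ fun ω => by simp [Prod.ext_iff]; tauto

theorem sum_satKernel_mul_cProb (hQ : ∀ ω, 0 ≤ Q ω) {τ : Type*} [Fintype τ]
    (f : Src 𝒳 𝒴₁ 𝒴₂ 𝒵₁ → τ) (u : U) (x : τ) :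
    ∑ v, satKernel Q u v * cProb Q (fun ω => f ω.2) Prod.fst x (u, v) =
      cProb Q (fun ω => f ω.2) (fun ω => ω.1.1) x u := by
  by_cases h : law Q (fun ω => ω.1.1) u = 0
  · have h0 : ∀ v, law Q Prod.fst (u, v) = 0 := fun v => by
      rw [← law_mul_satKernel hQ, h, zero_mul]
    simp [cProb, h, h0]
  · refine mul_left_cancel₀ h ?_
    rw [mul_comm _ (cProb _ _ _ _ _), cProb_mul_law hQ, mul_sum]
    simp only [← mul_assoc, law_mul_satKernel_mul_cProb hQ]
    have := sum_law_pair' Q (fun ω => (f ω.2, ω.1.1)) (fun ω => ω.1.2) (x, u)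
    rw [← this]
    exact sum_congr rfl fun v _ => law_congr _ _ _ _ _ fun ω => by simp [Prod.ext_iff]; tauto

theorem law_mul_sum_satKernel_mul_cProb (hQ : ∀ ω, 0 ≤ Q ω) {τ : Type*} [Fintype τ]
    (f : Src 𝒳 𝒴₁ 𝒴₂ 𝒵₁ → τ) (x : τ) :
    ∑ u, law Q (fun ω => ω.1.1) u *
      ∑ v, satKernel Q u v * cProb Q (fun ω => f ω.2) Prod.fst x (u, v) =
      law Q (fun ω => f ω.2) x := by
  rw [← sum_law_pair Q (fun ω => f ω.2) (fun ω => ω.1.1) x]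
  refine sum_congr rfl fun u _ => ?_
  rw [sum_satKernel_mul_cProb hQ, mul_comm, cProb_mul_law hQ]

/-- This is the conditional pmf of the letter given X. At a null `x` every quotient is 0 and so is
the sum, hence an inequality. -/
theorem law_div_law_le_one (P : Src 𝒳 𝒴₁ 𝒴₂ 𝒵₁ → ℝ) (x : 𝒳) :
    law (fun s => P s / law P Xc (Xc s)) Xc x ≤ 1 := by
  classical
  have : law (fun s => P s / law P Xc (Xc s)) Xc x = law P Xc x / law P Xc x := by
    rw [law_eq_sum_ite, law_eq_sum_ite P Xc x, sum_div]
    rw [← law_eq_sum_ite P Xc x]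
    refine sum_congr rfl fun s _ => ?_
    split_ifs with h
    · rw [h]
    · simp
  rw [this]
  exact div_self_le_one _

theorem law_mul_div_law (hP : ∀ s, 0 ≤ P s) (s : Src 𝒳 𝒴₁ 𝒴₂ 𝒵₁) :
    law P Xc (Xc s) * (P s / law P Xc (Xc s)) = P s := by
  by_cases h : law P Xc (Xc s) = 0
  · have := le_law hP Xc s
    rw [h] at this
    rw [h, zero_mul, le_antisymm this (hP s)]
  · exact mul_div_cancel₀ _ h

theorem IsAuxiliary.law_comp {𝒰 τ : Type*} [Fintype 𝒰] {Q : 𝒰 × Src 𝒳 𝒴₁ 𝒴₂ 𝒵₁ → ℝ}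
    (h : IsAuxiliary P Q) (f : Src 𝒳 𝒴₁ 𝒴₂ 𝒵₁ → τ) (x : τ) :
    law Q (fun ω => f ω.2) x = law P f x := by
  rw [← law_law Q Prod.snd f]
  congr 1
  exact funext h.2.1

theorem IsAuxiliary.sum_mul_comp {𝒰 : Type*} [Fintype 𝒰] {Q : 𝒰 × Src 𝒳 𝒴₁ 𝒴₂ 𝒵₁ → ℝ}
    (h : IsAuxiliary P Q) (g : Src 𝒳 𝒴₁ 𝒴₂ 𝒵₁ → ℝ) : ∑ ω, Q ω * g ω.2 = ∑ s, P s * g s := by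
  rw [← sum_law_mul Q Prod.snd g]
  simp only [h.2.1]

theorem IsAuxiliary.pos {𝒰 : Type*} [Fintype 𝒰] {Q : 𝒰 × Src 𝒳 𝒴₁ 𝒴₂ 𝒵₁ → ℝ}
    (h : IsAuxiliary P Q) {ω : 𝒰 × Src 𝒳 𝒴₁ 𝒴₂ 𝒵₁} (hω : 0 < Q ω) : 0 < P ω.2 := by
  rw [← h.2.1]
  exact law_pos h.1.1 Prod.snd hω

/-- The Markov chain in generative form: a centre, a satellite, X from the pair, and the rest of the
letter from X alone. -/
theorem IsAuxiliary.eq_mul (h : IsAuxiliary P Q) (u : U) (v : V)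
    (s : Src 𝒳 𝒴₁ 𝒴₂ 𝒵₁) :
    law Q (fun ω => ω.1.1) u * satKernel Q u v *
        cProb Q (fun ω => Xc ω.2) Prod.fst (Xc s) (u, v) * (P s / law P Xc (Xc s)) =
      Q ((u, v), s) := by
  rw [law_mul_satKernel_mul_cProb h.1.1]
  have hm := h.2.2 (u, v) (Xc s) (Y1c s, Y2c s, Z1c s)
  have e1 : law Q (fun ω => (ω.1, Xc ω.2, Y1c ω.2, Y2c ω.2, Z1c ω.2))
      ((u, v), Xc s, Y1c s, Y2c s, Z1c s) = Q ((u, v), s) :=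
    law_eq_of_iff _ _ _ _ fun ω => by simp [Prod.ext_iff, Xc, Y1c, Y2c, Z1c]
  have e2 : law Q (fun ω => (Xc ω.2, Y1c ω.2, Y2c ω.2, Z1c ω.2))
      (Xc s, Y1c s, Y2c s, Z1c s) = P s := by
    rw [← h.2.1 s]
    exact law_congr _ _ _ _ _ fun ω => by simp [Prod.ext_iff, Xc, Y1c, Y2c, Z1c]
  have e3 : law Q (fun ω => (ω.1, Xc ω.2)) ((u, v), Xc s) =
      law Q (fun ω => (ω.1.1, ω.1.2, Xc ω.2)) (u, v, Xc s) :=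
    law_congr _ _ _ _ _ fun ω => by simp [Prod.ext_iff]; tauto
  rw [e1, e2, e3, h.law_comp Xc] at hm
  by_cases h0 : law P Xc (Xc s) = 0
  · have h1 := h.law_comp Xc (Xc s)
    have h2 := le_law h.1.1 (fun ω => Xc ω.2) ((u, v), s)
    rw [h1, h0] at h2
    rw [h0, div_zero, mul_zero, le_antisymm h2 (h.1.1 _)]
  · rw [← mul_div_assoc, ← hm, mul_div_cancel_right₀ _ h0]

theorem IsAuxiliary.law_mul_cProb_mul (h : IsAuxiliary P Q) (u : U)
    (s : Src 𝒳 𝒴₁ 𝒴₂ 𝒵₁) :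
    law Q (fun ω => ω.1.1) u * cProb Q (fun ω => Xc ω.2) (fun ω => ω.1.1) (Xc s) u *
      (P s / law P Xc (Xc s)) = law Q (fun ω => (ω.1.1, ω.2)) (u, s) := by
  rw [← sum_satKernel_mul_cProb h.1.1, mul_sum, sum_mul]
  simp only [← mul_assoc, h.eq_mul]
  rw [← sum_law_pair' Q (fun ω => (ω.1.1, ω.2)) (fun ω => ω.1.2) (u, s)]
  exact sum_congr rfl fun v _ => (law_eq_of_iff _ _ _ _ fun ω => by
    simp [Prod.ext_iff]; tauto).symm

/-- A satellite codeword of another bin index fits the side information with small probability. -/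
theorem sum_satKernel_mul_cProb_div_le_one (h : IsAuxiliary P Q) :
    ∑ c : Src 𝒳 𝒴₁ 𝒴₂ 𝒵₁ × U × V, law Q (fun ω => ω.1.1) c.2.1 *
        cProb Q (fun ω => Xc ω.2) (fun ω => ω.1.1) (Xc c.1) c.2.1 * (P c.1 / law P Xc (Xc c.1)) *
        satKernel Q c.2.1 c.2.2 / cProb Q (fun ω => Z1c ω.2) (fun ω => ω.1.1) (Z1c c.1) c.2.1 *
        cProb Q (fun ω => Z1c ω.2) Prod.fst (Z1c c.1) (c.2.1, c.2.2) ≤ 1 := by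
  have hQ := h.1.1
  set φ : 𝒵₁ × U → ℝ := fun p => (∑ v, satKernel Q p.2 v *
    cProb Q (fun ω => Z1c ω.2) Prod.fst p.1 (p.2, v)) /
      cProb Q (fun ω => Z1c ω.2) (fun ω => ω.1.1) p.1 p.2 with hφ
  calc _ = ∑ p : U × Src 𝒳 𝒴₁ 𝒴₂ 𝒵₁, law Q (fun ω => (ω.1.1, ω.2)) p * φ (Z1c p.2, p.1) := by
        simp only [h.law_mul_cProb_mul, hφ]
        rw [Fintype.sum_prod_type]
        conv_rhs => rw [Fintype.sum_prod_type_right]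
        refine sum_congr rfl fun s _ => ?_
        rw [Fintype.sum_prod_type]
        refine sum_congr rfl fun u _ => ?_
        rw [sum_div, mul_sum]
        exact sum_congr rfl fun v _ => by ring
    _ = ∑ ω, Q ω * φ (Z1c ω.2, ω.1.1) :=
        sum_law_mul Q (fun ω => (ω.1.1, ω.2)) fun p => φ (Z1c p.2, p.1)
    _ = ∑ p, law Q (fun ω => (Z1c ω.2, ω.1.1)) p * φ p :=
        (sum_law_mul Q (fun ω => (Z1c ω.2, ω.1.1)) φ).symm
    _ ≤ ∑ p : 𝒵₁ × U, law Q (fun ω => (Z1c ω.2, ω.1.1)) p := by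
        refine sum_le_sum fun p _ => mul_le_of_le_one_right (law_nonneg hQ _ _) ?_
        simp only [hφ]
        rw [sum_satKernel_mul_cProb hQ]
        exact div_self_le_one _
    _ = 1 := by rw [sum_law, h.1.2]

end Letters

/-! ### Block codes with explicit thresholds. -/

section BlockCode

variable {𝒳 𝒴₁ 𝒴₂ 𝒵₁ : Type*} [Fintype 𝒳] [Fintype 𝒴₁] [Fintype 𝒴₂] [Fintype 𝒵₁]
  {P : Src 𝒳 𝒴₁ 𝒴₂ 𝒵₁ → ℝ} {U V : Type*} [Fintype U] [Fintype V]
  {Q : (U × V) × Src 𝒳 𝒴₁ 𝒴₂ 𝒵₁ → ℝ}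

open Classical in
-- Every parameter is a likelihood-ratio threshold. The five sums are null-hypothesis probabilities
-- that a threshold is missed: two for covering, then the test of receiver 1, the fit of the true
-- satellite to Z₁ⁿ, and the test of receiver 2. The term `L * K` pays for wrong satellites.
theorem exists_code_of_isAuxiliary (hP : P ∈ stdSimplex ℝ (Src 𝒳 𝒴₁ 𝒴₂ 𝒵₁)) (h : IsAuxiliary P Q)
    {n : ℕ} {R : ℝ} {N₀ N₁ : ℕ} (hN₀ : 0 < N₀) (hN₁ : 0 < N₁) (L : ℕ)
    (hM : N₀ * N₁ ≤ Fintype.card (Message n R)) {B₁ B₀ K K₁ K₂ : ℝ} (hB₁ : 0 ≤ B₁) (hB₀ : 0 ≤ B₀)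
    (hK : 0 ≤ K) (hK₁ : 0 ≤ K₁) (hK₂ : 0 ≤ K₂) :
    ∃ c : Code 𝒳 𝒴₁ 𝒴₂ 𝒵₁ n R, c.typeI₁ P + c.typeI₂ P ≤
        2 * (Real.sqrt (B₁ / (N₀ * (N₁ * (L + 1))) + B₀ / N₀) +
          2 * (∑ c : Fin n → U × V × 𝒳,
              piLaw (Fin n) (law Q fun ω => (ω.1.1, ω.1.2, Xc ω.2)) c *
              (if ∏ t, cProb Q (fun ω => Xc ω.2) Prod.fst (c t).2.2 ((c t).1, (c t).2.1) ≤
                B₁ * ∏ t, law P Xc (c t).2.2 then 0 else 1) +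
            ∑ c : Fin n → U × V × 𝒳,
              piLaw (Fin n) (law Q fun ω => (ω.1.1, ω.1.2, Xc ω.2)) c *
              (if ∏ t, cProb Q (fun ω => Xc ω.2) (fun ω => ω.1.1) (c t).2.2 (c t).1 ≤
                B₀ * ∏ t, law P Xc (c t).2.2 then 0 else 1))) +
        (∑ c : Fin n → (U × V) × Src 𝒳 𝒴₁ 𝒴₂ 𝒵₁, piLaw (Fin n) Q c *
          (if ∏ t, cProb P Y1c Z1c (Y1c (c t).2) (Z1c (c t).2) ≤ K₁ * ∏ t, cProb Q
            (fun ω => Y1c ω.2) (fun ω => (Z1c ω.2, ω.1.1, ω.1.2)) (Y1c (c t).2)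
              (Z1c (c t).2, (c t).1.1, (c t).1.2) then 0 else 1) +
        ∑ c : Fin n → (U × V) × Src 𝒳 𝒴₁ 𝒴₂ 𝒵₁, piLaw (Fin n) Q c *
          (if ∏ t, cProb Q (fun ω => Z1c ω.2) (fun ω => ω.1.1) (Z1c (c t).2) (c t).1.1 ≤
            K * ∏ t, cProb Q (fun ω => Z1c ω.2) Prod.fst (Z1c (c t).2) (c t).1 then 0 else 1) +
        ∑ c : Fin n → (U × V) × Src 𝒳 𝒴₁ 𝒴₂ 𝒵₁, piLaw (Fin n) Q c *
          (if ∏ t, law P Y2c (Y2c (c t).2) ≤ K₂ * ∏ t, cProb Q (fun ω => Y2c ω.2)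
            (fun ω => ω.1.1) (Y2c (c t).2) (c t).1.1 then 0 else 1)) + L * K ∧
      c.typeII₁ P ≤ K₁ ∧ c.typeII₂ P ≤ K₂ := by
  have hQ := h.1
  let t₁ : (Fin n → U) × (Fin n → V) → (Fin n → 𝒴₁) → (Fin n → 𝒵₁) → Prop := fun uv y z =>
    ∏ t, cProb P Y1c Z1c (y t) (z t) ≤ K₁ * ∏ t, cProb Q (fun ω => Y1c ω.2)
      (fun ω => (Z1c ω.2, ω.1.1, ω.1.2)) (y t) (z t, uv.1 t, uv.2 t)
  let t₂ : (Fin n → U) → (Fin n → 𝒴₂) → Prop := fun u y =>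
    ∏ t, law P Y2c (y t) ≤ K₂ * ∏ t, cProb Q (fun ω => Y2c ω.2) (fun ω => ω.1.1) (y t) (u t)
  obtain ⟨enc, henc, φ₁, φ₂, hI⟩ := exists_block_code (n := n) (P := P) (Q := Q)
    (a := law Q fun ω => ω.1.1) (b := satKernel Q)
    (W := fun u v x => cProb Q (fun ω => Xc ω.2) Prod.fst x (u, v)) (q := law P Xc) (ξ := Xc)
    (ζ := Z1c) (T := fun s => P s / law P Xc (Xc s))
    (μ := law Q fun ω => (ω.1.1, ω.1.2, Xc ω.2)) (law_mem_stdSimplex hQ _) (satKernel_mem hQ)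
    (fun u v x => cProb_nonneg hQ.1 _ _ _ _)
    (fun x => by rw [law_mul_sum_satKernel_mul_cProb hQ.1, h.law_comp]) (by rw [sum_law, hP.2])
    (fun s => div_nonneg (hP.1 s) (law_nonneg hP.1 _ _)) (law_div_law_le_one P)
    (law_mul_div_law hP.1) h.eq_mul (fun u v x => law_mul_satKernel_mul_cProb hQ.1 Xc u v x)
    (g₁ := fun p => cProb Q (fun ω => Xc ω.2) Prod.fst p.2.2 (p.1, p.2.1))
    (g₀ := fun p => cProb Q (fun ω => Xc ω.2) (fun ω => ω.1.1) p.2.2 p.1) hB₁ hB₀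
    (fun u v x => rfl) (fun u v x => sum_satKernel_mul_cProb hQ.1 Xc u x)
    (fun u v z => ∏ t, cProb Q (fun ω => Z1c ω.2) (fun ω => ω.1.1) (z t) (u t) ≤
      K * ∏ t, cProb Q (fun ω => Z1c ω.2) Prod.fst (z t) (u t, v t))
    (fun uv s => t₁ uv (fun t => Y1c (s t)) fun t => Z1c (s t))
    (fun u s => t₂ u fun t => Y2c (s t)) hN₀ hN₁ L (K := K) (by
      have hM := sum_prod_mul_ite_le (ι := Fin n) (A := Src 𝒳 𝒴₁ 𝒴₂ 𝒵₁ × U × V)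
        (h := fun _ c => law Q (fun ω => ω.1.1) c.2.1 *
          cProb Q (fun ω => Xc ω.2) (fun ω => ω.1.1) (Xc c.1) c.2.1 * (P c.1 / law P Xc (Xc c.1)) *
          satKernel Q c.2.1 c.2.2)
        (f := fun _ c => cProb Q (fun ω => Z1c ω.2) (fun ω => ω.1.1) (Z1c c.1) c.2.1)
        (g := fun _ c => cProb Q (fun ω => Z1c ω.2) Prod.fst (Z1c c.1) (c.2.1, c.2.2))
        (fun t c => by
          rw [h.law_mul_cProb_mul]
          exact mul_nonneg (law_nonneg hQ.1 _ _) ((satKernel_mem hQ _).1 _))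
        (fun t c => cProb_nonneg hQ.1 _ _ _ _) (fun t c => cProb_nonneg hQ.1 _ _ _ _)
        (fun t c hc => by
          rw [h.law_mul_cProb_mul]
          have h1 := cProb_mul_law hQ.1 (fun ω => Z1c ω.2) (fun ω => ω.1.1) (Z1c c.1) c.2.1
          rw [hc, zero_mul] at h1
          have h2 := law_le_of_imp hQ.1 (fun ω => (ω.1.1, ω.2)) (fun ω => (Z1c ω.2, ω.1.1))
            (c.2.1, c.1) (Z1c c.1, c.2.1) fun ω hω => by
              simp only [Prod.ext_iff] at hω ⊢
              simp [Z1c, hω]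
          rw [← h1] at h2
          rw [le_antisymm h2 (law_nonneg hQ.1 _ _), zero_mul])
        (fun _ => sum_satKernel_mul_cProb_div_le_one h) hK
      refine le_trans (le_of_eq ?_) hM
      refine Eq.symm ((sum_seq_prod fun (s : Fin n → Src 𝒳 𝒴₁ 𝒴₂ 𝒵₁) (uv : Fin n → U × V) =>
        (∏ t, law Q (fun ω => ω.1.1) (uv t).1 *
          cProb Q (fun ω => Xc ω.2) (fun ω => ω.1.1) (Xc (s t)) (uv t).1 *
          (P (s t) / law P Xc (Xc (s t))) * satKernel Q (uv t).1 (uv t).2) *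
        if ∏ t, cProb Q (fun ω => Z1c ω.2) (fun ω => ω.1.1) (Z1c (s t)) (uv t).1 ≤
          K * ∏ t, cProb Q (fun ω => Z1c ω.2) Prod.fst (Z1c (s t)) ((uv t).1, (uv t).2)
          then 1 else 0).trans ?_)
      refine sum_congr rfl fun s _ =>
        (sum_seq_prod fun (u : Fin n → U) (v : Fin n → V) => (∏ t, law Q (fun ω => ω.1.1) (u t) *
          cProb Q (fun ω => Xc ω.2) (fun ω => ω.1.1) (Xc (s t)) (u t) *
          (P (s t) / law P Xc (Xc (s t))) * satKernel Q (u t) (v t)) *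
        if ∏ t, cProb Q (fun ω => Z1c ω.2) (fun ω => ω.1.1) (Z1c (s t)) (u t) ≤
          K * ∏ t, cProb Q (fun ω => Z1c ω.2) Prod.fst (Z1c (s t)) (u t, v t)
          then 1 else 0).trans ?_
      simp only [sum_satKernel_mul_cProb hQ.1])
  have : Nonempty (Fin N₀ × Fin N₁) := ⟨(⟨0, hN₀⟩, ⟨0, hN₁⟩)⟩
  obtain ⟨c, h1, h2, h3, h4⟩ := exists_code_of_tests (n := n) (R := R) hP
    (by simpa using hM) enc henc (fun m y z => t₁ (φ₁ m z) y z) (fun m y => t₂ (φ₂ m) y)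
    (K₁ := K₁) (K₂ := K₂)
    (fun m z => sum_prod_cProb_mul_ite_le (f := fun t y => cProb P Y1c Z1c y (z t))
      (g := fun t y => cProb Q (fun ω => Y1c ω.2) (fun ω => (Z1c ω.2, ω.1.1, ω.1.2)) y
        (z t, (φ₁ m z).1 t, (φ₁ m z).2 t)) (fun _ _ => cProb_nonneg hP.1 _ _ _ _)
      (fun _ _ => cProb_nonneg hQ.1 _ _ _ _) (fun _ => sum_cProb_le_one _ _ _ _) hK₁)
    (fun m => sum_prod_cProb_mul_ite_le (f := fun t y => law P Y2c y)
      (g := fun t y => cProb Q (fun ω => Y2c ω.2) (fun ω => ω.1.1) y (φ₂ m t))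
      (fun _ _ => law_nonneg hP.1 _ _)
      (fun _ _ => cProb_nonneg hQ.1 _ _ _ _) (fun _ => sum_cProb_le_one _ _ _ _) hK₂)
  refine ⟨c, ?_, h3, h4⟩
  rw [h1, h2]
  refine hI.trans (le_of_eq ?_)
  simp only [mul_add (piLaw _ Q _), sum_add_distrib]
  congr!

end BlockCode

/-! ### Choice of rates and vanishing error terms. -/

section Asymptotics

open Filter Topology

variable {𝒳 𝒴₁ 𝒴₂ 𝒵₁ : Type*} [Fintype 𝒳] [Fintype 𝒴₁] [Fintype 𝒴₂] [Fintype 𝒵₁]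
  {P : Src 𝒳 𝒴₁ 𝒴₂ 𝒵₁ → ℝ} {U V : Type*} [Fintype U] [Fintype V]
  {Q : (U × V) × Src 𝒳 𝒴₁ 𝒴₂ 𝒵₁ → ℝ}

theorem IsAuxiliary.cEnt_le_entropy {U τ : Type*} [Fintype U] [Fintype τ]
    {Q : U × Src 𝒳 𝒴₁ 𝒴₂ 𝒵₁ → ℝ} {β : Type*} [Fintype β] (h : IsAuxiliary P Q)
    (f : Src 𝒳 𝒴₁ 𝒴₂ 𝒵₁ → τ) (B : U × Src 𝒳 𝒴₁ 𝒴₂ 𝒵₁ → β) :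
    cEnt Q (fun ω => f ω.2) B ≤ entropy P f := by
  have := entropy_pair_le h.1 (fun ω => f ω.2) B
  rw [← entropy_comp_snd h, cEnt]
  linarith

/-- The left side is I(U₀,U₁;X), the exponent of the codebook size needed for covering. It splits
into the message rate and I(U₁;Z₁|U₀), the bin size that Z₁ can resolve. -/
theorem IsAuxiliary.covering_eq (h : IsAuxiliary P Q) :
    entropy P Xc - cEnt Q (fun ω => Xc ω.2) Prod.fst =
      (entropy P Z1c - cEnt Q (fun ω => Z1c ω.2) (fun ω => ω.1.1)) +
        (cEnt P Xc Z1c - cEnt Q (fun ω => Xc ω.2) (fun ω => (Z1c ω.2, ω.1.1, ω.1.2))) +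
        (cEnt Q (fun ω => Z1c ω.2) (fun ω => ω.1.1) - cEnt Q (fun ω => Z1c ω.2) Prod.fst) := by
  have hm := entropy_markov_map h.1.1 h.2.2 id fun y => y.2.2
  simp only [id] at hm
  have e1 : entropy Q (fun ω => (ω.1, Xc ω.2, Z1c ω.2)) =
      entropy Q (fun ω => (Xc ω.2, Z1c ω.2, ω.1.1, ω.1.2)) :=
    entropy_congr _ _ _ fun ω ω' => by simp only [Prod.ext_iff]; tauto
  have e2 : entropy Q (fun ω => (ω.1, Xc ω.2)) = entropy Q (fun ω => (Xc ω.2, ω.1)) :=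
    entropy_congr _ _ _ fun ω ω' => by simp only [Prod.ext_iff]; tauto
  have e3 : entropy Q (fun ω => (Z1c ω.2, ω.1)) = entropy Q (fun ω => (Z1c ω.2, ω.1.1, ω.1.2)) :=
    entropy_congr _ _ _ fun ω ω' => by simp only [Prod.ext_iff]
  have e4 := entropy_comp_snd h fun s => (Xc s, Z1c s)
  have e5 := entropy_comp_snd h Xc
  simp only [cEnt]
  linarith

/-- The difference of the two sides is I(U₁;X|U₀,Z₁), the exponent of the number of bins per centre.
-/
theorem IsAuxiliary.binning_nonneg (h : IsAuxiliary P Q) :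
    entropy P Xc - cEnt Q (fun ω => Xc ω.2) (fun ω => ω.1.1) ≤
      (entropy P Z1c - cEnt Q (fun ω => Z1c ω.2) (fun ω => ω.1.1)) +
        (cEnt P Xc Z1c - cEnt Q (fun ω => Xc ω.2) (fun ω => (Z1c ω.2, ω.1.1, ω.1.2))) := by
  have hm := entropy_markov_map h.1.1 h.2.2 Prod.fst fun y => y.2.2
  have hs := entropy_submodular h.1.1 (fun ω => Xc ω.2) (fun ω => ω.1.2) fun ω => (Z1c ω.2, ω.1.1)
  have e1 : entropy Q (fun ω => (ω.1.1, Xc ω.2, Z1c ω.2)) =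
      entropy Q (fun ω => (Xc ω.2, Z1c ω.2, ω.1.1)) :=
    entropy_congr _ _ _ fun ω ω' => by simp only [Prod.ext_iff]; tauto
  have e2 : entropy Q (fun ω => (ω.1.1, Xc ω.2)) = entropy Q (fun ω => (Xc ω.2, ω.1.1)) :=
    entropy_congr _ _ _ fun ω ω' => by simp only [Prod.ext_iff]; tauto
  have e3 : entropy Q (fun ω => (Xc ω.2, ω.1.2, Z1c ω.2, ω.1.1)) =
      entropy Q (fun ω => (Xc ω.2, Z1c ω.2, ω.1.1, ω.1.2)) :=
    entropy_congr _ _ _ fun ω ω' => by simp only [Prod.ext_iff]; tauto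
  have e6 : entropy Q (fun ω => (ω.1.2, Z1c ω.2, ω.1.1)) =
      entropy Q (fun ω => (Z1c ω.2, ω.1.1, ω.1.2)) :=
    entropy_congr _ _ _ fun ω ω' => by simp only [Prod.ext_iff]; tauto
  have e4 := entropy_comp_snd h fun s => (Xc s, Z1c s)
  have e5 := entropy_comp_snd h Xc
  simp only [cEnt]
  linarith

theorem tendsto_two_rpow_neg_nat_mul {δ : ℝ} (hδ : 0 < δ) :
    Tendsto (fun n : ℕ => (2 : ℝ) ^ (-((n : ℝ) * δ))) atTop (𝓝 0) := by
  have h1 : (2 : ℝ) ^ (-δ) < 1 := Real.rpow_lt_one_of_one_lt_of_neg one_lt_two (by linarith)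
  refine (tendsto_pow_atTop_nhds_zero_of_lt_one (by positivity) h1).congr fun n => ?_
  rw [← Real.rpow_natCast, ← Real.rpow_mul two_pos.le]
  ring_nf

theorem ceil_mul_ceil_le {n : ℕ} {x y δ R : ℝ} (hx : 0 ≤ x) (hy : 0 ≤ y) (hn : 2 ≤ n * δ)
    (hR : x + y + δ ≤ R) :
    ⌈(2 : ℝ) ^ (n * x)⌉₊ * ⌈(2 : ℝ) ^ (n * y)⌉₊ ≤ Fintype.card (Message n R) := by
  rw [Fintype.card_fin]
  refine Nat.le_succ_of_le (Nat.le_floor ?_)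
  have hn0 : (0 : ℝ) ≤ n := Nat.cast_nonneg n
  have h1 : (1 : ℝ) ≤ 2 ^ (n * x) := Real.one_le_rpow one_le_two (by positivity)
  have h2 : (1 : ℝ) ≤ 2 ^ (n * y) := Real.one_le_rpow one_le_two (by positivity)
  have c1 : (⌈(2 : ℝ) ^ (n * x)⌉₊ : ℝ) ≤ 2 * 2 ^ (n * x) :=
    (Nat.ceil_lt_add_one (by positivity)).le.trans (by linarith)
  have c2 : (⌈(2 : ℝ) ^ (n * y)⌉₊ : ℝ) ≤ 2 * 2 ^ (n * y) :=
    (Nat.ceil_lt_add_one (by positivity)).le.trans (by linarith)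
  have h4 : (4 : ℝ) ≤ 2 ^ (n * δ) := by
    calc (4 : ℝ) = 2 ^ (2 : ℝ) := by norm_num
      _ ≤ _ := Real.rpow_le_rpow_of_exponent_le one_le_two hn
  push_cast
  calc _ ≤ (2 * (2 : ℝ) ^ (n * x)) * (2 * 2 ^ (n * y)) := by gcongr
    _ = 4 * 2 ^ (n * x) * 2 ^ (n * y) := by ring
    _ ≤ 2 ^ (n * δ) * 2 ^ (n * x) * 2 ^ (n * y) := by gcongr
    _ = 2 ^ (n * (x + y + δ)) := by
        rw [← Real.rpow_add two_pos, ← Real.rpow_add two_pos]; ring_nf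
    _ ≤ _ := Real.rpow_le_rpow_of_exponent_le one_le_two (by gcongr)

theorem eventually_exists_code (hP : P ∈ stdSimplex ℝ (Src 𝒳 𝒴₁ 𝒴₂ 𝒵₁)) (h : IsAuxiliary P Q)
    {δ η R : ℝ} (hδ : 0 < δ) (hη : 0 < η)
    (hR : (entropy P Z1c - cEnt Q (fun ω => Z1c ω.2) (fun ω => ω.1.1)) +
        (cEnt P Xc Z1c - cEnt Q (fun ω => Xc ω.2) (fun ω => (Z1c ω.2, ω.1.1, ω.1.2))) + 5 * δ ≤ R) :
    ∀ᶠ n : ℕ in atTop, ∃ c : Code 𝒳 𝒴₁ 𝒴₂ 𝒵₁ n R, c.typeI₁ P + c.typeI₂ P ≤ η ∧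
      c.typeII₁ P ≤ 2 ^ (n * (-(cEnt P Y1c Z1c -
        cEnt Q (fun ω => Y1c ω.2) (fun ω => (Z1c ω.2, ω.1.1, ω.1.2))) + δ)) ∧
      c.typeII₂ P ≤ 2 ^ (n * (-(entropy P Y2c -
        cEnt Q (fun ω => Y2c ω.2) (fun ω => ω.1.1)) + δ)) := by
  classical
  have hQ := h.1
  have hi₀ := h.cEnt_le_entropy Xc fun ω => ω.1.1
  have hi₁ := h.covering_eq
  have hj := h.binning_nonneg
  set i₁ := entropy P Xc - cEnt Q (fun ω => Xc ω.2) Prod.fst with hi₁d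
  set i₀ := entropy P Xc - cEnt Q (fun ω => Xc ω.2) (fun ω => ω.1.1) with hi₀d
  set r := (entropy P Z1c - cEnt Q (fun ω => Z1c ω.2) (fun ω => ω.1.1)) +
        (cEnt P Xc Z1c - cEnt Q (fun ω => Xc ω.2) (fun ω => (Z1c ω.2, ω.1.1, ω.1.2))) with hr
  set J := cEnt Q (fun ω => Z1c ω.2) (fun ω => ω.1.1) - cEnt Q (fun ω => Z1c ω.2) Prod.fst with hJ
  have hμ := law_mem_stdSimplex hQ fun ω => (ω.1.1, ω.1.2, Xc ω.2)
  have hμpos : ∀ p : U × V × 𝒳, 0 < law Q (fun ω => (ω.1.1, ω.1.2, Xc ω.2)) p →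
      ∃ ω, 0 < Q ω ∧ (ω.1.1, ω.1.2, Xc ω.2) = p := fun p hp => by
    by_contra! hn
    rw [law_eq_sum_ite] at hp
    refine hp.ne' (sum_eq_zero fun ω _ => ?_)
    split_ifs with hω
    · exact le_antisymm (not_lt.1 fun h0 => hn ω h0 hω) (hQ.1 ω)
    · rfl
  have hX : ∑ ω, Q ω * Real.logb 2 (law P Xc (Xc ω.2)) = -entropy P Xc := by
    rw [h.sum_mul_comp fun s => Real.logb 2 (law P Xc (Xc s)), sum_mul_logb_law]
  have hsl := sum_law_mul Q fun ω => (ω.1.1, ω.1.2, Xc ω.2)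
  have S₁ := tendsto_sum_piLaw_mul_ite hμ
    (f := fun p => cProb Q (fun ω => Xc ω.2) Prod.fst p.2.2 (p.1, p.2.1))
    (g := fun p => law P Xc p.2.2)
    (fun p hp => by
      obtain ⟨ω, h0, rfl⟩ := hμpos p hp
      exact cProb_pos hQ.1 (fun ω => Xc ω.2) Prod.fst h0)
    (fun p hp => by
      obtain ⟨ω, h0, rfl⟩ := hμpos p hp
      exact law_pos hP.1 Xc (h.pos h0)) (m := i₁ + δ) (by
      rw [hsl fun p => Real.logb 2
        (cProb Q (fun ω => Xc ω.2) Prod.fst p.2.2 (p.1, p.2.1)),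
        hsl fun p => Real.logb 2 (law P Xc p.2.2), hX]
      have := sum_mul_logb_cProb hQ.1 (fun ω => Xc ω.2) Prod.fst
      simp only [Prod.mk.eta]
      rw [this]
      linarith)
  have S₀ := tendsto_sum_piLaw_mul_ite hμ
    (f := fun p => cProb Q (fun ω => Xc ω.2) (fun ω => ω.1.1) p.2.2 p.1)
    (g := fun p => law P Xc p.2.2)
    (fun p hp => by
      obtain ⟨ω, h0, rfl⟩ := hμpos p hp
      exact cProb_pos hQ.1 (fun ω => Xc ω.2) (fun ω => ω.1.1) h0)
    (fun p hp => by
      obtain ⟨ω, h0, rfl⟩ := hμpos p hp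
      exact law_pos hP.1 Xc (h.pos h0)) (m := i₀ + δ) (by
      rw [hsl fun p => Real.logb 2
        (cProb Q (fun ω => Xc ω.2) (fun ω => ω.1.1) p.2.2 p.1),
        hsl fun p => Real.logb 2 (law P Xc p.2.2), hX]
      have := sum_mul_logb_cProb hQ.1 (fun ω => Xc ω.2) (fun ω => ω.1.1)
      rw [this]
      linarith)
  have ST₁ := tendsto_sum_piLaw_mul_ite hQ
    (f := fun ω => cProb P Y1c Z1c (Y1c ω.2) (Z1c ω.2))
    (g := fun ω => cProb Q (fun ω => Y1c ω.2) (fun ω => (Z1c ω.2, ω.1.1, ω.1.2)) (Y1c ω.2)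
      (Z1c ω.2, ω.1.1, ω.1.2))
    (fun ω h0 => cProb_pos hP.1 Y1c Z1c (h.pos h0))
    (fun ω h0 => cProb_pos hQ.1 (fun ω => Y1c ω.2) (fun ω => (Z1c ω.2, ω.1.1, ω.1.2)) h0)
    (m := -(cEnt P Y1c Z1c -
        cEnt Q (fun ω => Y1c ω.2) (fun ω => (Z1c ω.2, ω.1.1, ω.1.2))) + δ) (by
      rw [h.sum_mul_comp fun s => Real.logb 2 (cProb P Y1c Z1c (Y1c s) (Z1c s)),
        sum_mul_logb_cProb hP.1,
        sum_mul_logb_cProb hQ.1 (fun ω => Y1c ω.2) (fun ω => (Z1c ω.2, ω.1.1, ω.1.2))]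
      linarith)
  have ST₂ := tendsto_sum_piLaw_mul_ite hQ
    (f := fun ω => law P Y2c (Y2c ω.2))
    (g := fun ω => cProb Q (fun ω => Y2c ω.2) (fun ω => ω.1.1) (Y2c ω.2) ω.1.1)
    (fun ω h0 => law_pos hP.1 Y2c (h.pos h0))
    (fun ω h0 => cProb_pos hQ.1 (fun ω => Y2c ω.2) (fun ω => ω.1.1) h0)
    (m := -(entropy P Y2c - cEnt Q (fun ω => Y2c ω.2) (fun ω => ω.1.1)) + δ) (by
      rw [h.sum_mul_comp fun s => Real.logb 2 (law P Y2c (Y2c s)), sum_mul_logb_law,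
        sum_mul_logb_cProb hQ.1 (fun ω => Y2c ω.2) (fun ω => ω.1.1)]
      linarith)
  have SG := tendsto_sum_piLaw_mul_ite hQ
    (f := fun ω => cProb Q (fun ω => Z1c ω.2) (fun ω => ω.1.1) (Z1c ω.2) ω.1.1)
    (g := fun ω => cProb Q (fun ω => Z1c ω.2) Prod.fst (Z1c ω.2) ω.1)
    (fun ω h0 => cProb_pos hQ.1 (fun ω => Z1c ω.2) (fun ω => ω.1.1) h0)
    (fun ω h0 => cProb_pos hQ.1 (fun ω => Z1c ω.2) Prod.fst h0) (m := -J + δ) (by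
      rw [sum_mul_logb_cProb hQ.1 (fun ω => Z1c ω.2) (fun ω => ω.1.1),
        sum_mul_logb_cProb hQ.1 (fun ω => Z1c ω.2) Prod.fst]
      linarith)
  have hx := tendsto_two_rpow_neg_nat_mul hδ
  have hlim := ((((hx.add hx).sqrt.add ((S₁.add S₀).const_mul 2)).const_mul 2).add
    ((ST₁.add SG).add ST₂)).add hx
  simp only [add_zero, Real.sqrt_zero, mul_zero] at hlim
  have hev : ∀ᶠ n : ℕ in atTop, 2 ≤ (n : ℝ) * δ := by
    filter_upwards [(tendsto_natCast_atTop_atTop (R := ℝ)).eventually_ge_atTop (2 / δ)] with n hn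
    rwa [div_le_iff₀ hδ] at hn
  filter_upwards [hlim.eventually_le_const hη, hev] with n hn hn2
  have hpos : ∀ e : ℝ, (0 : ℝ) < 2 ^ ((n : ℝ) * e) := fun e => by positivity
  -- The codebook has exponent `i₁ + 2δ` in all and `i₀ + 2δ` in centres, each `δ` above its
  -- covering threshold. Bins of exponent `J - 2δ` stay `δ` below what Z₁ resolves. Messages use `r
  -- + 4δ`, and the ceilings take the fifth `δ`. If the floor is 0, a bin still holds one satellite.
  obtain ⟨c, hc, hc1, hc2⟩ := exists_code_of_isAuxiliary hP h (n := n) (R := R)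
    (N₀ := ⌈(2 : ℝ) ^ (n * (i₀ + 2 * δ))⌉₊) (N₁ := ⌈(2 : ℝ) ^ (n * (r - i₀ + 2 * δ))⌉₊)
    (Nat.ceil_pos.2 (hpos _)) (Nat.ceil_pos.2 (hpos _)) ⌊(2 : ℝ) ^ (n * (J - 2 * δ))⌋₊
    (ceil_mul_ceil_le (by linarith) (by linarith) hn2 (by linarith))
    (hpos (i₁ + δ)).le (hpos (i₀ + δ)).le (hpos (-J + δ)).le (hpos _).le (hpos _).le
  refine ⟨c, ?_, hc1, hc2⟩
  refine hc.trans (le_trans ?_ hn)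
  have b₀ : (2 : ℝ) ^ (n * (i₀ + δ)) / (⌈(2 : ℝ) ^ (n * (i₀ + 2 * δ))⌉₊ : ℝ) ≤
      2 ^ (-((n : ℝ) * δ)) := by
    rw [div_le_iff₀ (by exact_mod_cast Nat.ceil_pos.2 (hpos _))]
    calc (2 : ℝ) ^ (n * (i₀ + δ)) = 2 ^ (-((n : ℝ) * δ)) * 2 ^ (n * (i₀ + 2 * δ)) := by
          rw [← Real.rpow_add two_pos]; ring_nf
      _ ≤ _ := by gcongr; exact Nat.le_ceil _
  have b₁ : (2 : ℝ) ^ (n * (i₁ + δ)) / ((⌈(2 : ℝ) ^ (n * (i₀ + 2 * δ))⌉₊ : ℝ) *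
      ((⌈(2 : ℝ) ^ (n * (r - i₀ + 2 * δ))⌉₊ : ℝ) * ((⌊(2 : ℝ) ^ (n * (J - 2 * δ))⌋₊ : ℝ) + 1))) ≤
      2 ^ (-((n : ℝ) * δ)) := by
    have p0 : (0 : ℝ) < ⌈(2 : ℝ) ^ (n * (i₀ + 2 * δ))⌉₊ := by exact_mod_cast Nat.ceil_pos.2 (hpos _)
    have p1 : (0 : ℝ) < ⌈(2 : ℝ) ^ (n * (r - i₀ + 2 * δ))⌉₊ := by
      exact_mod_cast Nat.ceil_pos.2 (hpos _)
    rw [div_le_iff₀ (by positivity)]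
    calc (2 : ℝ) ^ (n * (i₁ + δ)) = 2 ^ (-((n : ℝ) * δ)) * (2 ^ (n * (i₀ + 2 * δ)) *
          (2 ^ (n * (r - i₀ + 2 * δ)) * 2 ^ (n * (J - 2 * δ)))) := by
          rw [← Real.rpow_add two_pos, ← Real.rpow_add two_pos, ← Real.rpow_add two_pos, hi₁]
          ring_nf
      _ ≤ _ := by
          gcongr
          · exact Nat.le_ceil _
          · exact Nat.le_ceil _
          · exact (Nat.lt_floor_add_one _).le
  have b₂ : (⌊(2 : ℝ) ^ (n * (J - 2 * δ))⌋₊ : ℝ) * 2 ^ (n * (-J + δ)) ≤ 2 ^ (-((n : ℝ) * δ)) := by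
    calc _ ≤ (2 : ℝ) ^ (n * (J - 2 * δ)) * 2 ^ (n * (-J + δ)) := by
          gcongr; exact Nat.floor_le (hpos _).le
      _ = _ := by rw [← Real.rpow_add two_pos]; ring_nf
  refine add_le_add (add_le_add (mul_le_mul_of_nonneg_left (add_le_add
    (Real.sqrt_le_sqrt (add_le_add b₁ b₀)) (le_of_eq ?_)) two_pos.le) (le_of_eq ?_)) b₂
  · congr!
  · congr!

end Asymptotics

/-! ### The inner region lies in the exponents region. -/

section Achievability

open Filter Topology

variable {𝒳 𝒴₁ 𝒴₂ 𝒵₁ : Type*} [Fintype 𝒳] [Fintype 𝒴₁] [Fintype 𝒴₂] [Fintype 𝒵₁]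
  {P : Src 𝒳 𝒴₁ 𝒴₂ 𝒵₁ → ℝ} {R : ℝ}

theorem exists_forall_of_eventually_exists {C : ℕ → Type*} (c₀ : ∀ n, C n) {p : ∀ n, C n → Prop}
    (h : ∀ᶠ n in atTop, ∃ c, p n c) : ∃ c : ∀ n, C n, ∀ᶠ n in atTop, p n (c n) := by
  classical
  refine ⟨fun n => if hn : ∃ c, p n c then hn.choose else c₀ n, h.mono fun n hn => ?_⟩
  simp only [dif_pos hn]
  exact hn.choose_spec

/-- The code that sends message `0` and always decides for the null hypothesis. -/
def trivialCode (𝒳 𝒴₁ 𝒴₂ 𝒵₁ : Type*) (n : ℕ) (R : ℝ) : Code 𝒳 𝒴₁ 𝒴₂ 𝒵₁ n R where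
  enc _ m := if m = 0 then 1 else 0
  enc_mem _ := ⟨fun m => by dsimp only; split_ifs <;> norm_num, by simp⟩
  dec₁ _ _ _ := 0
  dec₂ _ _ := 0

theorem trivialCode_typeI₁ (P : Src 𝒳 𝒴₁ 𝒴₂ 𝒵₁ → ℝ) (n : ℕ) (R : ℝ) :
    (trivialCode 𝒳 𝒴₁ 𝒴₂ 𝒵₁ n R).typeI₁ P = 0 := by
  rw [Code.typeI₁, law_eq_sum_ite]
  exact sum_eq_zero fun ω _ => if_neg (by simp [Code.decision₁, trivialCode])

theorem trivialCode_typeI₂ (P : Src 𝒳 𝒴₁ 𝒴₂ 𝒵₁ → ℝ) (n : ℕ) (R : ℝ) :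
    (trivialCode 𝒳 𝒴₁ 𝒴₂ 𝒵₁ n R).typeI₂ P = 0 := by
  rw [Code.typeI₂, law_eq_sum_ite]
  exact sum_eq_zero fun ω _ => if_neg (by simp [Code.decision₂, trivialCode])

theorem le_errorExponent_of_lt {β : ℕ → ℝ} {θ I : ℝ} (h0 : ∀ n, 0 ≤ β n) (h1 : ∀ n, β n ≤ 1)
    {δ : ℝ} (hθ : θ ≤ 0 ∨ θ + δ ≤ I) (h : 0 < θ → ∀ᶠ n : ℕ in atTop, β n ≤ 2 ^ (n * (-I + δ))) :
    (θ : EReal) ≤ errorExponent β := by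
  refine le_errorExponent h0 ?_
  by_cases hθ0 : θ ≤ 0
  · exact Eventually.of_forall fun n => (h1 n).trans (Real.one_le_rpow one_le_two
      (neg_nonneg.2 (mul_nonpos_of_nonneg_of_nonpos (Nat.cast_nonneg n) hθ0)))
  · filter_upwards [h (not_le.1 hθ0)] with n hn
    refine hn.trans (Real.rpow_le_rpow_of_exponent_le one_le_two ?_)
    rw [← mul_neg]
    exact mul_le_mul_of_nonneg_left (by linarith [hθ.resolve_left hθ0]) (Nat.cast_nonneg n)

theorem epsAchievable_of_nonpos (hP : P ∈ stdSimplex ℝ (Src 𝒳 𝒴₁ 𝒴₂ 𝒵₁)) {ε θ₁ θ₂ : ℝ}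
    (hε : 0 < ε) (h₁ : θ₁ ≤ 0) (h₂ : θ₂ ≤ 0) : EpsAchievable P ε θ₁ θ₂ R := by
  have hj := fun n => jointLaw_mem (trivialCode 𝒳 𝒴₁ 𝒴₂ 𝒵₁ n R) (altLaw_mem hP)
  refine ⟨fun n => trivialCode 𝒳 𝒴₁ 𝒴₂ 𝒵₁ n R, Eventually.of_forall fun n => ?_, ?_, ?_⟩
  · simp [trivialCode_typeI₁, trivialCode_typeI₂, hε.le]
  · exact le_errorExponent_of_lt (I := 0) (δ := 0) (fun n => law_nonneg (hj n).1 _ _)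
      (fun n => law_le_one (hj n) _ _) (Or.inl h₁) fun h => absurd h h₁.not_gt
  · exact le_errorExponent_of_lt (I := 0) (δ := 0) (fun n => law_nonneg (hj n).1 _ _)
      (fun n => law_le_one (hj n) _ _) (Or.inl h₂) fun h => absurd h h₂.not_gt

/-- Strict slack in the rate and in each positive exponent leaves room for a common `δ`; an exponent
that is not positive asks for nothing beyond `β ≤ 1`. -/
theorem epsAchievable_of_mem_triples (hP : P ∈ stdSimplex ℝ (Src 𝒳 𝒴₁ 𝒴₂ 𝒵₁)) {t₁ t₂ r : ℝ}
    (h : (t₁, t₂, r) ∈ triples P) (hr : r < R) {ε θ₁ θ₂ : ℝ} (hε : 0 < ε)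
    (h₁ : θ₁ ≤ 0 ∨ θ₁ < t₁) (h₂ : θ₂ ≤ 0 ∨ θ₂ < t₂) : EpsAchievable P ε θ₁ θ₂ R := by
  obtain ⟨c, d, a, b, hh, ht₁, ht₂, hrate⟩ := h
  obtain ⟨k₀, k₁, Q, hQ, rfl, rfl, rfl, rfl⟩ := exists_isAuxiliary_of_mem_hull₀ hh
  dsimp only at ht₁ ht₂ hrate
  obtain ⟨δ, hδ, hδR, hδ₁, hδ₂⟩ : ∃ δ : ℝ, 0 < δ ∧ r + 5 * δ ≤ R ∧ (θ₁ ≤ 0 ∨ θ₁ + δ ≤ t₁) ∧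
      (θ₂ ≤ 0 ∨ θ₂ + δ ≤ t₂) := by
    have key : ∀ {θ t : ℝ}, (θ ≤ 0 ∨ θ < t) → ∃ δ, 0 < δ ∧ (θ ≤ 0 ∨ θ + δ ≤ t) := by
      rintro θ t (h | h)
      · exact ⟨1, one_pos, Or.inl h⟩
      · exact ⟨t - θ, sub_pos.2 h, Or.inr (by linarith)⟩
    obtain ⟨δ₁, p₁, q₁⟩ := key h₁
    obtain ⟨δ₂, p₂, q₂⟩ := key h₂
    have m₁ := min_le_left ((R - r) / 5) (min δ₁ δ₂)
    have m₂ := (min_le_right ((R - r) / 5) (min δ₁ δ₂)).trans (min_le_left _ _)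
    have m₃ := (min_le_right ((R - r) / 5) (min δ₁ δ₂)).trans (min_le_right _ _)
    exact ⟨min ((R - r) / 5) (min δ₁ δ₂), lt_min (by linarith) (lt_min p₁ p₂), by linarith,
      q₁.imp_right fun h => by linarith, q₂.imp_right fun h => by linarith⟩
  have hev := eventually_exists_code hP hQ hδ hε (R := R) (by linarith)
  obtain ⟨c, hc⟩ := exists_forall_of_eventually_exists
    (fun n => trivialCode 𝒳 𝒴₁ 𝒴₂ 𝒵₁ n R) hev
  have hp := fun n => jointLaw_mem (c n) hP
  have hj := fun n => jointLaw_mem (c n) (altLaw_mem hP)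
  refine ⟨c, ?_, ?_, ?_⟩
  · filter_upwards [hc] with n hn
    have n1 : 0 ≤ (c n).typeI₁ P := law_nonneg (hp n).1 _ _
    have n2 : 0 ≤ (c n).typeI₂ P := law_nonneg (hp n).1 _ _
    exact ⟨by linarith [hn.1], by linarith [hn.1]⟩
  · exact le_errorExponent_of_lt (fun n => law_nonneg (hj n).1 _ _) (fun n => law_le_one (hj n) _ _)
      (hδ₁.imp_right fun h => h.trans ht₁) fun _ => hc.mono fun n hn => hn.2.1
  · exact le_errorExponent_of_lt (fun n => law_nonneg (hj n).1 _ _) (fun n => law_le_one (hj n) _ _)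
      (hδ₂.imp_right fun h => h.trans ht₂) fun _ => hc.mono fun n hn => hn.2.2

theorem IsAuxiliary.cEnt_le {U τ σ β : Type*} [Fintype U] [Fintype τ] [Fintype σ] [Fintype β]
    {Q : U × Src 𝒳 𝒴₁ 𝒴₂ 𝒵₁ → ℝ} (h : IsAuxiliary P Q) (f : Src 𝒳 𝒴₁ 𝒴₂ 𝒵₁ → τ)
    (g : Src 𝒳 𝒴₁ 𝒴₂ 𝒵₁ → σ) (B : U × Src 𝒳 𝒴₁ 𝒴₂ 𝒵₁ → β) :
    cEnt Q (fun ω => f ω.2) (fun ω => (g ω.2, B ω)) ≤ cEnt P f g := by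
  have := entropy_sub_anti h.1.1 (fun ω => f ω.2) (fun ω => (g ω.2, B ω)) (fun ω => g ω.2)
    fun ω ω' hω => (Prod.ext_iff.1 hω).1
  have e := entropy_comp_snd h fun s => (f s, g s)
  have e' := entropy_comp_snd h g
  simp only [cEnt]
  linarith

/-- Data processing: `I(U; Y₁ | Z₁) ≤ I(U; X | Z₁)`. -/
theorem IsAuxiliary.data_processing {U V : Type*} [Fintype U] [Fintype V]
    {Q : (U × V) × Src 𝒳 𝒴₁ 𝒴₂ 𝒵₁ → ℝ} (h : IsAuxiliary P Q) :
    cEnt P Y1c Z1c - cEnt Q (fun ω => Y1c ω.2) (fun ω => (Z1c ω.2, ω.1.1, ω.1.2)) ≤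
      cEnt P Xc Z1c - cEnt Q (fun ω => Xc ω.2) (fun ω => (Z1c ω.2, ω.1.1, ω.1.2)) := by
  have m1 := entropy_markov_map h.1.1 h.2.2 id fun y => y.2.2
  have m2 := entropy_markov_map h.1.1 h.2.2 id fun y => (y.1, y.2.2)
  have hs := entropy_submodular h.1.1 (fun ω => Xc ω.2) (fun ω => ω.1) fun ω => (Y1c ω.2, Z1c ω.2)
  simp only [id] at m1 m2
  have e1 : entropy Q (fun ω => (ω.1, Xc ω.2, Z1c ω.2)) =
      entropy Q (fun ω => (Xc ω.2, Z1c ω.2, ω.1.1, ω.1.2)) :=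
    entropy_congr _ _ _ fun ω ω' => by simp only [Prod.ext_iff]; tauto
  have e2 : entropy Q (fun ω => (ω.1, Xc ω.2, Y1c ω.2, Z1c ω.2)) =
      entropy Q (fun ω => (Xc ω.2, ω.1, Y1c ω.2, Z1c ω.2)) :=
    entropy_congr _ _ _ fun ω ω' => by simp only [Prod.ext_iff]; tauto
  have e3 : entropy Q (fun ω => (ω.1, Y1c ω.2, Z1c ω.2)) =
      entropy Q (fun ω => (Y1c ω.2, Z1c ω.2, ω.1.1, ω.1.2)) :=
    entropy_congr _ _ _ fun ω ω' => by simp only [Prod.ext_iff]; tauto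
  have e4 := entropy_comp_snd h fun s => (Xc s, Z1c s)
  have e5 := entropy_comp_snd h fun s => (Y1c s, Z1c s)
  simp only [cEnt]
  linarith

/-- I(U₀;Z₁) and I(U₀,U₁;X|Z₁) are nonnegative and sum to at most 0, so both vanish. The first
bounds I(U₀;Y₂) by less noisiness, the second I(U₀,U₁;Y₁|Z₁) by data processing. -/
theorem nonpos_of_mem_triples_zero (hZY : LessNoisy P) {t₁ t₂ : ℝ} (h : (t₁, t₂, 0) ∈ triples P) :
    t₁ ≤ 0 ∧ t₂ ≤ 0 := by
  obtain ⟨c, d, a, b, hh, ht₁, ht₂, hrate⟩ := h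
  have hZ := hZY.sub_le_sub hh
  obtain ⟨k₀, k₁, Q, hQ, rfl, rfl, rfl, rfl⟩ := exists_isAuxiliary_of_mem_hull₀ hh
  have h1 := hQ.cEnt_le_entropy Z1c fun ω => ω.1.1
  have h2 := hQ.cEnt_le Xc Z1c fun ω => (ω.1.1, ω.1.2)
  have h3 := hQ.data_processing
  dsimp only at ht₁ ht₂ hrate
  constructor <;> linarith

theorem innerRegion_subset_region (hP : P ∈ stdSimplex ℝ (Src 𝒳 𝒴₁ 𝒴₂ 𝒵₁)) (hZY : LessNoisy P)
    (hR : 0 ≤ R) : innerRegion P R ⊆ region P R := by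
  rintro ⟨θ₁, θ₂⟩ hθ
  obtain ⟨hθ₁, hθ₂, ht⟩ := mem_innerRegion_iff.1 hθ
  dsimp only at hθ₁ hθ₂ ht
  rcases hR.eq_or_lt with rfl | hR
  -- At rate zero, shrinking frees no rate, but the trivial code already attains the zero exponents.
  · obtain ⟨h1, h2⟩ := nonpos_of_mem_triples_zero hZY ht
    exact subset_closure ⟨hθ₁, hθ₂, fun ε hε => epsAchievable_of_nonpos hP hε.1 h1 h2⟩
  -- Scaling by `l < 1` frees rate; subtracting `1 - l` makes the exponent inequalities strict, and
  -- the maximum keeps the targets nonnegative.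
  · have hlim : Tendsto (fun l : ℝ => (max (l * θ₁ - (1 - l)) 0, max (l * θ₂ - (1 - l)) 0))
        (𝓝[<] 1) (𝓝 (θ₁, θ₂)) := by
      have hc : Continuous fun l : ℝ =>
        (max (l * θ₁ - (1 - l)) 0, max (l * θ₂ - (1 - l)) 0) := by fun_prop
      have := (hc.tendsto 1).mono_left (nhdsWithin_le_nhds (s := Set.Iio 1))
      simpa [hθ₁, hθ₂] using this
    refine mem_closure_of_tendsto hlim ?_
    filter_upwards [Ioo_mem_nhdsLT (show (0 : ℝ) < 1 from one_pos)] with l hl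
    refine ⟨le_max_right _ _, le_max_right _ _, fun ε hε => ?_⟩
    have hs := scale_mem_triples hP ht hl.1.le hl.2.le
    simp only [Prod.smul_mk, smul_eq_mul] at hs
    refine epsAchievable_of_mem_triples hP hs (mul_lt_of_lt_one_left hR hl.2) hε.1 ?_ ?_
    · rcases max_choice (l * θ₁ - (1 - l)) 0 with h | h
      · right; rw [h]; linarith [hl.2]
      · left; exact h.le
    · rcases max_choice (l * θ₂ - (1 - l)) 0 with h | h
      · right; rw [h]; linarith [hl.2]
      · left; exact h.le

end Achievability

end HeegardBerger

end

theorem theorem3 {𝒳 𝒴₁ 𝒴₂ 𝒵₁ : Type*}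
    [Fintype 𝒳] [Fintype 𝒴₁] [Fintype 𝒴₂] [Fintype 𝒵₁]
    (P : HeegardBerger.Src 𝒳 𝒴₁ 𝒴₂ 𝒵₁ → ℝ)
    (hP : P ∈ stdSimplex ℝ (HeegardBerger.Src 𝒳 𝒴₁ 𝒴₂ 𝒵₁))
    (hZY : HeegardBerger.LessNoisy P) (R : ℝ) (hR : 0 ≤ R) :
    HeegardBerger.innerRegion P R = HeegardBerger.region P R := by
  exact Set.Subset.antisymm (HeegardBerger.innerRegion_subset_region hP hZY hR)
    (HeegardBerger.region_subset_innerRegion hP hZY hR)
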